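/- For a polynomial curve $\Gamma=(P_1,P_2,P_3)$, $P_i\in\mathbb{C}[z]$, put $L_1=P_1'$, $L_2=P_1'P_2''-P_1''P_2'$, $L_3=L_\Gamma=\det(\Gamma',\Gamma'',\Gamma''')$, let $\Phi_\Gamma(z_1,z_2,z_3)=\Gamma(z_1)+\Gamma(z_2)+\Gamma(z_3)$, and let $J_{\Phi_\Gamma}$ be the complex Jacobian determinant of $\Phi_\Gamma:\mathbb{C}^3\to\mathbb{C}^3$. For $\varepsilon>0$ and $K\ge 1$, call a set $B\subset\mathbb{C}$ an $(\varepsilon,K)$-piece for $\Gamma$ with centre $b\in\mathbb{C}$ and exponents $(k_1,k_2,k_3)\in\mathbb{Z}_{\ge0}^3$, where $k_i\le\deg L_i$, if $B$ is convex; $B-b$ is contained in a closed sector of aperture $\varepsilon$ with vertex $0$; and, for $i=1,2,3$, the image $L_i(B)$ is contained in a closed sector of aperture $\varepsilon$ with vertex $0$ and there is $A_i>0$ with $$K^{-1}A_i|z-b|^{k_i}\le |L_i(z)|\le K A_i|z-b|^{k_i}\qquad\text{for all } z\in B.$$ Set $\sigma_2=k_2-2k_1$ and $\sigma_3=k_3+k_1-2k_2$,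 the exponents of $L_2/L_1^2$ and $L_1L_3/L_2^2$. **Lemma 3.1.** For every $N$ there is $\varepsilon=\varepsilon(N)>0$ such that the following two statements hold. 1. There are $M=M(N)$ and $K=K(N)\ge1$ such that, for every polynomial curve $\Gamma$ of degree at most $N$ with $L_\Gamma\not\equiv0$, $\mathbb{C}$ is the disjoint union of $M$ (possibly empty) $(\varepsilon,K)$-pieces for $\Gamma$, each with its own centre and exponents. 2. For every $K\ge1$ there is $c=c(N,K)>0$ such that, for every polynomial curve $\Gamma$ of degree at most $N$ with $L_\Gamma\not\equiv 0$ and every $(\varepsilon,K)$-piece $B$ for $\Gamma$ whose exponents satisfy $\sigma_3\ne-1$ and either $\sigma_2+\frac{\sigma_3}{2}<-2$ or $\sigma_2+\frac{\sigma_3}{2}\ge0$, $$|J_{\Phi_\Gamma}(z_1,z_2,z_3)|\ \ge\ c\prod_{i=1}^3|L_\Gamma(z_i)|^{1/3}\prod_{1\le i<j\le3}|z_j-z_i|\qquad\text{for all }z_1,z_2,z_3\in B.$$ In particular, with the $K=K(N)$ of the first statement, the inequality holds with a constant depending only on $N$ on every set of the decomposition whose exponents satisfy these conditions. -/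

import Mathlib

open Polynomial

noncomputable section

namespace GeomIneq

/-- A complex polynomial curve `Γ(z) = (P₁(z), P₂(z), P₃(z))`. -/
abbrev Curve : Type := Fin 3 → ℂ[X]

/-- `Γ` has degree at most `N`. -/
def Curve.DegreeLE (Γ : Curve) (N : ℕ) : Prop := ∀ i, (Γ i).natDegree ≤ N

/-- `L₁ = P₁'`. -/
def L₁ (Γ : Curve) : ℂ[X] := derivative (Γ 0)

/-- `L₂ = det (P₁' P₁''; P₂' P₂'')`. -/
def L₂ (Γ : Curve) : ℂ[X] :=
  Matrix.det !![derivative (Γ 0), derivative^[2] (Γ 0);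
                derivative (Γ 1), derivative^[2] (Γ 1)]

/-- `L₃ = L_Γ = det (Γ', Γ'', Γ''')`, as a polynomial. -/
def L₃ (Γ : Curve) : ℂ[X] :=
  Matrix.det (Matrix.of fun i j : Fin 3 => derivative^[(j : ℕ) + 1] (Γ i))

/-- The family `(L₁, L₂, L₃)`. -/
def L (Γ : Curve) : Fin 3 → ℂ[X] := ![L₁ Γ, L₂ Γ, L₃ Γ]

/-- `Φ_Γ(z₁, z₂, z₃) = Γ(z₁) + Γ(z₂) + Γ(z₃)`, a map from `ℂ³` to `ℂ³`. -/
def Φ (Γ : Curve) (z : Fin 3 → ℂ) : Fin 3 → ℂ :=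
  fun i => ∑ s, (Γ i).eval (z s)

/-- The (complex) Jacobian determinant of `Φ_Γ`. -/
def jacobian (Γ : Curve) (z : Fin 3 → ℂ) : ℂ := (fderiv ℂ (Φ Γ) z).det

/-- `S` is contained in a closed sector of aperture `ε` with vertex `0`. -/
def InSector (ε : ℝ) (S : Set ℂ) : Prop :=
  ∃ θ₀ : ℝ, ∀ w ∈ S, ∃ r θ : ℝ,
    0 ≤ r ∧ θ₀ ≤ θ ∧ θ ≤ θ₀ + ε ∧ w = r * Complex.exp (θ * Complex.I)

/-- `|Q(z)| ∼ A |z - b|ᵏ` on `B` with implicit constant `K`, for some `A > 0`;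
here `k` is at most the degree of `Q`. -/
def MonomialOn (K : ℝ) (Q : ℂ[X]) (B : Set ℂ) (b : ℂ) (k : ℕ) : Prop :=
  k ≤ Q.natDegree ∧
  ∃ A : ℝ, 0 < A ∧ ∀ z ∈ B,
    K⁻¹ * (A * ‖z - b‖ ^ k) ≤ ‖Q.eval z‖ ∧ ‖Q.eval z‖ ≤ K * (A * ‖z - b‖ ^ k)

/-- A set `B` of the kind produced by the decomposition, with centre `b` and exponents
`k = (k₁, k₂, k₃)`: it is convex, it lies in a sector of aperture `ε` with vertex `b`, each
`Lᵢ` behaves on it like a monomial in `z - b` of degree `kᵢ`, and each `Lᵢ` maps it into a sector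
of aperture `ε`. -/
structure IsPiece (Γ : Curve) (ε K : ℝ) (B : Set ℂ) (b : ℂ) (k : Fin 3 → ℕ) : Prop where
  convex : Convex ℝ B
  sector : InSector ε ((fun z => z - b) '' B)
  monomial : ∀ i, MonomialOn K (L Γ i) B b (k i)
  sector_L : ∀ i, InSector ε ((fun z => (L Γ i).eval z) '' B)

/-- The exponent of `L₂ / L₁²`. -/
def σ₂ (k : Fin 3 → ℕ) : ℤ := (k 1 : ℤ) - 2 * k 0

/-- The exponent of `L₁ L₃ / L₂²`. -/
def σ₃ (k : Fin 3 → ℕ) : ℤ := (k 2 : ℤ) + k 0 - 2 * k 1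

/-- The condition on the exponents: `σ₃ ≠ -1`, and `σ₂ + σ₃/2 < -2` or `σ₂ + σ₃/2 ≥ 0`. -/
def Admissible (k : Fin 3 → ℕ) : Prop :=
  σ₃ k ≠ -1 ∧ ((σ₂ k : ℝ) + (σ₃ k : ℝ) / 2 < -2 ∨ 0 ≤ (σ₂ k : ℝ) + (σ₃ k : ℝ) / 2)

end GeomIneq

end

/-! Put f = P₂'/P₁' and g = P₃'/P₁'. Then f' = u with u = L₂/L₁², and g' = hu with h' = v, v =
L₁L₃/L₂² (`wronskian_identity`). The Jacobian is L₁(z₁)L₁(z₂)L₁(z₃) times the determinant with rows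
(1, f(zᵢ), g(zᵢ)). Base this determinant at z₂, write a₁ = z₁ - z₂ and a₃ = z₃ - z₂, and subtract
h(z₂) times the f-column from the g-column. Up to a unimodular factor it becomes a₁a₃(a₃P₁Q₃ -
a₁P₃Q₁), where Pᵢ is a normalized integral of u along a side and Qᵢ a normalized iterated integral
of u∫v (`jacobian_eq_sides`).

On a piece, u and v have values in narrow sectors, and convexity keeps the sides inside the piece,
so after rotation all Pᵢ, Qᵢ lie in narrow cones around the positive axis. If z₂ is the vertex
opposite the longest side, a₁ and a₃ form an angle of at least sixty degrees and the two terms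
cannot cancel (`norm_sub_ge_of_angle`). What remains is an inequality between positive reals.

With s = σ₂ and t = σ₃, |u| and |v| behave like |z - b|^s and |z - b|^t, so Pᵢ and Qᵢ are bounded
below by powers of the radii (`SideData.lower_bounds`). The target carries (x₁x₂x₃)^q with 3q = 2s +
t, where the xᵢ are the radii. Trading powers of a smaller radius for powers of a larger one proves
the real inequality (`exists_radial_bound`), by a finite discussion of linear inequalities between s
and t, unless s = -1 or (s, t) = (-3, 1).

In these two cases the model integrals contain a logarithm, and the polynomial structure is needed.
If the radii in the piece had a large ratio, some circle around b would run through an annulus free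
of roots, where each Lᵢ is nearly a monomial. Then f', or the derivative of g minus a multiple of f,
would have a nonzero residue term there, although its primitive is single-valued on the circle. So
the radii are comparable (`exists_radii_ratio_bound`), and powers of them may be exchanged freely.

For the decomposition the centre of a cell is a nearest point among the listed roots of L₁, L₂, L₃.
Every other linear factor is comparable either to |z - b| or to a constant. Cutting with ℓ¹ balls
inside quadrants instead of discs keeps all cells convex. -/

noncomputable section

namespace GeomIneq

/-! ### Determinant identities and degrees of the polynomials Lᵢ. -/

/-- The numerator `P₁'P₃'' - P₁''P₃'`. -/
def wronskian₁₃ (Γ : Curve) : ℂ[X] :=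
  derivative (Γ 0) * derivative^[2] (Γ 2) - derivative^[2] (Γ 0) * derivative (Γ 2)

lemma L₂_eq (Γ : Curve) : L₂ Γ =
    derivative (Γ 0) * derivative^[2] (Γ 1) - derivative^[2] (Γ 0) * derivative (Γ 1) := by
  simp [L₂, Matrix.det_fin_two]

lemma L₃_eq (Γ : Curve) : L₃ Γ =
    derivative (Γ 0) * derivative^[2] (Γ 1) * derivative^[3] (Γ 2)
    - derivative (Γ 0) * derivative^[3] (Γ 1) * derivative^[2] (Γ 2)
    - derivative^[2] (Γ 0) * derivative (Γ 1) * derivative^[3] (Γ 2)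
    + derivative^[2] (Γ 0) * derivative^[3] (Γ 1) * derivative (Γ 2)
    + derivative^[3] (Γ 0) * derivative (Γ 1) * derivative^[2] (Γ 2)
    - derivative^[3] (Γ 0) * derivative^[2] (Γ 1) * derivative (Γ 2) := by
  simp [L₃, Matrix.det_fin_three]

/-- This is the identity behind h' = L₁L₃/L₂². It also shows that L₂ cannot vanish identically when
L₃ does not. -/
lemma wronskian_identity (Γ : Curve) :
    derivative (wronskian₁₃ Γ) * L₂ Γ - wronskian₁₃ Γ * derivative (L₂ Γ) = L₁ Γ * L₃ Γ := by
  rw [L₂_eq, L₃_eq, wronskian₁₃, L₁]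
  simp only [derivative_sub, derivative_mul, Function.iterate_succ, Function.comp,
    Function.iterate_zero, id]
  ring

lemma L₁_ne_zero {Γ : Curve} (h : L₃ Γ ≠ 0) : L₁ Γ ≠ 0 := by
  intro h1
  apply h
  rw [L₁] at h1
  rw [L₃_eq]
  simp [h1]

lemma L₂_ne_zero {Γ : Curve} (h : L₃ Γ ≠ 0) : L₂ Γ ≠ 0 := by
  intro h2
  have := wronskian_identity Γ
  rw [h2] at this
  simp at this
  exact this.elim (L₁_ne_zero h) h

lemma L_ne_zero {Γ : Curve} (h : L₃ Γ ≠ 0) (i : Fin 3) : L Γ i ≠ 0 := by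
  fin_cases i
  · exact L₁_ne_zero h
  · exact L₂_ne_zero h
  · exact h

lemma natDegree_iterate_derivative_le' {P : ℂ[X]} {N : ℕ} (h : P.natDegree ≤ N) (m : ℕ) :
    (derivative^[m] P).natDegree ≤ N :=
  (natDegree_iterate_derivative P m).trans ((Nat.sub_le _ _).trans h)

lemma natDegree_L_le {Γ : Curve} {N : ℕ} (h : Γ.DegreeLE N) (i : Fin 3) :
    (L Γ i).natDegree ≤ 3 * N := by
  have H : ∀ j m, (derivative^[m] (Γ j)).natDegree ≤ N :=
    fun j m => natDegree_iterate_derivative_le' (h j) m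
  have H1 : ∀ j, (derivative (Γ j)).natDegree ≤ N := fun j => H j 1
  have M2 : ∀ {p q : ℂ[X]}, p.natDegree ≤ N → q.natDegree ≤ N → (p * q).natDegree ≤ 2 * N := by
    intro p q hp hq
    exact natDegree_mul_le.trans (by omega)
  have M3 : ∀ {p q r : ℂ[X]}, p.natDegree ≤ N → q.natDegree ≤ N → r.natDegree ≤ N →
      (p * q * r).natDegree ≤ 3 * N := by
    intro p q r hp hq hr
    have := M2 hp hq
    exact natDegree_mul_le.trans (by omega)
  fin_cases i
  · show (L₁ Γ).natDegree ≤ _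
    have := H1 0
    rw [L₁]; omega
  · show (L₂ Γ).natDegree ≤ _
    rw [L₂_eq]
    refine (natDegree_sub_le_of_le (M2 ?_ ?_) (M2 ?_ ?_)).trans (by omega) <;> first | with_reducible exact H1 _ | with_reducible exact H _ _
  · show (L₃ Γ).natDegree ≤ _
    rw [L₃_eq]
    refine (natDegree_sub_le_of_le (natDegree_add_le_of_le (natDegree_add_le_of_le
      (natDegree_sub_le_of_le (natDegree_sub_le_of_le (M3 ?_ ?_ ?_) (M3 ?_ ?_ ?_))
      (M3 ?_ ?_ ?_)) (M3 ?_ ?_ ?_)) (M3 ?_ ?_ ?_)) (M3 ?_ ?_ ?_)).trans (by simp) <;> first | with_reducible exact H1 _ | with_reducible exact H _ _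

lemma jacobian_eq_det (Γ : Curve) (z : Fin 3 → ℂ) :
    jacobian Γ z = Matrix.det (Matrix.of fun i s : Fin 3 => (derivative (Γ i)).eval (z s)) := by
  set M : Matrix (Fin 3) (Fin 3) ℂ := Matrix.of fun i s => (derivative (Γ i)).eval (z s) with hM
  have h : HasFDerivAt (Φ Γ) (LinearMap.toContinuousLinearMap (Matrix.toLin' M)) z := by
    rw [hasFDerivAt_pi']
    intro i
    have h1 : ∀ s : Fin 3, HasFDerivAt (fun z : Fin 3 → ℂ => (Γ i).eval (z s))
        (((derivative (Γ i)).eval (z s)) • (ContinuousLinearMap.proj s : (Fin 3 → ℂ) →L[ℂ] ℂ)) z := by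
      intro s
      exact ((Γ i).hasDerivAt (z s)).comp_hasFDerivAt z
        (ContinuousLinearMap.proj s : (Fin 3 → ℂ) →L[ℂ] ℂ).hasFDerivAt
    have h2 := HasFDerivAt.fun_sum (u := Finset.univ) fun s _ => h1 s
    refine h2.congr_fderiv ?_
    ext v
    simp [hM, Matrix.toLin'_apply, Matrix.mulVec, dotProduct]
  rw [jacobian, h.fderiv]
  show LinearMap.det (Matrix.toLin' M) = _
  rw [LinearMap.det_toLin']

lemma jacobian_formula (Γ : Curve) (a b c : ℂ) :
    jacobian Γ ![a, b, c] =
      (derivative (Γ 0)).eval a * (derivative (Γ 1)).eval b * (derivative (Γ 2)).eval c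
    - (derivative (Γ 0)).eval a * (derivative (Γ 1)).eval c * (derivative (Γ 2)).eval b
    - (derivative (Γ 0)).eval b * (derivative (Γ 1)).eval a * (derivative (Γ 2)).eval c
    + (derivative (Γ 0)).eval b * (derivative (Γ 1)).eval c * (derivative (Γ 2)).eval a
    + (derivative (Γ 0)).eval c * (derivative (Γ 1)).eval a * (derivative (Γ 2)).eval b
    - (derivative (Γ 0)).eval c * (derivative (Γ 1)).eval b * (derivative (Γ 2)).eval a := by
  rw [jacobian_eq_det]
  simp [Matrix.det_fin_three]

/-! ### Sectors, and how sign conditions cut them out. -/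

section Sectors

lemma InSector.mono {ε ε' : ℝ} {S : Set ℂ} (h : InSector ε S) (hε : ε ≤ ε') : InSector ε' S := by
  obtain ⟨θ₀, h⟩ := h
  refine ⟨θ₀, fun w hw => ?_⟩
  obtain ⟨r, θ, h1, h2, h3, h4⟩ := h w hw
  exact ⟨r, θ, h1, h2, h3.trans (by linarith), h4⟩

lemma InSector.mul {ε ε' : ℝ} {B : Set ℂ} {F G : ℂ → ℂ} (hF : InSector ε (F '' B))
    (hG : InSector ε' (G '' B)) : InSector (ε + ε') ((fun z => F z * G z) '' B) := by
  obtain ⟨a, hF⟩ := hF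
  obtain ⟨b, hG⟩ := hG
  refine ⟨a + b, ?_⟩
  rintro _ ⟨z, hz, rfl⟩
  obtain ⟨r, θ, h1, h2, h3, h4⟩ := hF _ ⟨z, hz, rfl⟩
  obtain ⟨r', θ', h1', h2', h3', h4'⟩ := hG _ ⟨z, hz, rfl⟩
  refine ⟨r * r', θ + θ', mul_nonneg h1 h1', by linarith, by linarith, ?_⟩
  show F z * G z = _
  rw [h4, h4']
  push_cast
  rw [add_mul, Complex.exp_add]
  ring

lemma inSector_const (c : ℂ) (B : Set ℂ) : InSector 0 ((fun _ => c) '' B) := by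
  refine ⟨c.arg, ?_⟩
  rintro _ ⟨z, -, rfl⟩
  exact ⟨‖c‖, c.arg, norm_nonneg _, le_rfl, by simp, (Complex.norm_mul_exp_arg_mul_I c).symm⟩

lemma inSector_multiset_prod {δ : ℝ} {B : Set ℂ} (s : Multiset ℂ)
    (h : ∀ t ∈ s, InSector δ ((fun z => z - t) '' B)) :
    InSector (s.card * δ) ((fun z => (s.map (fun t => z - t)).prod) '' B) := by
  induction s using Multiset.induction with
  | empty => simpa using inSector_const 1 B
  | cons a s ih =>
    have h1 := (h a (Multiset.mem_cons_self a s)).mul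
      (ih fun t ht => h t (Multiset.mem_cons_of_mem ht))
    simp only [Multiset.map_cons, Multiset.prod_cons, Multiset.card_cons]
    refine h1.mono (le_of_eq ?_)
    push_cast
    ring

lemma im_ofReal_mul_exp (r θ : ℝ) : ((r : ℂ) * Complex.exp (θ * Complex.I)).im = r * Real.sin θ := by
  rw [Complex.im_ofReal_mul, Complex.exp_ofReal_mul_I_im]

lemma mul_exp_neg_eq (r θ α : ℝ) : (r : ℂ) * Complex.exp (θ * Complex.I) *
    Complex.exp (-(α : ℂ) * Complex.I) = r * Complex.exp (((θ - α : ℝ) : ℂ) * Complex.I) := by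
  rw [mul_assoc, ← Complex.exp_add]
  congr 2
  push_cast
  ring

/-- The signs of Im(w e^{-imδ}), δ = 2π/S, tell on which side of the line of direction mδ the point
w lies. If one nonzero point has argument in [mδ, (m+1)δ), the signs for m and m+1 force all others
into that sector, because δ < π when S ≥ 3. Since m + 1 may equal S, the index runs over S + 1
values. -/
lemma inSector_of_sign_eq {S : ℕ} (hS : 3 ≤ S) {W : Set ℂ}
    (h : ∀ w ∈ W, ∀ w' ∈ W, ∀ m : Fin (S + 1),
      SignType.sign (w * Complex.exp (-(((m : ℕ) * (2 * Real.pi / S) : ℝ) : ℂ) * Complex.I)).im =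
      SignType.sign (w' * Complex.exp (-(((m : ℕ) * (2 * Real.pi / S) : ℝ) : ℂ) * Complex.I)).im) :
    InSector (2 * Real.pi / S) W := by
  have hS0 : (0 : ℝ) < S := by positivity
  set δ : ℝ := 2 * Real.pi / S with hδ
  have hπ := Real.pi_pos
  have hδ0 : 0 < δ := by positivity
  have hSδ : S * δ = 2 * Real.pi := by rw [hδ]; field_simp
  have hδπ : δ < Real.pi := by
    have : (3 : ℝ) ≤ S := by exact_mod_cast hS
    nlinarith
  by_cases hW : ∃ w ∈ W, w ≠ 0
  · obtain ⟨w, hw, hw0⟩ := hW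
    obtain ⟨φ, hφ0, hφ1, hwφ⟩ : ∃ φ : ℝ, 0 ≤ φ ∧ φ < 2 * Real.pi ∧
        w = ‖w‖ * Complex.exp (φ * Complex.I) := by
      by_cases ha : 0 ≤ w.arg
      · exact ⟨w.arg, ha, by linarith [Complex.arg_le_pi w],
          (Complex.norm_mul_exp_arg_mul_I w).symm⟩
      · refine ⟨w.arg + 2 * Real.pi, by linarith [Complex.neg_pi_lt_arg w], by linarith, ?_⟩
        push_cast
        rw [add_mul, Complex.exp_add, Complex.exp_two_pi_mul_I, mul_one,
          Complex.norm_mul_exp_arg_mul_I]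
    have hwn : 0 < ‖w‖ := norm_pos_iff.mpr hw0
    set m := ⌊φ / δ⌋₊ with hm
    have hm1 : m * δ ≤ φ := by
      have := Nat.floor_le (show 0 ≤ φ / δ by positivity)
      rwa [le_div_iff₀ hδ0] at this
    have hm2 : φ < (m + 1) * δ := by
      have := Nat.lt_floor_add_one (φ / δ)
      rwa [div_lt_iff₀ hδ0] at this
    have hmS : m < S := by
      have : (m : ℝ) * δ < S * δ := by linarith
      exact_mod_cast lt_of_mul_lt_mul_right this hδ0.le
    refine ⟨m * δ, fun w' hw' => ?_⟩
    have h1 := h w hw w' hw' ⟨m, by omega⟩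
    have h2 := h w hw w' hw' ⟨m + 1, by omega⟩
    simp only at h1 h2
    set u := w' * Complex.exp (-((m * δ : ℝ) : ℂ) * Complex.I) with hu
    have e1 : 0 ≤ u.im := by
      have : 0 ≤ (w * Complex.exp (-((m * δ : ℝ) : ℂ) * Complex.I)).im := by
        rw [hwφ, mul_exp_neg_eq, im_ofReal_mul_exp]
        exact mul_nonneg hwn.le (Real.sin_nonneg_of_nonneg_of_le_pi (by linarith) (by linarith))
      rw [← sign_nonneg_iff] at this ⊢
      rwa [← h1]
    have hu2 : u = ‖u‖ * Complex.exp (u.arg * Complex.I) :=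
      (Complex.norm_mul_exp_arg_mul_I u).symm
    have hw'u : w' = ‖u‖ * Complex.exp (((u.arg + m * δ : ℝ) : ℂ) * Complex.I) := by
      have : w' = u * Complex.exp (((m * δ : ℝ) : ℂ) * Complex.I) := by
        rw [hu, mul_assoc, ← Complex.exp_add]
        simp
      rw [this]
      conv_lhs => rw [hu2]
      rw [mul_assoc, ← Complex.exp_add]
      congr 2
      push_cast
      ring
    have e2 : ‖u‖ * Real.sin (u.arg - δ) < 0 := by
      have : (w * Complex.exp (-(((m + 1 : ℕ) * δ : ℝ) : ℂ) * Complex.I)).im < 0 := by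
        rw [hwφ, mul_exp_neg_eq, im_ofReal_mul_exp]
        refine mul_neg_of_pos_of_neg hwn (Real.sin_neg_of_neg_of_neg_pi_lt ?_ ?_) <;>
        · push_cast
          nlinarith
      rw [← sign_eq_neg_one_iff, h2, sign_eq_neg_one_iff, hw'u, mul_exp_neg_eq,
        im_ofReal_mul_exp] at this
      rwa [show u.arg + m * δ - ((m + 1 : ℕ) : ℝ) * δ = u.arg - δ by push_cast; ring] at this
    have ha0 : 0 ≤ u.arg := Complex.arg_nonneg_iff.mpr e1
    refine ⟨‖u‖, u.arg + m * δ, norm_nonneg _, by linarith, ?_, hw'u⟩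
    by_contra hcon
    push Not at hcon
    have := Real.sin_nonneg_of_nonneg_of_le_pi (x := u.arg - δ) (by linarith)
      (by linarith [Complex.arg_le_pi u])
    nlinarith [norm_nonneg u]
  · push Not at hW
    refine ⟨0, fun w hw => ⟨0, 0, le_rfl, le_rfl, by linarith, ?_⟩⟩
    simp [hW w hw]

end Sectors

/-! ### Decomposition of the plane into convex cells. -/

section Cells

lemma sign_convexComb {x y a b : ℝ} (h : SignType.sign x = SignType.sign y) (ha : 0 ≤ a)
    (hb : 0 ≤ b) (hab : a + b = 1) : SignType.sign (a * x + b * y) = SignType.sign x := by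
  rcases lt_trichotomy x 0 with hx | hx | hx
  · have hy : y < 0 := by rwa [← sign_eq_neg_one_iff, ← h, sign_eq_neg_one_iff]
    rw [sign_neg hx, sign_neg]
    rcases ha.eq_or_lt with rfl | ha
    · obtain rfl : b = 1 := by linarith
      simpa
    · nlinarith
  · have hy : y = 0 := by rwa [← sign_eq_zero_iff, ← h, sign_eq_zero_iff]
    simp [hx, hy]
  · have hy : 0 < y := by rwa [← sign_eq_one_iff, ← h, sign_eq_one_iff]
    rw [sign_pos hx, sign_pos]
    rcases ha.eq_or_lt with rfl | ha
    · obtain rfl : b = 1 := by linarith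
      simpa
    · nlinarith [mul_nonneg hb hy.le, mul_pos ha hx]

lemma abs_convexComb {x y a b : ℝ} (h : SignType.sign x = SignType.sign y) (ha : 0 ≤ a)
    (hb : 0 ≤ b) : |a * x + b * y| = a * |x| + b * |y| := by
  rcases lt_trichotomy x 0 with hx | hx | hx
  · have hy : y < 0 := by rwa [← sign_eq_neg_one_iff, ← h, sign_eq_neg_one_iff]
    rw [abs_of_neg hx, abs_of_neg hy, abs_of_nonpos (by nlinarith)]
    ring
  · have hy : y = 0 := by rwa [← sign_eq_zero_iff, ← h, sign_eq_zero_iff]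
    simp [hx, hy]
  · have hy : 0 < y := by rwa [← sign_eq_one_iff, ← h, sign_eq_one_iff]
    rw [abs_of_pos hx, abs_of_pos hy, abs_of_nonneg (by positivity)]

lemma le_convexComb_iff {x y d a b : ℝ} (h : d ≤ x ↔ d ≤ y) (ha : 0 ≤ a)
    (hb : 0 ≤ b) (hab : a + b = 1) : d ≤ a * x + b * y ↔ d ≤ x := by
  by_cases hx : d ≤ x
  · have hy := h.mp hx
    simp only [hx, iff_true]
    calc d = a * d + b * d := by rw [← add_mul, hab, one_mul]
      _ ≤ a * x + b * y := by gcongr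
  · have hy : ¬ d ≤ y := fun hy => hx (h.mpr hy)
    simp only [hx, iff_false]
    push Not at hx hy ⊢
    rcases ha.eq_or_lt with rfl | ha
    · obtain rfl : b = 1 := by linarith
      simpa
    · calc a * x + b * y < a * d + b * d := by
            have := mul_lt_mul_of_pos_left hx ha
            have := mul_le_mul_of_nonneg_left hy.le hb
            linarith
        _ = d := by rw [← add_mul, hab, one_mul]

/-- The `ℓ¹` norm on `ℂ = ℝ²`. -/
def l1norm (w : ℂ) : ℝ := |w.re| + |w.im|

lemma norm_le_l1norm (w : ℂ) : ‖w‖ ≤ l1norm w := Complex.norm_le_abs_re_add_abs_im w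

lemma l1norm_le (w : ℂ) : l1norm w ≤ 2 * ‖w‖ := by
  have := Complex.abs_re_le_norm w
  have := Complex.abs_im_le_norm w
  rw [l1norm]
  linarith

/-- The type of labels of the cells of the decomposition. -/
abbrev CellLabel (n S : ℕ) : Type :=
  (Fin n → Fin n → Bool) × (Fin n → Fin n → Bool) × (Fin n → Fin (S + 1) → SignType) ×
    (Fin n → SignType) × (Fin n → SignType)

open Classical in
/-- The label of the cell of `z`, relative to the points `t`: it records the order of the distances
to these points, the comparison of these distances to the mutual distances of the `t j`, and
the sectors with vertices `t j` that contain `z`. -/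
def cellLabel {n : ℕ} (S : ℕ) (t : Fin n → ℂ) (z : ℂ) : CellLabel n S :=
  (fun j k => decide (‖z - t j‖ ≤ ‖z - t k‖),
   fun j k => decide (‖t k - t j‖ ≤ l1norm (z - t j)),
   fun k m => SignType.sign ((z - t k) *
     Complex.exp (-(((m : ℕ) * (2 * Real.pi / S) : ℝ) : ℂ) * Complex.I)).im,
   fun k => SignType.sign (z - t k).re,
   fun k => SignType.sign (z - t k).im)

lemma cellLabel_eq_iff {n S : ℕ} {t : Fin n → ℂ} {z z' : ℂ} :
    cellLabel S t z = cellLabel S t z' ↔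
      (∀ j k, ‖z - t j‖ ≤ ‖z - t k‖ ↔ ‖z' - t j‖ ≤ ‖z' - t k‖) ∧
      (∀ j k, ‖t k - t j‖ ≤ l1norm (z - t j) ↔ ‖t k - t j‖ ≤ l1norm (z' - t j)) ∧
      (∀ k (m : Fin (S + 1)), SignType.sign ((z - t k) *
        Complex.exp (-(((m : ℕ) * (2 * Real.pi / S) : ℝ) : ℂ) * Complex.I)).im =
        SignType.sign ((z' - t k) *
        Complex.exp (-(((m : ℕ) * (2 * Real.pi / S) : ℝ) : ℂ) * Complex.I)).im) ∧
      (∀ k, SignType.sign (z - t k).re = SignType.sign (z' - t k).re) ∧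
      (∀ k, SignType.sign (z - t k).im = SignType.sign (z' - t k).im) := by
  simp only [cellLabel, Prod.mk.injEq, funext_iff, decide_eq_decide]

lemma norm_sub_le_norm_sub_iff (z p q : ℂ) : ‖z - p‖ ≤ ‖z - q‖ ↔
    p.re ^ 2 + p.im ^ 2 - q.re ^ 2 - q.im ^ 2 ≤
      2 * (p.re - q.re) * z.re + 2 * (p.im - q.im) * z.im := by
  rw [← sq_le_sq₀ (norm_nonneg _) (norm_nonneg _), ← Complex.normSq_eq_norm_sq,
    ← Complex.normSq_eq_norm_sq, Complex.normSq_apply, Complex.normSq_apply]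
  simp only [Complex.sub_re, Complex.sub_im]
  constructor <;> intro h <;> nlinarith

/-- Every condition in the label is a linear one. Comparing distances to two points selects a
half-plane. The signs of real and imaginary parts fix a quadrant at each `t j`, and there the ℓ¹
norm is linear, so both the inside and the outside of an ℓ¹ ball are convex; with Euclidean discs
the outside would not be. -/
lemma convex_cell {n : ℕ} (S : ℕ) (t : Fin n → ℂ) (l : CellLabel n S) :
    Convex ℝ {z | cellLabel S t z = l} := by
  intro z hz z' hz' a b ha hb hab
  simp only [Set.mem_ofPred_eq] at *
  rw [← hz'] at hz
  rw [← hz', ← hz]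
  have hc : ∀ p : ℂ, a • z + b • z' - p = a • (z - p) + b • (z' - p) := by
    intro p
    have : p = (a : ℂ) * p + (b : ℂ) * p := by
      rw [← add_mul, ← Complex.ofReal_add, hab, Complex.ofReal_one, one_mul]
    simp only [Complex.real_smul]
    linear_combination -this
  obtain ⟨h1, h2, h3, h4, h5⟩ := cellLabel_eq_iff.mp hz
  refine cellLabel_eq_iff.mpr ⟨fun j k => ?_, fun j k => ?_, fun k m => ?_, fun k => ?_, fun k => ?_⟩
  · have := h1 j k
    simp only [norm_sub_le_norm_sub_iff] at this ⊢
    rw [← le_convexComb_iff this ha hb hab]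
    simp only [Complex.add_re, Complex.add_im, Complex.real_smul, Complex.re_ofReal_mul,
      Complex.im_ofReal_mul]
    ring_nf
  · rw [← le_convexComb_iff (h2 j k) ha hb hab]
    have : l1norm (a • z + b • z' - t j) = a * l1norm (z - t j) + b * l1norm (z' - t j) := by
      rw [hc]
      simp only [l1norm, Complex.add_re, Complex.add_im, Complex.real_smul, Complex.re_ofReal_mul,
        Complex.im_ofReal_mul, abs_convexComb (h4 j) ha hb, abs_convexComb (h5 j) ha hb]
      ring
    rw [this]
  · rw [hc, add_mul, Complex.add_im, Complex.real_smul, Complex.real_smul, mul_assoc, mul_assoc,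
      Complex.im_ofReal_mul, Complex.im_ofReal_mul]
    exact sign_convexComb (h3 k m) ha hb hab
  · rw [hc]
    simp only [Complex.add_re, Complex.real_smul, Complex.re_ofReal_mul]
    exact sign_convexComb (h4 k) ha hb hab
  · rw [hc]
    simp only [Complex.add_im, Complex.real_smul, Complex.im_ofReal_mul]
    exact sign_convexComb (h5 k) ha hb hab

lemma inSector_cell {n S : ℕ} (hS : 3 ≤ S) (t : Fin n → ℂ) (l : CellLabel n S) (k : Fin n) :
    InSector (2 * Real.pi / S) ((fun z => z - t k) '' {z | cellLabel S t z = l}) := by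
  apply inSector_of_sign_eq hS
  rintro _ ⟨z, hz, rfl⟩ _ ⟨z', hz', rfl⟩ m
  simp only [Set.mem_ofPred_eq] at hz hz'
  exact (cellLabel_eq_iff.mp (hz.trans hz'.symm)).2.2.1 k m

/-- Here `t j` is nearest to the whole cell, as the label records the order of the distances. If the
ℓ¹ distance to `t j` is at least |t k - t j|, the triangle inequality makes |z - t k| comparable to
|z - t j|. Otherwise |z - t j| < |t k - t j|, and |z - t k| is comparable to this constant. -/
lemma linear_factor_on_cell {n S : ℕ} (t : Fin n → ℂ) (l : CellLabel n S) (z₀ : ℂ)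
    (hz₀ : cellLabel S t z₀ = l) (j k : Fin n) (hj : ∀ k, ‖z₀ - t j‖ ≤ ‖z₀ - t k‖) :
    ∃ (A : ℝ) (e : ℕ), 0 < A ∧ e ≤ 1 ∧ ∀ z, cellLabel S t z = l →
      3⁻¹ * (A * ‖z - t j‖ ^ e) ≤ ‖z - t k‖ ∧ ‖z - t k‖ ≤ 3 * (A * ‖z - t j‖ ^ e) := by
  have hV : ∀ z, cellLabel S t z = l → ‖z - t j‖ ≤ ‖z - t k‖ := fun z hz =>
    ((cellLabel_eq_iff.mp (hz.trans hz₀.symm)).1 j k).mpr (hj k)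
  have tri : ∀ z, ‖z - t k‖ ≤ ‖z - t j‖ + ‖t k - t j‖ := fun z => by
    have := norm_sub_le (z - t j) (t k - t j)
    simpa using this
  have tri' : ∀ z, ‖t k - t j‖ ≤ ‖z - t j‖ + ‖z - t k‖ := fun z => by
    have := norm_sub_le (z - t j) (z - t k)
    simpa using this
  by_cases h : ‖t k - t j‖ ≤ l1norm (z₀ - t j)
  · refine ⟨1, 1, one_pos, le_rfl, fun z hz => ?_⟩
    have h' := ((cellLabel_eq_iff.mp (hz.trans hz₀.symm)).2.1 j k).mpr h
    have := hV z hz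
    have := tri z
    have := l1norm_le (z - t j)
    have := norm_nonneg (z - t j)
    constructor <;> simp only [pow_one] <;> linarith
  · have h0 : 0 < ‖t k - t j‖ := by
      push Not at h
      refine lt_of_le_of_lt ?_ h
      exact (norm_nonneg _).trans (norm_le_l1norm _)
    refine ⟨‖t k - t j‖, 0, h0, by norm_num, fun z hz => ?_⟩
    have h' := mt ((cellLabel_eq_iff.mp (hz.trans hz₀.symm)).2.1 j k).mp h
    push Not at h'
    have := hV z hz
    have := tri z
    have := tri' z
    have := norm_le_l1norm (z - t j)
    have := norm_nonneg (z - t j)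
    constructor <;> simp only [pow_zero] <;> linarith

lemma multiset_prod_comparable {B : Set ℂ} {b : ℂ} (s : Multiset ℂ)
    (h : ∀ t ∈ s, ∃ (A : ℝ) (e : ℕ), 0 < A ∧ e ≤ 1 ∧ ∀ z ∈ B,
      3⁻¹ * (A * ‖z - b‖ ^ e) ≤ ‖z - t‖ ∧ ‖z - t‖ ≤ 3 * (A * ‖z - b‖ ^ e)) :
    ∃ (A : ℝ) (e : ℕ), 0 < A ∧ e ≤ s.card ∧ ∀ z ∈ B,
      ((3 : ℝ) ^ s.card)⁻¹ * (A * ‖z - b‖ ^ e) ≤ ‖(s.map (fun t => z - t)).prod‖ ∧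
      ‖(s.map (fun t => z - t)).prod‖ ≤ 3 ^ s.card * (A * ‖z - b‖ ^ e) := by
  induction s using Multiset.induction with
  | empty => exact ⟨1, 0, one_pos, le_rfl, fun z _ => by simp⟩
  | cons a s ih =>
    obtain ⟨A, e, hA, he, H⟩ := h a (Multiset.mem_cons_self a s)
    obtain ⟨A', e', hA', he', H'⟩ := ih fun t ht => h t (Multiset.mem_cons_of_mem ht)
    refine ⟨A * A', e + e', by positivity, by rw [Multiset.card_cons]; omega, fun z hz => ?_⟩
    obtain ⟨h1, h2⟩ := H z hz
    obtain ⟨h1', h2'⟩ := H' z hz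
    simp only [Multiset.map_cons, Multiset.prod_cons, Multiset.card_cons, norm_mul]
    constructor
    · refine le_trans (le_of_eq ?_) (mul_le_mul h1 h1' (by positivity) (norm_nonneg _))
      rw [pow_succ, mul_inv, pow_add]
      ring
    · refine le_trans (mul_le_mul h2 h2' (by positivity) (by positivity)) (le_of_eq ?_)
      rw [pow_succ, pow_add]
      ring

lemma eval_eq_leadingCoeff_mul_prod (Q : ℂ[X]) (z : ℂ) :
    Q.eval z = Q.leadingCoeff * (Q.roots.map (fun t => z - t)).prod := by
  conv_lhs => rw [(IsAlgClosed.splits Q).eq_prod_roots]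
  rw [eval_mul, eval_C, eval_multiset_prod, Multiset.map_map]
  simp

lemma exists_enumeration (s : Finset ℂ) {n : ℕ} (hs : s.card < n) :
    ∃ t : Fin n → ℂ, ∀ a ∈ s, ∃ k, t k = a := by
  refine ⟨fun k => if h : (k : ℕ) < s.card then (s.equivFin.symm ⟨k, h⟩ : ℂ) else 0, fun a ha => ?_⟩
  refine ⟨⟨s.equivFin ⟨a, ha⟩, lt_trans (s.equivFin ⟨a, ha⟩).2 hs⟩, ?_⟩
  simp

lemma exists_decomposition (N : ℕ) {ε : ℝ} (hε : 0 < ε) :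
    ∃ (M : ℕ) (K : ℝ), 1 ≤ K ∧
      ∀ Γ : Curve, Γ.DegreeLE N → L₃ Γ ≠ 0 →
        ∃ (B : Fin M → Set ℂ) (b : Fin M → ℂ) (k : Fin M → Fin 3 → ℕ),
          (⋃ j, B j) = Set.univ ∧
          Pairwise (fun i j => Disjoint (B i) (B j)) ∧
          ∀ j, IsPiece Γ ε K (B j) (b j) (k j) := by
  -- Three polynomials of degree at most 3N have at most 9N roots in all. The extra point ensures
  -- that a nearest point exists even when there are no roots.
  set n := 9 * N + 1 with hn
  -- At most 3N factors, each in a sector of aperture 2π/S, are multiplied; the +1 also covers the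
  -- sector of z - b itself when N = 0.
  obtain ⟨S, hS⟩ : ∃ S : ℕ, max 3 ((3 * N + 1) * (2 * Real.pi) / ε) ≤ S := exists_nat_ge _
  have hS3 : 3 ≤ S := by exact_mod_cast (le_max_left _ _).trans hS
  have hSε : (3 * N + 1) * (2 * Real.pi / S) ≤ ε := by
    have h1 := (le_max_right _ _).trans hS
    rw [div_le_iff₀ hε] at h1
    have hS0 : (0 : ℝ) < S := by positivity
    rw [← mul_div_assoc, div_le_iff₀ hS0]
    linarith
  have hπ := Real.pi_pos
  have hδ : 0 ≤ 2 * Real.pi / S := by positivity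
  -- Each linear factor costs a factor 3, and there are at most 3N of them.
  refine ⟨Fintype.card (CellLabel n S), 3 ^ (3 * N), one_le_pow₀ (by norm_num), fun Γ hΓ hL => ?_⟩
  obtain ⟨t, ht⟩ := exists_enumeration
    (Finset.univ.biUnion fun i : Fin 3 => (L Γ i).roots.toFinset) (n := n) (by
      refine lt_of_le_of_lt Finset.card_biUnion_le ?_
      refine lt_of_le_of_lt (Finset.sum_le_card_nsmul _ _ (3 * N) fun i _ => ?_) ?_
      · exact (Multiset.toFinset_card_le _).trans ((card_roots' _).trans (natDegree_L_le hΓ i))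
      · simp [hn]; omega)
  have ht' : ∀ i, ∀ a ∈ (L Γ i).roots, ∃ k, t k = a := fun i a ha =>
    ht a (Finset.mem_biUnion.mpr ⟨i, Finset.mem_univ i, Multiset.mem_toFinset.mpr ha⟩)
  set E := Fintype.equivFin (CellLabel n S)
  have key : ∀ l : CellLabel n S, ∃ (b : ℂ) (k : Fin 3 → ℕ),
      IsPiece Γ ε (3 ^ (3 * N)) {z | cellLabel S t z = l} b k := by
    intro l
    have hsec : ∀ i, InSector ε ((fun z => (L Γ i).eval z) '' {z | cellLabel S t z = l}) := by
      intro i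
      have h1 := inSector_multiset_prod (δ := 2 * Real.pi / S) (B := {z | cellLabel S t z = l})
        (L Γ i).roots (fun a ha => by
          obtain ⟨k, rfl⟩ := ht' i a ha
          exact inSector_cell hS3 t l k)
      have h2 := (inSector_const (L Γ i).leadingCoeff {z | cellLabel S t z = l}).mul h1
      simp only [← eval_eq_leadingCoeff_mul_prod] at h2
      refine h2.mono ?_
      have : ((L Γ i).roots.card : ℝ) ≤ 3 * N + 1 := by
        have := (card_roots' (L Γ i)).trans (natDegree_L_le hΓ i)
        have : ((L Γ i).roots.card : ℝ) ≤ 3 * N := by exact_mod_cast this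
        linarith
      nlinarith
    rcases Set.eq_empty_or_nonempty {z | cellLabel S t z = l} with he | ⟨z₀, hz₀⟩
    · refine ⟨0, 0, ?_⟩
      rw [he]
      exact ⟨convex_empty, ⟨0, by simp⟩, fun i => ⟨Nat.zero_le _, 1, one_pos, by simp⟩,
        fun i => ⟨0, by simp⟩⟩
    · have : Nonempty (Fin n) := ⟨⟨0, by omega⟩⟩
      obtain ⟨j, hj⟩ := Finite.exists_min fun k => ‖z₀ - t k‖
      have hfac : ∀ i, ∃ (A : ℝ) (e : ℕ), 0 < A ∧ e ≤ (L Γ i).roots.card ∧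
          ∀ z ∈ {z | cellLabel S t z = l}, _ := fun i =>
        multiset_prod_comparable (B := {z | cellLabel S t z = l}) (b := t j) (L Γ i).roots
          (fun a ha => by
            obtain ⟨k, rfl⟩ := ht' i a ha
            exact linear_factor_on_cell t l z₀ hz₀ j k hj)
      choose A e hA he H using hfac
      refine ⟨t j, e, convex_cell S t l, (inSector_cell hS3 t l j).mono (by nlinarith),
        fun i => ⟨(he i).trans (card_roots' _), ‖(L Γ i).leadingCoeff‖ * A i, ?_, fun z hz => ?_⟩, hsec⟩
      · have := leadingCoeff_ne_zero.mpr (L_ne_zero hL i)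
        have := hA i
        positivity
      · obtain ⟨h1, h2⟩ := H i z hz
        have hp : (3 : ℝ) ^ (L Γ i).roots.card ≤ 3 ^ (3 * N) :=
          pow_le_pow_right₀ (by norm_num) ((card_roots' _).trans (natDegree_L_le hΓ i))
        rw [eval_eq_leadingCoeff_mul_prod, norm_mul]
        have hA := hA i
        constructor
        · calc ((3 : ℝ) ^ (3 * N))⁻¹ * (‖(L Γ i).leadingCoeff‖ * A i * ‖z - t j‖ ^ e i)
              ≤ ((3 : ℝ) ^ (L Γ i).roots.card)⁻¹ *
                  (‖(L Γ i).leadingCoeff‖ * A i * ‖z - t j‖ ^ e i) := by gcongr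
            _ = ‖(L Γ i).leadingCoeff‖ * (((3 : ℝ) ^ (L Γ i).roots.card)⁻¹ *
                  (A i * ‖z - t j‖ ^ e i)) := by ring
            _ ≤ _ := by gcongr
        · calc _ ≤ ‖(L Γ i).leadingCoeff‖ * ((3 : ℝ) ^ (L Γ i).roots.card *
                  (A i * ‖z - t j‖ ^ e i)) := by gcongr
            _ ≤ ‖(L Γ i).leadingCoeff‖ * ((3 : ℝ) ^ (3 * N) *
                  (A i * ‖z - t j‖ ^ e i)) := by gcongr
            _ = _ := by ring
  choose b k hk using key
  refine ⟨fun j => {z | cellLabel S t z = E.symm j}, fun j => b (E.symm j), fun j => k (E.symm j),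
    ?_, ?_, fun j => hk _⟩
  · ext z
    simp only [Set.mem_iUnion, Set.mem_ofPred_eq, Set.mem_univ, iff_true]
    exact ⟨E (cellLabel S t z), by simp⟩
  · intro i j hij
    rw [Set.disjoint_left]
    intro z hz hz'
    simp only [Set.mem_ofPred_eq] at hz hz'
    exact hij (E.symm.injective (hz.symm.trans hz'))

end Cells

/-! ### Approximate residues on a circle. -/

section Residues

open Metric

/-- The integral of C/(z - b) is 2πiC, that of G is zero, and the difference is at most 2πρδ. -/
lemma norm_le_of_circleIntegral_eq_zero {G : ℂ → ℂ} {b C : ℂ} {ρ δ : ℝ} (hρ : 0 < ρ)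
    (hG : ContinuousOn G (sphere b ρ)) (h0 : (∮ z in C(b, ρ), G z) = 0)
    (h : ∀ z ∈ sphere b ρ, ‖G z - C * (z - b)⁻¹‖ ≤ δ) : ‖C‖ ≤ ρ * δ := by
  have hne : ∀ z ∈ sphere b ρ, z - b ≠ 0 := fun z hz h => by
    rw [mem_sphere_iff_norm, h, norm_zero] at hz
    exact hρ.ne hz
  have hI : ContinuousOn (fun z => C * (z - b)⁻¹) (sphere b ρ) :=
    continuousOn_const.mul ((continuousOn_id.sub continuousOn_const).inv₀ hne)
  have h1 := circleIntegral.norm_integral_le_of_norm_le_const hρ.le h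
  rw [circleIntegral.integral_sub (hG.circleIntegrable hρ.le) (hI.circleIntegrable hρ.le), h0,
    circleIntegral.integral_const_mul, circleIntegral.integral_sub_center_inv b hρ.ne', zero_sub,
    norm_neg, norm_mul, norm_mul, norm_mul, Complex.norm_I] at h1
  simp only [Complex.norm_ofNat, Complex.norm_real, Real.norm_eq_abs, mul_one] at h1
  have hπ := Real.pi_pos
  rw [abs_of_pos hπ] at h1
  have : (2 * Real.pi) * ‖C‖ ≤ (2 * Real.pi) * (ρ * δ) := by linarith
  exact le_of_mul_le_mul_left this (by positivity)

lemma circle_oscillation_le {F F' : ℂ → ℂ} {b : ℂ} {ρ δ : ℝ} (hρ : 0 < ρ)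
    (hF : ∀ z ∈ sphere b ρ, HasDerivAt F (F' z) z) (hδ : ∀ z ∈ sphere b ρ, ‖F' z‖ ≤ δ) :
    ∃ q, ∀ z ∈ sphere b ρ, ‖F z - q‖ ≤ 2 * Real.pi * (δ * ρ) := by
  refine ⟨F (circleMap b ρ 0), fun z hz => ?_⟩
  rw [← abs_of_pos hρ, ← image_circleMap_Ioc] at hz
  obtain ⟨θ, hθ, rfl⟩ := hz
  have hπ := Real.pi_pos
  have hδ0 : 0 ≤ δ := (norm_nonneg _).trans (hδ _ (circleMap_mem_sphere b hρ.le 0))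
  have h1 := Convex.norm_image_sub_le_of_norm_hasDerivWithin_le (𝕜 := ℝ) (f := fun θ => F (circleMap b ρ θ))
    (f' := fun θ => (circleMap 0 ρ θ * Complex.I) • F' (circleMap b ρ θ))
    (C := δ * ρ) (s := Set.univ) (x := 0) (y := θ)
    (fun τ _ => ((hF _ (circleMap_mem_sphere b hρ.le τ)).scomp τ
      (hasDerivAt_circleMap b ρ τ)).hasDerivWithinAt)
    (fun τ _ => by
      rw [norm_smul, norm_mul, Complex.norm_I, mul_one, norm_circleMap_zero, abs_of_pos hρ, mul_comm]
      exact mul_le_mul_of_nonneg_right (hδ _ (circleMap_mem_sphere b hρ.le τ)) hρ.le)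
    convex_univ trivial trivial
  refine h1.trans ?_
  rw [sub_zero, Real.norm_eq_abs, abs_of_pos hθ.1, mul_comm]
  exact mul_le_mul_of_nonneg_right hθ.2 (by positivity)

/-- A function with a single-valued primitive on the circle has integral zero, so its derivative
cannot be close to C/(z - b) with C ≠ 0. -/
lemma eq_zero_of_derivative_near_inv {f u : ℂ → ℂ} {b C : ℂ} {ρ κ : ℝ} (hρ : 0 < ρ) (hκ : κ < 1)
    (hu : ContinuousOn u (sphere b ρ)) (hf : ∀ z ∈ sphere b ρ, HasDerivAt f (u z) z)
    (h : ∀ z ∈ sphere b ρ, ‖u z * (z - b) - C‖ ≤ κ * ‖C‖) : C = 0 := by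
  have h0 := circleIntegral.integral_eq_zero_of_hasDerivWithinAt hρ.le
    fun z hz => (hf z hz).hasDerivWithinAt (s := sphere b ρ)
  have h1 := norm_le_of_circleIntegral_eq_zero (C := C) (δ := κ * ‖C‖ / ρ) hρ hu h0 fun z hz => by
    have hz' := mem_sphere_iff_norm.mp hz
    have hne : z - b ≠ 0 := norm_pos_iff.mp (by rw [hz']; exact hρ)
    have : u z - C * (z - b)⁻¹ = (u z * (z - b) - C) / (z - b) := by field_simp
    rw [this, norm_div, hz']
    gcongr
    exact h z hz
  rw [mul_div_cancel₀ _ hρ.ne'] at h1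
  rw [← norm_eq_zero]
  nlinarith [norm_nonneg C]

/-- Since h' is close to D(z - b), h differs from D(z - b)²/2 by nearly a constant q. Then (g - qf)'
= (h - q)u is close to (CD/2)/(z - b), so the residue argument gives CD = 0. -/
lemma eq_zero_of_iterated_derivatives {f g h u v : ℂ → ℂ} {b C D : ℂ} {ρ : ℝ} (hρ : 0 < ρ)
    (hu : ContinuousOn u (sphere b ρ)) (hf : ∀ z ∈ sphere b ρ, HasDerivAt f (u z) z)
    (hh : ∀ z ∈ sphere b ρ, HasDerivAt h (v z) z)
    (hg : ∀ z ∈ sphere b ρ, HasDerivAt g (h z * u z) z)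
    (hC : ∀ z ∈ sphere b ρ, ‖u z * (z - b) ^ 3 - C‖ ≤ 1 / 100 * ‖C‖)
    (hD : ∀ z ∈ sphere b ρ, ‖v z - D * (z - b)‖ ≤ 1 / 100 * (‖D‖ * ρ)) : C = 0 ∨ D = 0 := by
  obtain ⟨q, hq⟩ := circle_oscillation_le (F := fun z => h z - D / 2 * (z - b) ^ 2)
    (F' := fun z => v z - D * (z - b)) hρ (fun z hz => by
      refine (hh z hz).sub ?_
      have := (((hasDerivAt_id z).sub_const b).pow 2).const_mul (D / 2)
      refine this.congr_deriv ?_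
      simp
      ring) hD
  have hcont : ContinuousOn h (sphere b ρ) := fun z hz => (hh z hz).continuousAt.continuousWithinAt
  have h0 := circleIntegral.integral_eq_zero_of_hasDerivWithinAt (f := fun z => g z - q * f z)
    (f' := fun z => h z * u z - q * u z) hρ.le
    fun z hz => ((hg z hz).sub ((hf z hz).const_mul q)).hasDerivWithinAt (s := sphere b ρ)
  have hπ := Real.pi_lt_d2
  have hπ0 := Real.pi_pos
  have h1 := norm_le_of_circleIntegral_eq_zero (C := D / 2 * C) (δ := 1 / 4 * (‖D‖ * ‖C‖) / ρ) hρ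
    ((hcont.mul hu).sub (continuousOn_const.mul hu)) h0 fun z hz => by
    have hz' := mem_sphere_iff_norm.mp hz
    have hne : z - b ≠ 0 := norm_pos_iff.mp (by rw [hz']; exact hρ)
    change ‖h z * u z - q * u z - D / 2 * C * (z - b)⁻¹‖ ≤ _
    have e : h z * u z - q * u z - D / 2 * C * (z - b)⁻¹ =
        (D / 2 * (z - b) ^ 2 * (u z * (z - b) ^ 3 - C) +
          (h z - D / 2 * (z - b) ^ 2 - q) * (u z * (z - b) ^ 3)) / (z - b) ^ 3 := by
      field_simp
      ring
    have e1 := hC z hz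
    have e2 := hq z hz
    have e3 : ‖u z * (z - b) ^ 3‖ ≤ 2 * ‖C‖ := by
      have := norm_sub_norm_le (u z * (z - b) ^ 3) C
      have := norm_nonneg C
      linarith
    rw [e, norm_div, norm_pow, hz', div_le_div_iff₀ (by positivity) hρ]
    -- The two errors add up to (1/200 + π/25)‖D‖‖C‖ρ², below the allowed quarter; the residue
    -- itself has size ‖D‖‖C‖/2.
    have e4 : ‖D / 2 * (z - b) ^ 2 * (u z * (z - b) ^ 3 - C) +
          (h z - D / 2 * (z - b) ^ 2 - q) * (u z * (z - b) ^ 3)‖ ≤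
          ‖D‖ / 2 * ρ ^ 2 * (1 / 100 * ‖C‖) +
          2 * Real.pi * (1 / 100 * (‖D‖ * ρ) * ρ) * (2 * ‖C‖) := by
      refine (norm_add_le _ _).trans (add_le_add ?_ ?_)
      · rw [norm_mul, norm_mul, norm_div, norm_pow, hz', Complex.norm_ofNat]
        gcongr
      · rw [norm_mul]
        gcongr
    have e5 : 0 ≤ ‖D‖ * ‖C‖ * ρ ^ 3 := by positivity
    nlinarith
  rw [mul_div_cancel₀ _ hρ.ne', norm_mul, norm_div, Complex.norm_ofNat] at h1
  have : ‖D‖ * ‖C‖ ≤ 0 := by linarith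
  have h2 : ‖D‖ * ‖C‖ = 0 := le_antisymm this (by positivity)
  rcases mul_eq_zero.mp h2 with h | h
  · exact Or.inr (norm_eq_zero.mp h)
  · exact Or.inl (norm_eq_zero.mp h)

end Residues

/-! ### Annuli without roots, where polynomials are nearly monomials. -/

section Gaps

lemma norm_mul_sub_one_le {x y : ℂ} {η E : ℝ} (hx : ‖x - 1‖ ≤ η) (hy : ‖y - 1‖ ≤ E - 1) :
    ‖x * y - 1‖ ≤ (1 + η) * E - 1 := by
  have h1 : x * y - 1 = (x - 1) * (y - 1) + (x - 1) + (y - 1) := by ring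
  have hη : 0 ≤ η := (norm_nonneg _).trans hx
  calc ‖x * y - 1‖ ≤ ‖(x - 1) * (y - 1)‖ + ‖x - 1‖ + ‖y - 1‖ := by
        rw [h1]; exact norm_add₃_le
    _ ≤ η * (E - 1) + η + (E - 1) := by rw [norm_mul]; gcongr
    _ = _ := by ring

/-- Well inside the gap a root a near b contributes (z - b)(1 - (a - b)/(z - b)), and a far one
contributes (b - a)(1 - (z - b)/(a - b)); both corrections are at most η. -/
lemma multiset_prod_on_gap {b : ℂ} {ρ₀ ρ₁ : ℝ} (hρ₁ : 0 < ρ₁) (s : Multiset ℂ)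
    (h : ∀ a ∈ s, ‖a - b‖ ≤ ρ₀ ∨ ρ₁ ≤ ‖a - b‖) :
    ∃ (C : ℂ) (e : ℕ), C ≠ 0 ∧ ∀ (z : ℂ) (η : ℝ), z ≠ b → ρ₀ ≤ η * ‖z - b‖ →
      ‖z - b‖ ≤ η * ρ₁ → ∃ E : ℂ, (s.map (fun t => z - t)).prod = C * (z - b) ^ e * E ∧
      ‖E - 1‖ ≤ (1 + η) ^ s.card - 1 := by
  induction s using Multiset.induction with
  | empty => exact ⟨1, 0, one_ne_zero, fun z η _ _ _ => ⟨1, by simp⟩⟩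
  | cons a s ih =>
    obtain ⟨C, e, hC, H⟩ := ih fun t ht => h t (Multiset.mem_cons_of_mem ht)
    rcases h a (Multiset.mem_cons_self a s) with ha | ha
    · refine ⟨C, e + 1, hC, fun z η hz h0 h1 => ?_⟩
      obtain ⟨E, hE, hE'⟩ := H z η hz h0 h1
      have hne : z - b ≠ 0 := sub_ne_zero.mpr hz
      refine ⟨(1 - (a - b) / (z - b)) * E, ?_, ?_⟩
      · rw [Multiset.map_cons, Multiset.prod_cons, hE]
        field_simp
        ring
      · rw [Multiset.card_cons, pow_succ']
        refine norm_mul_sub_one_le ?_ hE'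
        rw [sub_sub_cancel_left, norm_neg, norm_div, div_le_iff₀ (norm_pos_iff.mpr hne)]
        exact ha.trans h0
    · have hab : a - b ≠ 0 := norm_pos_iff.mp (hρ₁.trans_le ha)
      refine ⟨(b - a) * C, e, mul_ne_zero (by rw [← neg_sub]; exact neg_ne_zero.mpr hab) hC,
        fun z η hz h0 h1 => ?_⟩
      obtain ⟨E, hE, hE'⟩ := H z η hz h0 h1
      refine ⟨(1 - (z - b) / (a - b)) * E, ?_, ?_⟩
      · rw [Multiset.map_cons, Multiset.prod_cons, hE]
        field_simp
        ring
      · rw [Multiset.card_cons, pow_succ']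
        refine norm_mul_sub_one_le ?_ hE'
        rw [sub_sub_cancel_left, norm_neg, norm_div, div_le_iff₀ (norm_pos_iff.mpr hab)]
        have hη : 0 ≤ η := by
          by_contra hη
          push Not at hη
          nlinarith [norm_pos_iff.mpr (sub_ne_zero.mpr hz)]
        exact h1.trans (by gcongr)

/-- Passing from radius `ra` to μ·`ra` multiplies the two monomials by μ^e and μ^k. If e > k the
quotient grows by at least μ, while comparability at both radii allows only 4K². -/
lemma exponent_le_of_comparable {A C K ra μ : ℝ} {e k : ℕ} (hra : 0 < ra) (hC : 0 < C)
    (hK : 1 ≤ K) (hμ : 4 * K ^ 2 < μ)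
    (h1 : K⁻¹ * (A * ra ^ k) ≤ 2 * (C * ra ^ e))
    (h2 : 2⁻¹ * (C * (μ * ra) ^ e) ≤ K * (A * (μ * ra) ^ k)) : e ≤ k := by
  by_contra hek
  push Not at hek
  have hK0 : 0 < K := by linarith
  have hμ1 : 1 ≤ μ := by nlinarith
  have hμ0 : 0 < μ := by linarith
  rw [inv_mul_le_iff₀ hK0] at h1
  rw [inv_mul_le_iff₀ two_pos, mul_pow, mul_pow] at h2
  have hX : 0 < C * ra ^ e := by positivity
  have h3 : μ ^ e * (C * ra ^ e) ≤ 4 * K ^ 2 * μ ^ k * (C * ra ^ e) := by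
    calc μ ^ e * (C * ra ^ e) = C * (μ ^ e * ra ^ e) := by ring
      _ ≤ 2 * K * μ ^ k * (A * ra ^ k) := by linarith
      _ ≤ 2 * K * μ ^ k * (K * (2 * (C * ra ^ e))) := by gcongr
      _ = _ := by ring
  have h4 := le_of_mul_le_mul_right h3 hX
  have h5 : μ ^ (k + 1) ≤ μ ^ e := pow_le_pow_right₀ hμ1 hek
  have h6 : μ * μ ^ k ≤ 4 * K ^ 2 * μ ^ k := by rw [← pow_succ']; exact h5.trans h4
  have := le_of_mul_le_mul_right h6 (by positivity)
  linarith

lemma le_exponent_of_comparable {A C K ra μ : ℝ} {e k : ℕ} (hra : 0 < ra) (hA : 0 < A)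
    (hK : 1 ≤ K) (hμ : 4 * K ^ 2 < μ)
    (h1 : 2⁻¹ * (C * ra ^ e) ≤ K * (A * ra ^ k))
    (h2 : K⁻¹ * (A * (μ * ra) ^ k) ≤ 2 * (C * (μ * ra) ^ e)) : k ≤ e := by
  have hK0 : 0 < K := by linarith
  refine exponent_le_of_comparable (A := C) (C := A) (K := K) (μ := μ) hra hA hK hμ ?_ ?_
  · rw [inv_mul_le_iff₀ hK0]
    linarith
  · rw [inv_mul_le_iff₀ hK0] at h2
    linarith

/-- Pigeonhole: there is one more interval [rλ^i, rλ^(i+1)) than there are points. -/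
lemma exists_gap (T : Finset ℝ) {r lam : ℝ} (hr : 0 < r) (hlam : 1 < lam) :
    ∃ i : ℕ, i ≤ T.card ∧ ∀ x ∈ T, x < r * lam ^ i ∨ r * lam ^ (i + 1) ≤ x := by
  by_contra hcon
  push Not at hcon
  have h1 : ∀ i : Fin (T.card + 1), ∃ x ∈ T, r * lam ^ (i : ℕ) ≤ x ∧ x < r * lam ^ ((i : ℕ) + 1) :=
    fun i => hcon i (by omega)
  choose x hxT hx1 hx2 using h1
  have hinj : Function.Injective x := by
    intro i j hij
    by_contra hne
    rcases lt_or_gt_of_ne hne with h | h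
    · have : r * lam ^ ((i : ℕ) + 1) ≤ r * lam ^ (j : ℕ) := by
        gcongr
        · exact hlam.le
        · exact h
      have := hx2 i
      have := hx1 j
      rw [← hij] at this
      linarith
    · have : r * lam ^ ((j : ℕ) + 1) ≤ r * lam ^ (i : ℕ) := by
        gcongr
        · exact hlam.le
        · exact h
      have := hx1 i
      have := hx2 j
      rw [← hij] at this
      linarith
  have := Finset.card_le_card_of_injOn (s := Finset.univ) (t := T) x (by intro i _; exact hxT i)
    hinj.injOn
  simp at this

lemma exists_small_pow (n : ℕ) {κ : ℝ} (hκ : 0 < κ) :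
    ∃ η : ℝ, 0 < η ∧ η < 1 ∧ (1 + η) ^ n - 1 ≤ κ := by
  have h : Filter.Tendsto (fun η : ℝ => (1 + η) ^ n - 1) (nhdsWithin 0 (Set.Ioi 0)) (nhds 0) := by
    have : Continuous fun η : ℝ => (1 + η) ^ n - 1 := by fun_prop
    have := this.tendsto 0
    simp only [add_zero, one_pow, sub_self] at this
    exact this.mono_left nhdsWithin_le_nhds
  have h1 := h.eventually (Iic_mem_nhds hκ)
  have h2 : ∀ᶠ η : ℝ in nhdsWithin 0 (Set.Ioi 0), η ∈ Set.Ioo (0 : ℝ) 1 :=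
    Ioo_mem_nhdsGT one_pos
  obtain ⟨η, h3, h4⟩ := (h1.and h2).exists
  exact ⟨η, h4.1, h4.2, h3⟩

end Gaps

/-! ### The functions f, g, h and their derivatives. -/

section AffineInvariants

/-- The derivative of `P₂' / P₁'`. -/
def slope (Γ : Curve) (z : ℂ) : ℂ := (L₂ Γ).eval z / (L₁ Γ).eval z ^ 2

/-- The quotient `(P₃' / P₁')' / (P₂' / P₁')'`. -/
def curvature (Γ : Curve) (z : ℂ) : ℂ := (wronskian₁₃ Γ).eval z / (L₂ Γ).eval z

/-- The derivative of `curvature`. -/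
def torsion (Γ : Curve) (z : ℂ) : ℂ :=
  (L₁ Γ).eval z * (L₃ Γ).eval z / (L₂ Γ).eval z ^ 2

/-- The quotient `Pᵢ' / P₁'`. -/
def affineCoord (Γ : Curve) (i : Fin 3) (z : ℂ) : ℂ :=
  (derivative (Γ i)).eval z / (L₁ Γ).eval z

lemma hasDerivAt_affineCoord_one {Γ : Curve} {z : ℂ} (h : (L₁ Γ).eval z ≠ 0) :
    HasDerivAt (affineCoord Γ 1) (slope Γ z) z := by
  refine ((derivative (Γ 1)).hasDerivAt z |>.div ((L₁ Γ).hasDerivAt z) h).congr_deriv ?_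
  rw [slope, L₂_eq]
  simp only [L₁, eval_sub, eval_mul, Function.iterate_succ, Function.comp, Function.iterate_zero, id]
  ring

lemma hasDerivAt_affineCoord_two {Γ : Curve} {z : ℂ} (h : (L₁ Γ).eval z ≠ 0)
    (h2 : (L₂ Γ).eval z ≠ 0) :
    HasDerivAt (affineCoord Γ 2) (curvature Γ z * slope Γ z) z := by
  refine ((derivative (Γ 2)).hasDerivAt z |>.div ((L₁ Γ).hasDerivAt z) h).congr_deriv ?_
  rw [slope, curvature, div_mul_div_cancel₀ h2, wronskian₁₃]
  simp only [L₁, eval_sub, eval_mul, Function.iterate_succ, Function.comp, Function.iterate_zero, id]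
  ring

lemma hasDerivAt_curvature {Γ : Curve} {z : ℂ} (h2 : (L₂ Γ).eval z ≠ 0) :
    HasDerivAt (curvature Γ) (torsion Γ z) z := by
  refine ((wronskian₁₃ Γ).hasDerivAt z |>.div ((L₂ Γ).hasDerivAt z) h2).congr_deriv ?_
  rw [torsion, ← eval_mul, ← eval_mul, ← eval_mul, ← eval_sub, wronskian_identity]

end AffineInvariants

/-! ### Pieces with a large ratio of radii: exclusion of the logarithmic exponents. -/

section LongPieces

/-- A piece whose radii span a large ratio must cross a root-free annulus. There each Lᵢ is nearly a
monomial on the full circle, not only on the piece, and comparison at two radii met by the piece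
identifies its exponent with `k i`. -/
lemma exists_monomial_circle (N : ℕ) {K κ : ℝ} (hK : 1 ≤ K) (hκ : 0 < κ) (hκ2 : κ ≤ 1 / 2) :
    ∃ Λ : ℝ, 1 ≤ Λ ∧ ∀ Γ : Curve, Γ.DegreeLE N → L₃ Γ ≠ 0 →
      ∀ (b : ℂ) (k : Fin 3 → ℕ) (A : Fin 3 → ℝ) (r₁ r₃ : ℝ), 0 < r₁ → Λ * r₁ ≤ r₃ →
        (∀ i, 0 < A i) →
        (∀ r, r₁ ≤ r → r ≤ r₃ → ∃ w, ‖w - b‖ = r ∧ ∀ i,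
          K⁻¹ * (A i * r ^ k i) ≤ ‖(L Γ i).eval w‖ ∧ ‖(L Γ i).eval w‖ ≤ K * (A i * r ^ k i)) →
        ∃ (ρ : ℝ) (C : Fin 3 → ℂ), 0 < ρ ∧ (∀ i, C i ≠ 0) ∧ ∀ i z, ‖z - b‖ = ρ →
          ∃ E : ℂ, (L Γ i).eval z = C i * (z - b) ^ k i * E ∧ ‖E - 1‖ ≤ κ := by
  obtain ⟨η, hη0, hη1, hη⟩ := exists_small_pow (3 * N) hκ
  set μ : ℝ := 4 * K ^ 2 + 1 with hμ
  have hμ1 : 1 < μ := by rw [hμ]; nlinarith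
  -- Removing a factor 1/η at both ends of a gap of ratio `lam` leaves radii of ratio μ, enough for
  -- the comparison of exponents.
  set lam : ℝ := μ / η ^ 2 with hlam
  have hη2 : η ^ 2 ≤ 1 := by nlinarith
  have hlam1 : 1 < lam := by
    rw [hlam, lt_div_iff₀ (by positivity)]
    linarith
  refine ⟨lam ^ (9 * N + 1), one_le_pow₀ hlam1.le, ?_⟩
  intro Γ hΓ hL b k A r₁ r₃ hr₁ hr₃ hA hw
  obtain ⟨i₀, hi₀, hgap⟩ := exists_gap
    ((Finset.univ.biUnion fun i : Fin 3 => (L Γ i).roots.toFinset).image fun a => ‖a - b‖)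
    hr₁ hlam1
  have hcard : i₀ ≤ 9 * N := by
    refine hi₀.trans (Finset.card_image_le.trans ?_)
    refine Finset.card_biUnion_le.trans ?_
    refine (Finset.sum_le_card_nsmul _ _ (3 * N) fun i _ => ?_).trans ?_
    · exact (Multiset.toFinset_card_le _).trans ((card_roots' _).trans (natDegree_L_le hΓ i))
    · simp; omega
  set ρ₀ := r₁ * lam ^ i₀ with hρ₀
  set ρ₁ := r₁ * lam ^ (i₀ + 1) with hρ₁
  have hρ₀0 : 0 < ρ₀ := by positivity
  have hρ₁0 : 0 < ρ₁ := by positivity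
  have hρ₁' : ρ₁ = lam * ρ₀ := by rw [hρ₁, hρ₀]; ring
  have hgap' : ∀ i, ∀ a ∈ (L Γ i).roots, ‖a - b‖ ≤ ρ₀ ∨ ρ₁ ≤ ‖a - b‖ := by
    intro i a ha
    refine (hgap ‖a - b‖ ?_).imp le_of_lt id
    exact Finset.mem_image_of_mem _ (Finset.mem_biUnion.mpr
      ⟨i, Finset.mem_univ i, Multiset.mem_toFinset.mpr ha⟩)
  have hprod := fun i => multiset_prod_on_gap hρ₁0 (L Γ i).roots (hgap' i)
  choose C e hC H using hprod
  have hcard' : ∀ i, (1 + η) ^ (L Γ i).roots.card - 1 ≤ κ := fun i => by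
    have : (1 + η) ^ (L Γ i).roots.card ≤ (1 + η) ^ (3 * N) :=
      pow_le_pow_right₀ (by linarith) ((card_roots' _).trans (natDegree_L_le hΓ i))
    linarith
  set ra := ρ₀ / η with hra
  have hra0 : 0 < ra := by positivity
  have hrb : μ * ra = η * ρ₁ := by
    rw [hρ₁', hra, hlam]
    field_simp
  set D : Fin 3 → ℂ := fun i => (L Γ i).leadingCoeff * C i with hD
  have hD0 : ∀ i, D i ≠ 0 := fun i =>
    mul_ne_zero (leadingCoeff_ne_zero.mpr (L_ne_zero hL i)) (hC i)
  have key : ∀ i z, ra ≤ ‖z - b‖ → ‖z - b‖ ≤ μ * ra → ∃ E : ℂ,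
      (L Γ i).eval z = D i * (z - b) ^ e i * E ∧ ‖E - 1‖ ≤ κ := by
    intro i z h1 h2
    have hz : z ≠ b := by
      rintro rfl
      simp at h1
      linarith
    obtain ⟨E, hE, hE'⟩ := H i z η hz (by rwa [hra, div_le_iff₀' hη0] at h1) (by rwa [← hrb])
    refine ⟨E, ?_, hE'.trans (hcard' i)⟩
    rw [eval_eq_leadingCoeff_mul_prod, hE, hD]
    ring
  clear_value D
  have key2 : ∀ i z, ra ≤ ‖z - b‖ → ‖z - b‖ ≤ μ * ra →
      2⁻¹ * (‖D i‖ * ‖z - b‖ ^ e i) ≤ ‖(L Γ i).eval z‖ ∧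
      ‖(L Γ i).eval z‖ ≤ 2 * (‖D i‖ * ‖z - b‖ ^ e i) := by
    intro i z h1 h2
    obtain ⟨E, hE, hE'⟩ := key i z h1 h2
    have e1 : ‖E‖ ≤ 2 := by
      have := norm_sub_norm_le E 1
      rw [norm_one] at this
      linarith
    have e2 : 2⁻¹ ≤ ‖E‖ := by
      have := norm_sub_norm_le 1 E
      rw [norm_one, norm_sub_rev] at this
      linarith
    rw [hE, norm_mul, norm_mul (D i), norm_pow, mul_comm _ ‖E‖]
    constructor <;> gcongr
  have hraη : ρ₀ ≤ ra := by
    rw [hra, le_div_iff₀ hη0]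
    nlinarith
  have hr₁ρ₀ : r₁ ≤ ρ₀ := by
    rw [hρ₀]
    exact le_mul_of_one_le_right hr₁.le (one_le_pow₀ hlam1.le)
  have hrarb : ra ≤ μ * ra := le_mul_of_one_le_left hra0.le hμ1.le
  have hrbr₃ : μ * ra ≤ r₃ := by
    rw [hrb]
    calc η * ρ₁ ≤ ρ₁ := mul_le_of_le_one_left hρ₁0.le hη1.le
      _ ≤ r₁ * lam ^ (9 * N + 1) := by
        rw [hρ₁]
        gcongr
        exact hlam1.le
      _ ≤ r₃ := by rwa [mul_comm]
  obtain ⟨w₁, hw₁, hw₁'⟩ := hw ra (by linarith) (by linarith)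
  obtain ⟨w₂, hw₂, hw₂'⟩ := hw (μ * ra) (by linarith) hrbr₃
  have hek : ∀ i, e i = k i := by
    intro i
    have h1 := key2 i w₁ hw₁.ge (by rw [hw₁]; exact hrarb)
    have h2 := key2 i w₂ (by rw [hw₂]; exact hrarb) hw₂.le
    rw [hw₁] at h1
    rw [hw₂] at h2
    have hDi := norm_pos_iff.mpr (hD0 i)
    refine le_antisymm ?_ ?_
    · exact exponent_le_of_comparable (A := A i) (C := ‖D i‖) hra0 hDi hK (by rw [hμ]; linarith)
        ((hw₁' i).1.trans h1.2) (h2.1.trans (hw₂' i).2)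
    · exact le_exponent_of_comparable (A := A i) (C := ‖D i‖) hra0 (hA i) hK (by rw [hμ]; linarith)
        (h1.1.trans (hw₁' i).2) ((hw₂' i).1.trans h2.2)
  refine ⟨ra, D, hra0, hD0, fun i z hz => ?_⟩
  rw [← hek i]
  exact key i z hz.ge (by rw [hz]; exact hrarb)

lemma norm_div_sub_one_le {x y : ℂ} {κ : ℝ} (hκ : κ ≤ 1 / 10) (hx : ‖x - 1‖ ≤ 3 * κ)
    (hy : ‖y - 1‖ ≤ 3 * κ) : ‖x / y - 1‖ ≤ 10 * κ := by
  have h1 : 7 / 10 ≤ ‖y‖ := by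
    have := norm_sub_norm_le 1 y
    rw [norm_one, norm_sub_rev] at this
    linarith
  have hy0 : y ≠ 0 := norm_pos_iff.mp (by linarith)
  have h2 : x / y - 1 = ((x - 1) - (y - 1)) / y := by field_simp; ring
  have hκ0 : 0 ≤ κ := by linarith [norm_nonneg (x - 1)]
  rw [h2, norm_div, div_le_iff₀ (by linarith)]
  calc _ ≤ ‖x - 1‖ + ‖y - 1‖ := norm_sub_le _ _
    _ ≤ 10 * κ * (7 / 10) := by linarith
    _ ≤ _ := by gcongr

lemma norm_mul_sub_one_le' {x y : ℂ} {κ : ℝ} (hκ : κ ≤ 1) (hx : ‖x - 1‖ ≤ κ)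
    (hy : ‖y - 1‖ ≤ κ) : ‖x * y - 1‖ ≤ 3 * κ := by
  have := norm_mul_sub_one_le (E := 1 + κ) hx (by linarith)
  have hκ0 : 0 ≤ κ := (norm_nonneg _).trans hx
  nlinarith

lemma ne_zero_of_norm_sub_one_le {x : ℂ} {κ : ℝ} (hκ : κ < 1) (hx : ‖x - 1‖ ≤ κ) : x ≠ 0 := by
  rintro rfl
  rw [zero_sub, norm_neg, norm_one] at hx
  linarith

/-- Logarithmic exponents do not occur on pieces with a large ratio of the radii. -/
lemma exists_radii_ratio_bound (N : ℕ) {K : ℝ} (hK : 1 ≤ K) :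
    ∃ Λ : ℝ, 1 ≤ Λ ∧ ∀ Γ : Curve, Γ.DegreeLE N → L₃ Γ ≠ 0 →
      ∀ (b : ℂ) (k : Fin 3 → ℕ) (A : Fin 3 → ℝ) (r₁ r₃ : ℝ), 0 < r₁ →
        (∀ i, 0 < A i) →
        (∀ r, r₁ ≤ r → r ≤ r₃ → ∃ w, ‖w - b‖ = r ∧ ∀ i,
          K⁻¹ * (A i * r ^ k i) ≤ ‖(L Γ i).eval w‖ ∧ ‖(L Γ i).eval w‖ ≤ K * (A i * r ^ k i)) →
        (σ₂ k = -1 ∨ (σ₂ k = -3 ∧ σ₃ k = 1)) → r₃ ≤ Λ * r₁ := by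
  -- A quotient of products of such factors is within 10κ = 1/100 of 1, the tolerance of the residue
  -- lemmas.
  obtain ⟨Λ, hΛ, H⟩ := exists_monomial_circle N (κ := 1 / 1000) hK (by norm_num) (by norm_num)
  refine ⟨Λ, hΛ, ?_⟩
  intro Γ hΓ hL b k A r₁ r₃ hr₁ hA hw hσ
  by_contra hcon
  push Not at hcon
  obtain ⟨ρ, C, hρ, hC, hE⟩ := H Γ hΓ hL b k A r₁ r₃ hr₁ hcon.le hA hw
  choose! E hE hE1 using hE
  have hne : ∀ z ∈ Metric.sphere b ρ, z - b ≠ 0 := fun z hz => by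
    rw [← norm_pos_iff, mem_sphere_iff_norm.mp hz]
    exact hρ
  have hE0 : ∀ i, ∀ z ∈ Metric.sphere b ρ, E i z ≠ 0 := fun i z hz =>
    ne_zero_of_norm_sub_one_le (by norm_num) (hE1 i z (mem_sphere_iff_norm.mp hz))
  have hL0 : ∀ i, ∀ z ∈ Metric.sphere b ρ, (L Γ i).eval z ≠ 0 := fun i z hz => by
    rw [hE i z (mem_sphere_iff_norm.mp hz)]
    exact mul_ne_zero (mul_ne_zero (hC i) (pow_ne_zero _ (hne z hz))) (hE0 i z hz)
  have hcont : ContinuousOn (slope Γ) (Metric.sphere b ρ) := by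
    unfold slope
    refine (L₂ Γ).continuous.continuousOn.div ((L₁ Γ).continuous.continuousOn.pow 2) fun z hz => ?_
    exact pow_ne_zero _ (hL0 0 z hz)
  have hf : ∀ z ∈ Metric.sphere b ρ, HasDerivAt (affineCoord Γ 1) (slope Γ z) z :=
    fun z hz => hasDerivAt_affineCoord_one (hL0 0 z hz)
  have hslope : ∀ z ∈ Metric.sphere b ρ, slope Γ z * (C 0 ^ 2 * (z - b) ^ (2 * k 0)) =
      C 1 * (z - b) ^ k 1 * (E 1 z / (E 0 z * E 0 z)) := by
    intro z hz
    have h0 := hE 0 z (mem_sphere_iff_norm.mp hz)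
    have h1 := hE 1 z (mem_sphere_iff_norm.mp hz)
    change (L₁ Γ).eval z = _ at h0
    change (L₂ Γ).eval z = _ at h1
    rw [slope, h0, h1]
    have := hne z hz
    have := hE0 0 z hz
    have := hC 0
    field_simp
    rw [pow_mul']
  have hEs : ∀ z ∈ Metric.sphere b ρ, ‖E 1 z / (E 0 z * E 0 z) - 1‖ ≤ 1 / 100 := fun z hz => by
    have h0 := hE1 0 z (mem_sphere_iff_norm.mp hz)
    have h1 := hE1 1 z (mem_sphere_iff_norm.mp hz)
    have := norm_div_sub_one_le (κ := 1 / 1000) (by norm_num) (h1.trans (by norm_num))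
      (norm_mul_sub_one_le' (by norm_num) h0 h0)
    linarith
  rcases hσ with hσ | ⟨hσ, hσ'⟩
  -- Here the slope is close to C/(z - b).
  · have hk : 2 * k 0 = k 1 + 1 := by simp only [σ₂] at hσ; omega
    have h := eq_zero_of_derivative_near_inv (C := C 1 / C 0 ^ 2) (κ := 1 / 100) hρ (by norm_num)
      hcont hf fun z hz => by
        have h1 := hslope z hz
        rw [hk] at h1
        have h2 : slope Γ z * (z - b) - C 1 / C 0 ^ 2 =
            C 1 / C 0 ^ 2 * (E 1 z / (E 0 z * E 0 z) - 1) := by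
          have := hC 0
          have := pow_ne_zero (k 1) (hne z hz)
          rw [mul_sub (C 1 / C 0 ^ 2), mul_one, sub_left_inj, div_mul_eq_mul_div,
            eq_div_iff (pow_ne_zero 2 (hC 0))]
          apply mul_right_cancel₀ this
          linear_combination h1
        rw [h2, norm_mul, mul_comm]
        gcongr
        exact hEs z hz
    exact div_ne_zero (hC 1) (pow_ne_zero 2 (hC 0)) h
  -- Here the slope is close to C(z - b)⁻³ and the torsion to D(z - b).
  · have hk : 2 * k 0 = k 1 + 3 := by simp only [σ₂] at hσ; omega
    have hk' : k 2 + k 0 = 2 * k 1 + 1 := by simp only [σ₃] at hσ'; omega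
    have h := eq_zero_of_iterated_derivatives (C := C 1 / C 0 ^ 2) (D := C 0 * C 2 / C 1 ^ 2)
      (h := curvature Γ) (v := torsion Γ) (g := affineCoord Γ 2) hρ hcont hf
      (fun z hz => hasDerivAt_curvature (hL0 1 z hz))
      (fun z hz => hasDerivAt_affineCoord_two (hL0 0 z hz) (hL0 1 z hz))
      (fun z hz => by
        have h1 := hslope z hz
        rw [hk] at h1
        have h2 : slope Γ z * (z - b) ^ 3 - C 1 / C 0 ^ 2 =
            C 1 / C 0 ^ 2 * (E 1 z / (E 0 z * E 0 z) - 1) := by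
          have := hC 0
          have := pow_ne_zero (k 1) (hne z hz)
          rw [mul_sub (C 1 / C 0 ^ 2), mul_one, sub_left_inj, div_mul_eq_mul_div,
            eq_div_iff (pow_ne_zero 2 (hC 0))]
          apply mul_right_cancel₀ this
          linear_combination h1
        rw [h2, norm_mul, mul_comm]
        gcongr
        exact hEs z hz)
      (fun z hz => by
        have hz' := mem_sphere_iff_norm.mp hz
        have h0 := hE 0 z hz'
        have h1 := hE 1 z hz'
        have h2 := hE 2 z hz'
        change (L₁ Γ).eval z = _ at h0
        change (L₂ Γ).eval z = _ at h1
        change (L₃ Γ).eval z = _ at h2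
        have h3 : torsion Γ z - C 0 * C 2 / C 1 ^ 2 * (z - b) =
            C 0 * C 2 / C 1 ^ 2 * (z - b) * (E 0 z * E 2 z / (E 1 z * E 1 z) - 1) := by
          have e0 := hne z hz
          have e1 := hE0 1 z hz
          have e2 := hC 1
          have e3 : (z - b) ^ k 2 * (z - b) ^ k 0 = ((z - b) ^ k 1) ^ 2 * (z - b) := by
            rw [← pow_add, hk', pow_succ, mul_comm 2, pow_mul]
          rw [mul_sub (C 0 * C 2 / C 1 ^ 2 * (z - b)), mul_one, sub_left_inj, torsion, h0, h1, h2]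
          field_simp
          linear_combination (C 0 * C 2 * E 0 z * E 2 z) * e3
        rw [h3, norm_mul, norm_mul, hz', mul_comm]
        gcongr
        have := norm_div_sub_one_le (κ := 1 / 1000) (by norm_num)
          (norm_mul_sub_one_le' (by norm_num) (hE1 0 z hz') (hE1 2 z hz'))
          (norm_mul_sub_one_le' (by norm_num) (hE1 1 z hz') (hE1 1 z hz'))
        linarith)
    rcases h with h | h
    · exact div_ne_zero (hC 1) (pow_ne_zero 2 (hC 0)) h
    · exact div_ne_zero (mul_ne_zero (hC 0) (hC 2)) (pow_ne_zero 2 (hC 1)) h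

end LongPieces

/-! ### The real inequality between radii and side lengths. -/

section PowerInequalities

lemma rpow_mul_rpow_le {x y C : ℝ} (hx : 0 < x) (hy : 0 < y) (hC : 1 ≤ C) (hxy : x ≤ C * y)
    {p e : ℝ} (hpe : p ≤ e) (m : ℝ) :
    x ^ e * y ^ (m - e) ≤ C ^ (e - p) * (x ^ p * y ^ (m - p)) := by
  have h1 : x ^ e = x ^ (e - p) * x ^ p := by rw [← Real.rpow_add hx]; ring_nf
  have h2 : y ^ (m - p) = y ^ (e - p) * y ^ (m - e) := by rw [← Real.rpow_add hy]; ring_nf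
  have h3 : x ^ (e - p) ≤ C ^ (e - p) * y ^ (e - p) := by
    rw [← Real.mul_rpow (by linarith) hy.le]
    exact Real.rpow_le_rpow hx.le hxy (by linarith)
  rw [h1, h2]
  calc x ^ (e - p) * x ^ p * y ^ (m - e) ≤ C ^ (e - p) * y ^ (e - p) * x ^ p * y ^ (m - e) := by gcongr
    _ = _ := by ring

lemma rpow_le_abs_mul {x y C : ℝ} (hx : 0 < x) (hy : 0 < y) (hC : 1 ≤ C) (hxy : x ≤ C * y)
    (hyx : y ≤ C * x) (p : ℝ) : x ^ p ≤ C ^ |p| * y ^ p := by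
  rcases le_total 0 p with hp | hp
  · rw [abs_of_nonneg hp, ← Real.mul_rpow (by linarith) hy.le]
    exact Real.rpow_le_rpow hx.le hxy hp
  · rw [abs_of_nonpos hp, Real.rpow_neg (by linarith), ← Real.inv_rpow (by linarith),
      ← Real.mul_rpow (by positivity) hy.le]
    refine Real.rpow_le_rpow_of_nonpos (by positivity) ?_ hp
    rw [inv_mul_le_iff₀ (by linarith)]
    exact hyx

lemma rpow_mul_rpow_le_abs {x y C : ℝ} (hx : 0 < x) (hy : 0 < y) (hC : 1 ≤ C) (hxy : x ≤ C * y)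
    (hyx : y ≤ C * x) (p e m : ℝ) :
    x ^ e * y ^ (m - e) ≤ C ^ |e - p| * (x ^ p * y ^ (m - p)) := by
  have h1 : x ^ e = x ^ (e - p) * x ^ p := by rw [← Real.rpow_add hx]; ring_nf
  have h2 : y ^ (m - p) = y ^ (e - p) * y ^ (m - e) := by rw [← Real.rpow_add hy]; ring_nf
  have h3 := rpow_le_abs_mul hx hy hC hxy hyx (e - p)
  rw [h1, h2]
  calc x ^ (e - p) * x ^ p * y ^ (m - e)
      ≤ C ^ |e - p| * y ^ (e - p) * x ^ p * y ^ (m - e) := by gcongr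
    _ = _ := by ring

/-- The configurations of radii and distances of three points in a narrow sector. -/
structure RadialConfig (x₁ x₂ x₃ d₁ d₃ : ℝ) : Prop where
  pos₁ : 0 < x₁
  pos₂ : 0 < x₂
  pos₃ : 0 < x₃
  le₁₂ : x₁ ≤ 5 * x₂
  le₂₃ : x₂ ≤ 5 * x₃
  nonneg₁ : 0 ≤ d₁
  nonneg₃ : 0 ≤ d₃
  d₁_le : d₁ ≤ 7 * x₂
  d₃_le : d₃ ≤ 7 * x₃
  le_d₁ : x₂ - x₁ ≤ d₁
  le_d₃ : x₃ - x₂ ≤ d₃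

variable {x₁ x₂ x₃ d₁ d₃ E₁ E₃ F₁ F₃ c q s t : ℝ}

/-- The exponents of x₂ in E₁F₃ add up to q, so d₃E₁F₃ already gives (x₁x₂x₃)^q d₃. If x₃ ≥ 2x₂,
then d₁ ≤ 7d₃ and this suffices; otherwise x₂ and x₃ are comparable and d₁E₃F₁ supplies the part
with d₁. -/
lemma RadialConfig.bound_of_outer (h : RadialConfig x₁ x₂ x₃ d₁ d₃) (hc : 0 < c)
    (hq : 3 * q = 2 * s + t)
    (hE₁ : c * (x₁ ^ q * x₂ ^ (s - q)) ≤ E₁) (hF₃ : c * (x₃ ^ q * x₂ ^ (s + t - q)) ≤ F₃)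
    (hE₃ : c * (x₂ ^ (s + 1) * x₃ ^ (-1 : ℝ)) ≤ E₃) (hF₁ : c * (x₁ ^ q * x₂ ^ (s + t - q)) ≤ F₁) :
    c ^ 2 * (5 ^ |q|)⁻¹ / 8 * ((x₁ * x₂ * x₃) ^ q * (d₁ + d₃)) ≤ d₃ * (E₁ * F₃) + d₁ * (E₃ * F₁) := by
  obtain ⟨p1, p2, p3, l12, l23, n1, n3, u1, u3, v1, v3⟩ := h
  have hX : (x₁ * x₂ * x₃) ^ q = x₁ ^ q * x₂ ^ q * x₃ ^ q := by
    rw [Real.mul_rpow (by positivity) p3.le, Real.mul_rpow p1.le p2.le]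
  have h5 : 1 ≤ (5 : ℝ) ^ |q| := Real.one_le_rpow (by norm_num) (abs_nonneg q)
  have h5' : ((5 : ℝ) ^ |q|)⁻¹ ≤ 1 := inv_le_one_of_one_le₀ h5
  have h1 : c ^ 2 * (x₁ * x₂ * x₃) ^ q ≤ E₁ * F₃ := by
    calc c ^ 2 * (x₁ * x₂ * x₃) ^ q = c * (x₁ ^ q * x₂ ^ (s - q)) * (c * (x₃ ^ q * x₂ ^ (s + t - q))) := by
          have : x₂ ^ q = x₂ ^ (s - q) * x₂ ^ (s + t - q) := by
            rw [← Real.rpow_add p2]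
            congr 1
            linarith
          rw [hX, this]
          ring
      _ ≤ E₁ * F₃ := mul_le_mul hE₁ hF₃ (by positivity) (le_trans (by positivity) hE₁)
  have hX0 : 0 < (x₁ * x₂ * x₃) ^ q := by positivity
  have hE₃F₁ : 0 ≤ E₃ * F₁ := mul_nonneg (le_trans (by positivity) hE₃) (le_trans (by positivity) hF₁)
  have hs1 : d₃ * (c ^ 2 * (x₁ * x₂ * x₃) ^ q) ≤ d₃ * (E₁ * F₃) := by gcongr
  rcases le_total (2 * x₂) x₃ with hx | hx
  · have hd : d₁ + d₃ ≤ 8 * d₃ := by linarith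
    have hs2 : 0 ≤ d₁ * (E₃ * F₁) := by positivity
    calc c ^ 2 * (5 ^ |q|)⁻¹ / 8 * ((x₁ * x₂ * x₃) ^ q * (d₁ + d₃))
        ≤ c ^ 2 * 1 / 8 * ((x₁ * x₂ * x₃) ^ q * (8 * d₃)) := by gcongr
      _ = d₃ * (c ^ 2 * (x₁ * x₂ * x₃) ^ q) := by ring
      _ ≤ _ := by linarith
  · have h2 : c ^ 2 * (5 ^ |q|)⁻¹ / 2 * (x₁ * x₂ * x₃) ^ q ≤ E₃ * F₁ := by
      have e1 : x₃ ^ q ≤ 5 ^ |q| * x₂ ^ q :=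
        rpow_le_abs_mul p3 p2 (by norm_num) (by linarith) l23 q
      have e2 : x₂ ^ (-1 : ℝ) ≤ 2 * x₃ ^ (-1 : ℝ) := by
        rw [Real.rpow_neg_one, Real.rpow_neg_one, ← div_eq_mul_inv, le_div_iff₀ p3,
          inv_mul_le_iff₀ p2]
        linarith
      have e3 : x₂ ^ q * x₂ ^ q = x₂ ^ (s + 1) * x₂ ^ (s + t - q) * x₂ ^ (-1 : ℝ) := by
        rw [← Real.rpow_add p2, ← Real.rpow_add p2, ← Real.rpow_add p2]
        congr 1
        linarith
      calc c ^ 2 * (5 ^ |q|)⁻¹ / 2 * (x₁ * x₂ * x₃) ^ q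
          ≤ c ^ 2 * (5 ^ |q|)⁻¹ / 2 * (x₁ ^ q * x₂ ^ q * (5 ^ |q| * x₂ ^ q)) := by
            rw [hX]; gcongr
        _ = c ^ 2 / 2 * x₁ ^ q * (x₂ ^ q * x₂ ^ q) := by field_simp
        _ = c ^ 2 / 2 * x₁ ^ q * (x₂ ^ (s + 1) * x₂ ^ (s + t - q) * x₂ ^ (-1 : ℝ)) := by rw [e3]
        _ ≤ c ^ 2 / 2 * x₁ ^ q * (x₂ ^ (s + 1) * x₂ ^ (s + t - q) * (2 * x₃ ^ (-1 : ℝ))) := by gcongr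
        _ = c * (x₂ ^ (s + 1) * x₃ ^ (-1 : ℝ)) * (c * (x₁ ^ q * x₂ ^ (s + t - q))) := by ring
        _ ≤ E₃ * F₁ := mul_le_mul hE₃ hF₁ (by positivity) (le_trans (by positivity) hE₃)
    have hs2 : d₁ * (c ^ 2 * (5 ^ |q|)⁻¹ / 2 * (x₁ * x₂ * x₃) ^ q) ≤ d₁ * (E₃ * F₁) := by gcongr
    refine le_trans ?_ (add_le_add hs1 hs2)
    have e1 : c ^ 2 * (5 ^ |q|)⁻¹ * (x₁ * x₂ * x₃) ^ q * d₃ ≤ c ^ 2 * 1 * (x₁ * x₂ * x₃) ^ q * d₃ := by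
      gcongr
    have e2 : 0 ≤ c ^ 2 * (5 ^ |q|)⁻¹ * (x₁ * x₂ * x₃) ^ q * d₃ := by positivity
    have e3 : 0 ≤ c ^ 2 * (5 ^ |q|)⁻¹ * (x₁ * x₂ * x₃) ^ q * d₁ := by positivity
    linarith

/-- Here E₃F₁ exceeds (x₁x₂x₃)^q by the factor x₃/x₂. If x₂ ≥ 2x₁, then d₁ is at least x₂/2 and
d₁x₃/x₂ controls d₃; otherwise x₁ and x₂ are comparable and d₃E₁F₃ supplies the part with d₃. -/
lemma RadialConfig.bound_of_inner (h : RadialConfig x₁ x₂ x₃ d₁ d₃) (hc : 0 < c)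
    (hq : 3 * q = 2 * s + t)
    (hE₃ : c * (x₃ ^ (q + 1) * x₂ ^ (s - q - 1)) ≤ E₃)
    (hF₁ : c * (x₁ ^ q * x₂ ^ (s + t - q)) ≤ F₁)
    (hE₁ : c * x₂ ^ s ≤ E₁) (hF₃ : c * (x₃ ^ q * x₂ ^ (s + t - q)) ≤ F₃) :
    c ^ 2 * (5 ^ |q|)⁻¹ / 20 * ((x₁ * x₂ * x₃) ^ q * (d₁ + d₃)) ≤
      d₃ * (E₁ * F₃) + d₁ * (E₃ * F₁) := by
  obtain ⟨p1, p2, p3, l12, l23, n1, n3, u1, u3, v1, v3⟩ := h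
  have hX : (x₁ * x₂ * x₃) ^ q = x₁ ^ q * x₂ ^ q * x₃ ^ q := by
    rw [Real.mul_rpow (by positivity) p3.le, Real.mul_rpow p1.le p2.le]
  have h5 : 1 ≤ (5 : ℝ) ^ |q| := Real.one_le_rpow (by norm_num) (abs_nonneg q)
  have h5' : ((5 : ℝ) ^ |q|)⁻¹ ≤ 1 := inv_le_one_of_one_le₀ h5
  have h1 : c ^ 2 * (x₁ * x₂ * x₃) ^ q * (x₃ / x₂) ≤ E₃ * F₁ := by
    calc c ^ 2 * (x₁ * x₂ * x₃) ^ q * (x₃ / x₂) =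
          c * (x₃ ^ (q + 1) * x₂ ^ (s - q - 1)) * (c * (x₁ ^ q * x₂ ^ (s + t - q))) := by
          have e1 : x₂ ^ (s - q - 1) * x₂ ^ (s + t - q) = x₂ ^ q * x₂⁻¹ := by
            rw [← Real.rpow_neg_one, ← Real.rpow_add p2, ← Real.rpow_add p2]
            congr 1
            linarith
          have e2 : x₃ ^ (q + 1) = x₃ ^ q * x₃ := by rw [Real.rpow_add_one p3.ne']
          rw [hX, e2, div_eq_mul_inv]
          linear_combination (-c ^ 2 * x₁ ^ q * x₃ ^ q * x₃) * e1
      _ ≤ E₃ * F₁ := mul_le_mul hE₃ hF₁ (by positivity) (le_trans (by positivity) hE₃)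
  have hX0 : 0 < (x₁ * x₂ * x₃) ^ q := by positivity
  have hE₁F₃ : 0 ≤ E₁ * F₃ := mul_nonneg (le_trans (by positivity) hE₁) (le_trans (by positivity) hF₃)
  have hs1 : d₁ * (c ^ 2 * (x₁ * x₂ * x₃) ^ q * (x₃ / x₂)) ≤ d₁ * (E₃ * F₁) := by gcongr
  have hR : 1 / 5 ≤ x₃ / x₂ := by
    rw [le_div_iff₀ p2]
    linarith
  rcases le_total (2 * x₁) x₂ with hx | hx
  · have hd : d₁ + d₃ ≤ 20 * (d₁ * (x₃ / x₂)) := by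
      have e1 : d₁ ≤ 5 * (d₁ * (x₃ / x₂)) := by nlinarith
      have e2 : d₃ ≤ 14 * (d₁ * (x₃ / x₂)) := by
        have : x₃ ≤ 2 * (d₁ * (x₃ / x₂)) := by
          rw [← mul_div_assoc, ← mul_div_assoc, le_div_iff₀ p2]
          nlinarith
        linarith
      have e3 : 0 ≤ d₁ * (x₃ / x₂) := by positivity
      linarith
    have hs2 : 0 ≤ d₃ * (E₁ * F₃) := by positivity
    calc c ^ 2 * (5 ^ |q|)⁻¹ / 20 * ((x₁ * x₂ * x₃) ^ q * (d₁ + d₃))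
        ≤ c ^ 2 * 1 / 20 * ((x₁ * x₂ * x₃) ^ q * (20 * (d₁ * (x₃ / x₂)))) := by gcongr
      _ = d₁ * (c ^ 2 * (x₁ * x₂ * x₃) ^ q * (x₃ / x₂)) := by ring
      _ ≤ _ := by linarith
  · have h2 : c ^ 2 * (5 ^ |q|)⁻¹ * (x₁ * x₂ * x₃) ^ q ≤ E₁ * F₃ := by
      have e1 : x₁ ^ q ≤ 5 ^ |q| * x₂ ^ q :=
        rpow_le_abs_mul p1 p2 (by norm_num) l12 (by linarith) q
      have e3 : x₂ ^ q * x₂ ^ q = x₂ ^ s * x₂ ^ (s + t - q) := by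
        rw [← Real.rpow_add p2, ← Real.rpow_add p2]
        congr 1
        linarith
      calc c ^ 2 * (5 ^ |q|)⁻¹ * (x₁ * x₂ * x₃) ^ q
          ≤ c ^ 2 * (5 ^ |q|)⁻¹ * (5 ^ |q| * x₂ ^ q * x₂ ^ q * x₃ ^ q) := by
            rw [hX]; gcongr
        _ = c ^ 2 * x₃ ^ q * (x₂ ^ q * x₂ ^ q) := by field_simp
        _ = c * x₂ ^ s * (c * (x₃ ^ q * x₂ ^ (s + t - q))) := by rw [e3]; ring
        _ ≤ E₁ * F₃ := mul_le_mul hE₁ hF₃ (by positivity) (le_trans (by positivity) hE₁)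
    have hs2 : d₃ * (c ^ 2 * (5 ^ |q|)⁻¹ * (x₁ * x₂ * x₃) ^ q) ≤ d₃ * (E₁ * F₃) := by gcongr
    refine le_trans ?_ (add_le_add hs2 hs1)
    have e1 : c ^ 2 * (5 ^ |q|)⁻¹ * (x₁ * x₂ * x₃) ^ q * (d₁ * (1 / 5)) ≤
        c ^ 2 * 1 * (x₁ * x₂ * x₃) ^ q * (d₁ * (x₃ / x₂)) := by
      gcongr
    have e2 : 0 ≤ c ^ 2 * (5 ^ |q|)⁻¹ * (x₁ * x₂ * x₃) ^ q * d₃ := by positivity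
    have e3 : 0 ≤ c ^ 2 * (5 ^ |q|)⁻¹ * (x₁ * x₂ * x₃) ^ q * d₁ := by positivity
    linarith

/-- Lower bounds for the integrals of `x ^ s` and of `x ^ s ∫ x ^ t` along the two sides that meet
at the middle vertex. -/
structure SideBounds (s t x₁ x₂ x₃ E₁ E₃ F₁ F₃ : ℝ) : Prop where
  E₁_near : x₁ ^ (0 : ℝ) * x₂ ^ (s - 0) ≤ E₁
  E₁_far : x₁ ^ (s + 1) * x₂ ^ (s - (s + 1)) ≤ E₁
  E₃_near : x₂ ^ (s + 1) * x₃ ^ (s - (s + 1)) ≤ E₃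
  E₃_far : x₂ ^ (0 : ℝ) * x₃ ^ (s - 0) ≤ E₃
  F₁_near : x₁ ^ (0 : ℝ) * x₂ ^ (s + t - 0) ≤ F₁
  F₁_mid : x₁ ^ (s + 1) * x₂ ^ (s + t - (s + 1)) ≤ F₁
  F₁_far : x₁ ^ (s + t + 2) * x₂ ^ (s + t - (s + t + 2)) ≤ F₁
  F₃_near : x₂ ^ (s + t + 2) * x₃ ^ (s + t - (s + t + 2)) ≤ F₃
  F₃_mid : x₂ ^ (t + 1) * x₃ ^ (s + t - (t + 1)) ≤ F₃
  F₃_far : x₂ ^ (0 : ℝ) * x₃ ^ (s + t - 0) ≤ F₃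

/-- As x is at most a multiple of y, moving exponent from y to x only decreases the product, up to a
constant. This is why `SideBounds` writes every bound as x^p y^(m-p): only p matters for the
comparison with a target exponent. -/
lemma exists_interpolation {C p e : ℝ} (hC : 1 ≤ C) (hpe : p ≤ e) (m : ℝ) :
    ∃ c : ℝ, 0 < c ∧ c ≤ 1 ∧ ∀ x y F : ℝ, 0 < x → 0 < y → x ≤ C * y → x ^ p * y ^ (m - p) ≤ F →
      c * (x ^ e * y ^ (m - e)) ≤ F := by
  have hC0 : 0 < C := by linarith
  refine ⟨(C ^ (e - p))⁻¹, by positivity, inv_le_one_of_one_le₀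
    (Real.one_le_rpow hC (by linarith)), fun x y F hx hy hxy h => ?_⟩
  rw [inv_mul_le_iff₀ (by positivity)]
  refine (rpow_mul_rpow_le hx hy hC hxy hpe m).trans ?_
  gcongr

/-- The real inequality behind the geometric inequality, for the exponents for which no
cancellation between the polynomials has to be used. -/
lemma exists_radial_bound {s t : ℤ} (ht : t ≠ -1) (hst : 2 * s + t < -4 ∨ 0 ≤ 2 * s + t)
    (hs : s ≠ -1) (hst' : ¬ (s = -3 ∧ t = 1)) :
    ∃ c : ℝ, 0 < c ∧ ∀ x₁ x₂ x₃ d₁ d₃ E₁ E₃ F₁ F₃ : ℝ, RadialConfig x₁ x₂ x₃ d₁ d₃ →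
      SideBounds s t x₁ x₂ x₃ E₁ E₃ F₁ F₃ →
      c * ((x₁ * x₂ * x₃) ^ ((2 * s + t : ℝ) / 3) * (d₁ + d₃)) ≤
        d₃ * (E₁ * F₃) + d₁ * (E₃ * F₁) := by
  set q : ℝ := (2 * s + t : ℝ) / 3 with hq
  have hq3 : 3 * q = 2 * s + t := by rw [hq]; ring
  have cast_le : ∀ a b : ℤ, a ≤ b → (a : ℝ) ≤ b := fun a b h => by exact_mod_cast h
  obtain ⟨cA, hcA, hcA1, HA⟩ : ∃ c : ℝ, 0 < c ∧ c ≤ 1 ∧ ∀ x₁ x₂ x₃ d₁ d₃ E₁ E₃ F₁ F₃ : ℝ,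
      RadialConfig x₁ x₂ x₃ d₁ d₃ → SideBounds s t x₁ x₂ x₃ E₁ E₃ F₁ F₃ →
      c * (x₁ ^ q * x₂ ^ (s + t - q)) ≤ F₁ := by
    -- Given 2s + t ≤ -5 or 2s + t ≥ 0, this fails only for (s, t) = (-2, -1) and (-3, -1), excluded
    -- by t ≠ -1.
    have : 0 ≤ 2 * s + t ∨ 3 * s + 3 ≤ 2 * s + t ∨ 3 * s + 3 * t + 6 ≤ 2 * s + t := by omega
    rcases this with h | h | h <;> have h := cast_le _ _ h <;> push_cast at h
    · obtain ⟨c, hc, hc1, H⟩ := exists_interpolation (C := 5) (by norm_num)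
        (show (0 : ℝ) ≤ q by linarith) (s + t)
      exact ⟨c, hc, hc1, fun _ _ _ _ _ _ _ _ _ h h' => H _ _ _ h.pos₁ h.pos₂ h.le₁₂ h'.F₁_near⟩
    · obtain ⟨c, hc, hc1, H⟩ := exists_interpolation (C := 5) (by norm_num)
        (show (s + 1 : ℝ) ≤ q by linarith) (s + t)
      exact ⟨c, hc, hc1, fun _ _ _ _ _ _ _ _ _ h h' => H _ _ _ h.pos₁ h.pos₂ h.le₁₂ h'.F₁_mid⟩
    · obtain ⟨c, hc, hc1, H⟩ := exists_interpolation (C := 5) (by norm_num)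
        (show (s + t + 2 : ℝ) ≤ q by linarith) (s + t)
      exact ⟨c, hc, hc1, fun _ _ _ _ _ _ _ _ _ h h' => H _ _ _ h.pos₁ h.pos₂ h.le₁₂ h'.F₁_far⟩
  obtain ⟨cB, hcB, hcB1, HB⟩ : ∃ c : ℝ, 0 < c ∧ c ≤ 1 ∧ ∀ x₁ x₂ x₃ d₁ d₃ E₁ E₃ F₁ F₃ : ℝ,
      RadialConfig x₁ x₂ x₃ d₁ d₃ → SideBounds s t x₁ x₂ x₃ E₁ E₃ F₁ F₃ →
      c * (x₃ ^ q * x₂ ^ (s + t - q)) ≤ F₃ := by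
    -- This fails only for (-3, 1), (-2, -1), (-1, -3) and (1, -1), all of them excluded.
    have : 2 * s + t + 6 ≤ 0 ∨ 2 * s + t + 6 ≤ 3 * s + 3 ∨ 2 * s + t + 6 ≤ 3 * s + 3 * t + 6 := by
      omega
    rcases this with h | h | h <;> have h := cast_le _ _ h <;> push_cast at h
    · obtain ⟨c, hc, hc1, H⟩ := exists_interpolation (C := 5) (by norm_num)
        (show (s + t + 2 : ℝ) ≤ s + t - q by linarith) (s + t)
      refine ⟨c, hc, hc1, fun _ _ _ _ _ _ _ _ _ h h' => ?_⟩
      have := H _ _ _ h.pos₂ h.pos₃ h.le₂₃ h'.F₃_near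
      rwa [sub_sub_cancel, mul_comm (_ ^ (_ : ℝ))] at this
    · obtain ⟨c, hc, hc1, H⟩ := exists_interpolation (C := 5) (by norm_num)
        (show (t + 1 : ℝ) ≤ s + t - q by linarith) (s + t)
      refine ⟨c, hc, hc1, fun _ _ _ _ _ _ _ _ _ h h' => ?_⟩
      have := H _ _ _ h.pos₂ h.pos₃ h.le₂₃ h'.F₃_mid
      rwa [sub_sub_cancel, mul_comm (_ ^ (_ : ℝ))] at this
    · obtain ⟨c, hc, hc1, H⟩ := exists_interpolation (C := 5) (by norm_num)
        (show (0 : ℝ) ≤ s + t - q by linarith) (s + t)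
      refine ⟨c, hc, hc1, fun _ _ _ _ _ _ _ _ _ h h' => ?_⟩
      have := H _ _ _ h.pos₂ h.pos₃ h.le₂₃ h'.F₃_far
      rwa [sub_sub_cancel, mul_comm (_ ^ (_ : ℝ))] at this
  have hpos : ∀ {x y p r : ℝ}, 0 < x → 0 < y → 0 ≤ x ^ p * y ^ r := fun hx hy => by positivity
  have outer : (∃ c : ℝ, 0 < c ∧ c ≤ 1 ∧ ∀ x₁ x₂ x₃ d₁ d₃ E₁ E₃ F₁ F₃ : ℝ,
      RadialConfig x₁ x₂ x₃ d₁ d₃ → SideBounds s t x₁ x₂ x₃ E₁ E₃ F₁ F₃ →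
      c * (x₁ ^ q * x₂ ^ (s - q)) ≤ E₁) →
      ∃ c : ℝ, 0 < c ∧ ∀ x₁ x₂ x₃ d₁ d₃ E₁ E₃ F₁ F₃ : ℝ, RadialConfig x₁ x₂ x₃ d₁ d₃ →
      SideBounds s t x₁ x₂ x₃ E₁ E₃ F₁ F₃ →
      c * ((x₁ * x₂ * x₃) ^ q * (d₁ + d₃)) ≤ d₃ * (E₁ * F₃) + d₁ * (E₃ * F₁) := by
    rintro ⟨cE, hcE, hcE1, HE⟩
    set c := min cE (min cA cB)
    have hc : 0 < c := lt_min hcE (lt_min hcA hcB)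
    refine ⟨c ^ 2 * (5 ^ |q|)⁻¹ / 8, by positivity, fun x₁ x₂ x₃ d₁ d₃ E₁ E₃ F₁ F₃ h h' => ?_⟩
    refine h.bound_of_outer hc hq3 ?_ ?_ ?_ ?_
    · exact (mul_le_mul_of_nonneg_right (min_le_left _ _) (hpos h.pos₁ h.pos₂)).trans
        (HE _ _ _ _ _ _ _ _ _ h h')
    · exact (mul_le_mul_of_nonneg_right ((min_le_right _ _).trans (min_le_right _ _))
        (hpos h.pos₃ h.pos₂)).trans (HB _ _ _ _ _ _ _ _ _ h h')
    · have := h'.E₃_near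
      rw [sub_add_cancel_left] at this
      refine (mul_le_of_le_one_left (hpos h.pos₂ h.pos₃) ((min_le_left _ _).trans hcE1)).trans this
    · exact (mul_le_mul_of_nonneg_right ((min_le_right _ _).trans (min_le_left _ _))
        (hpos h.pos₁ h.pos₂)).trans (HA _ _ _ _ _ _ _ _ _ h h')
  have inner : (∃ c : ℝ, 0 < c ∧ c ≤ 1 ∧ ∀ x₁ x₂ x₃ d₁ d₃ E₁ E₃ F₁ F₃ : ℝ,
      RadialConfig x₁ x₂ x₃ d₁ d₃ → SideBounds s t x₁ x₂ x₃ E₁ E₃ F₁ F₃ →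
      c * (x₃ ^ (q + 1) * x₂ ^ (s - q - 1)) ≤ E₃) →
      ∃ c : ℝ, 0 < c ∧ ∀ x₁ x₂ x₃ d₁ d₃ E₁ E₃ F₁ F₃ : ℝ, RadialConfig x₁ x₂ x₃ d₁ d₃ →
      SideBounds s t x₁ x₂ x₃ E₁ E₃ F₁ F₃ →
      c * ((x₁ * x₂ * x₃) ^ q * (d₁ + d₃)) ≤ d₃ * (E₁ * F₃) + d₁ * (E₃ * F₁) := by
    rintro ⟨cE, hcE, hcE1, HE⟩
    set c := min cE (min cA cB)
    have hc : 0 < c := lt_min hcE (lt_min hcA hcB)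
    refine ⟨c ^ 2 * (5 ^ |q|)⁻¹ / 20, by positivity, fun x₁ x₂ x₃ d₁ d₃ E₁ E₃ F₁ F₃ h h' => ?_⟩
    refine h.bound_of_inner hc hq3 ?_ ?_ ?_ ?_
    · exact (mul_le_mul_of_nonneg_right (min_le_left _ _) (hpos h.pos₃ h.pos₂)).trans
        (HE _ _ _ _ _ _ _ _ _ h h')
    · exact (mul_le_mul_of_nonneg_right ((min_le_right _ _).trans (min_le_left _ _))
        (hpos h.pos₁ h.pos₂)).trans (HA _ _ _ _ _ _ _ _ _ h h')
    · have := h'.E₁_near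
      rw [Real.rpow_zero, one_mul, sub_zero] at this
      exact (mul_le_of_le_one_left (Real.rpow_nonneg h.pos₂.le _)
        ((min_le_left _ _).trans hcE1)).trans this
    · exact (mul_le_mul_of_nonneg_right ((min_le_right _ _).trans (min_le_right _ _))
        (hpos h.pos₃ h.pos₂)).trans (HB _ _ _ _ _ _ _ _ _ h h')
  -- The only failures, (-2, -1) and (-1, -3), are excluded.
  have : 0 ≤ 2 * s + t ∨ 3 * s + 3 ≤ 2 * s + t ∨ 2 * s + t + 6 ≤ 0 ∨ 2 * s + t + 6 ≤ 3 * s + 3 := by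
    omega
  rcases this with h | h | h | h <;> have h := cast_le _ _ h <;> push_cast at h
  · apply outer
    obtain ⟨c, hc, hc1, H⟩ := exists_interpolation (C := 5) (by norm_num)
      (show (0 : ℝ) ≤ q by linarith) s
    exact ⟨c, hc, hc1, fun _ _ _ _ _ _ _ _ _ h h' => H _ _ _ h.pos₁ h.pos₂ h.le₁₂ h'.E₁_near⟩
  · apply outer
    obtain ⟨c, hc, hc1, H⟩ := exists_interpolation (C := 5) (by norm_num)
      (show (s + 1 : ℝ) ≤ q by linarith) s
    exact ⟨c, hc, hc1, fun _ _ _ _ _ _ _ _ _ h h' => H _ _ _ h.pos₁ h.pos₂ h.le₁₂ h'.E₁_far⟩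
  · apply inner
    obtain ⟨c, hc, hc1, H⟩ := exists_interpolation (C := 5) (by norm_num)
      (show (s + 1 : ℝ) ≤ s - q - 1 by linarith) s
    refine ⟨c, hc, hc1, fun _ _ _ _ _ _ _ _ _ h h' => ?_⟩
    have := H _ _ _ h.pos₂ h.pos₃ h.le₂₃ h'.E₃_near
    rwa [show (s : ℝ) - (s - q - 1) = q + 1 by ring, mul_comm (_ ^ (_ : ℝ))] at this
  · apply inner
    obtain ⟨c, hc, hc1, H⟩ := exists_interpolation (C := 5) (by norm_num)
      (show (0 : ℝ) ≤ s - q - 1 by linarith) s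
    refine ⟨c, hc, hc1, fun _ _ _ _ _ _ _ _ _ h h' => ?_⟩
    have := H _ _ _ h.pos₂ h.pos₃ h.le₂₃ h'.E₃_far
    rwa [show (s : ℝ) - (s - q - 1) = q + 1 by ring, mul_comm (_ ^ (_ : ℝ))] at this

/-- The real inequality behind the geometric inequality, for comparable radii. -/
lemma exists_radial_bound_of_comparable (s t : ℝ) {Λ : ℝ} (hΛ : 1 ≤ Λ) :
    ∃ c : ℝ, 0 < c ∧ ∀ x₁ x₂ x₃ d₁ d₃ E₁ E₃ F₁ F₃ : ℝ, RadialConfig x₁ x₂ x₃ d₁ d₃ →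
      x₃ ≤ Λ * x₁ →
      SideBounds s t x₁ x₂ x₃ E₁ E₃ F₁ F₃ →
      c * ((x₁ * x₂ * x₃) ^ ((2 * s + t : ℝ) / 3) * (d₁ + d₃)) ≤
        d₃ * (E₁ * F₃) + d₁ * (E₃ * F₁) := by
  set q : ℝ := (2 * s + t : ℝ) / 3 with hq
  have hq3 : 3 * q = 2 * s + t := by rw [hq]; ring
  set C : ℝ := 5 * Λ with hC
  have hC1 : 1 ≤ C := by linarith
  have hC0 : 0 < C := by linarith
  -- With all radii comparable up to C, replacing an exponent p by e costs C^|e - p|; the shifts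
  -- used below are 0, |q| and |s + t - q|.
  set c : ℝ := (C ^ (|q| + |s + t - q|))⁻¹ with hc
  have hc0 : 0 < c := by positivity
  have key : ∀ e p m x y F : ℝ, |e - p| ≤ |q| + |s + t - q| → 0 < x → 0 < y → x ≤ C * y →
      y ≤ C * x → x ^ p * y ^ (m - p) ≤ F → c * (x ^ e * y ^ (m - e)) ≤ F := by
    intro e p m x y F hep hx hy hxy hyx hF
    rw [hc, inv_mul_le_iff₀ (by positivity)]
    refine (rpow_mul_rpow_le_abs hx hy hC1 hxy hyx p e m).trans ?_
    gcongr
  refine ⟨c ^ 2 * (5 ^ |q|)⁻¹ / 8, by positivity, fun x₁ x₂ x₃ d₁ d₃ E₁ E₃ F₁ F₃ h hx h' => ?_⟩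
  have p1 := h.pos₁
  have p2 := h.pos₂
  have p3 := h.pos₃
  have h12 : x₁ ≤ C * x₂ := h.le₁₂.trans (by gcongr; linarith)
  have h23 : x₂ ≤ C * x₃ := h.le₂₃.trans (by gcongr; linarith)
  have h32 : x₃ ≤ C * x₂ := by
    calc x₃ ≤ Λ * x₁ := hx
      _ ≤ Λ * (5 * x₂) := by gcongr; exact h.le₁₂
      _ = C * x₂ := by rw [hC]; ring
  have h21 : x₂ ≤ C * x₁ := by
    calc x₂ ≤ 5 * x₃ := h.le₂₃
      _ ≤ 5 * (Λ * x₁) := by gcongr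
      _ = C * x₁ := by rw [hC]; ring
  refine h.bound_of_outer hc0 hq3 ?_ ?_ ?_ ?_
  · exact key q 0 s _ _ _ (by rw [sub_zero]; linarith [abs_nonneg (s + t - q)]) p1 p2 h12 h21
      h'.E₁_near
  · have := key (s + t - q) 0 (s + t) _ _ _ (by rw [sub_zero]; linarith [abs_nonneg q])
      p2 p3 h23 h32 h'.F₃_far
    rwa [sub_sub_cancel, mul_comm (_ ^ (_ : ℝ))] at this
  · have := key (s + 1) (s + 1) s _ _ _ (by rw [sub_self, abs_zero]; positivity)
      p2 p3 h23 h32 h'.E₃_near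
    rwa [sub_add_cancel_left] at this
  · exact key q 0 (s + t) _ _ _ (by rw [sub_zero]; linarith [abs_nonneg (s + t - q)]) p1 p2 h12 h21
      h'.F₁_near

end PowerInequalities

/-! ### Iterated integrals of functions with values in a narrow cone. -/

section Sides

lemma increment_ge {f f' : ℝ → ℝ} {p q m : ℝ} (hpq : p ≤ q)
    (hf : ∀ τ ∈ Set.Icc p q, HasDerivAt f (f' τ) τ) (hm : ∀ τ ∈ Set.Icc p q, m ≤ f' τ) :
    m * (q - p) ≤ f q - f p := by
  refine (convex_Icc p q).mul_sub_le_image_sub_of_le_deriv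
    (fun τ hτ => (hf τ hτ).continuousAt.continuousWithinAt)
    (fun τ hτ => (hf τ (interior_subset hτ)).differentiableAt.differentiableWithinAt)
    (fun τ hτ => ?_) p (Set.left_mem_Icc.mpr hpq) q (Set.right_mem_Icc.mpr hpq) hpq
  rw [(hf τ (interior_subset hτ)).deriv]
  exact hm τ (interior_subset hτ)

/-- The closed cone of opening `2 arctan κ` around the positive real axis. -/
def Cone (κ : ℝ) : Set ℂ := {w | |w.im| ≤ κ * w.re}

lemma Cone.abs_im_le {κ : ℝ} {w : ℂ} (h : w ∈ Cone κ) : |w.im| ≤ κ * w.re := h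

lemma Cone.re_nonneg {κ : ℝ} (hκ : 0 < κ) {w : ℂ} (h : w ∈ Cone κ) : 0 ≤ w.re :=
  nonneg_of_mul_nonneg_right ((abs_nonneg _).trans h) hκ

lemma Cone.mul {κ κ' : ℝ} (hκ : 0 < κ) (hκ' : 0 < κ') (hκκ : κ * κ' ≤ 1 / 4) {w w' : ℂ}
    (h : w ∈ Cone κ) (h' : w' ∈ Cone κ') :
    w * w' ∈ Cone (3 / 2 * (κ + κ')) ∧ 1 / 2 * (w.re * w'.re) ≤ (w * w').re := by
  have r := Cone.re_nonneg hκ h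
  have r' := Cone.re_nonneg hκ' h'
  have e1 : |w.im * w'.im| ≤ (κ * w.re) * (κ' * w'.re) := by
    rw [abs_mul]
    exact mul_le_mul h h' (abs_nonneg _) (by positivity)
  have e2 : (κ * w.re) * (κ' * w'.re) ≤ 1 / 4 * (w.re * w'.re) := by
    calc (κ * w.re) * (κ' * w'.re) = κ * κ' * (w.re * w'.re) := by ring
      _ ≤ _ := by gcongr
  have e3 := abs_le.mp e1
  have hre : 3 / 4 * (w.re * w'.re) ≤ (w * w').re := by
    rw [Complex.mul_re]
    linarith
  have hrr : 0 ≤ w.re * w'.re := by positivity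
  refine ⟨?_, by linarith⟩
  show |(w * w').im| ≤ _
  calc |(w * w').im| ≤ |w.re * w'.im| + |w.im * w'.re| := by
        rw [Complex.mul_im]; exact abs_add_le _ _
    _ = w.re * |w'.im| + |w.im| * w'.re := by
        rw [abs_mul, abs_mul, abs_of_nonneg r, abs_of_nonneg r']
    _ ≤ w.re * (κ' * w'.re) + κ * w.re * w'.re := by gcongr <;> assumption
    _ = (κ + κ') * (w.re * w'.re) := by ring
    _ ≤ 3 / 2 * (κ + κ') * (w * w').re := by nlinarith

lemma hasDerivAt_re {f : ℝ → ℂ} {f' : ℂ} {τ : ℝ} (h : HasDerivAt f f' τ) :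
    HasDerivAt (fun τ => (f τ).re) f'.re τ :=
  Complex.reCLM.hasFDerivAt.comp_hasDerivAt τ h

lemma hasDerivAt_im {f : ℝ → ℂ} {f' : ℂ} {τ : ℝ} (h : HasDerivAt f f' τ) :
    HasDerivAt (fun τ => (f τ).im) f'.im τ :=
  Complex.imCLM.hasFDerivAt.comp_hasDerivAt τ h

/-- The cone is an intersection of two half-planes, so the mean value inequality applies to the two
real functions κ·Re f ± Im f. -/
lemma increment_mem_cone {f f' : ℝ → ℂ} {p q κ : ℝ} (hpq : p ≤ q)
    (hf : ∀ τ ∈ Set.Icc p q, HasDerivAt f (f' τ) τ) (h : ∀ τ ∈ Set.Icc p q, f' τ ∈ Cone κ) :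
    f q - f p ∈ Cone κ := by
  have h1 := increment_ge (m := 0) (f := fun τ => κ * (f τ).re - (f τ).im) hpq
    (fun τ hτ => ((hasDerivAt_re (hf τ hτ)).const_mul κ).sub (hasDerivAt_im (hf τ hτ)))
    (fun τ hτ => by have := (abs_le.mp (Cone.abs_im_le (h τ hτ))).2; linarith)
  have h2 := increment_ge (m := 0) (f := fun τ => κ * (f τ).re + (f τ).im) hpq
    (fun τ hτ => ((hasDerivAt_re (hf τ hτ)).const_mul κ).add (hasDerivAt_im (hf τ hτ)))
    (fun τ hτ => by have := (abs_le.mp (Cone.abs_im_le (h τ hτ))).1; linarith)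
  show |(f q - f p).im| ≤ κ * (f q - f p).re
  rw [abs_le, Complex.sub_im, Complex.sub_re]
  constructor <;> linarith

/-- Iterated integrals along a side, given by primitives that vanish at the initial point. -/
structure SideData (κ : ℝ) (U V φ ψ χ : ℝ → ℂ) : Prop where
  hφ : ∀ τ ∈ Set.Icc (0 : ℝ) 1, HasDerivAt φ (U τ) τ
  hψ : ∀ τ ∈ Set.Icc (0 : ℝ) 1, HasDerivAt ψ (V τ) τ
  hχ : ∀ τ ∈ Set.Icc (0 : ℝ) 1, HasDerivAt χ (U τ * ψ τ) τ
  φ0 : φ 0 = 0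
  ψ0 : ψ 0 = 0
  χ0 : χ 0 = 0
  hU : ∀ τ ∈ Set.Icc (0 : ℝ) 1, U τ ∈ Cone κ
  hV : ∀ τ ∈ Set.Icc (0 : ℝ) 1, V τ ∈ Cone κ

namespace SideData

variable {κ : ℝ} {U V φ ψ χ : ℝ → ℂ}

lemma φ_mem (h : SideData κ U V φ ψ χ) : φ 1 ∈ Cone κ := by
  have := increment_mem_cone zero_le_one h.hφ h.hU
  rwa [h.φ0, sub_zero] at this

lemma ψ_mem (h : SideData κ U V φ ψ χ) {τ : ℝ} (hτ : τ ∈ Set.Icc (0 : ℝ) 1) : ψ τ ∈ Cone κ := by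
  have hsub : Set.Icc 0 τ ⊆ Set.Icc (0 : ℝ) 1 := Set.Icc_subset_Icc_right hτ.2
  have := increment_mem_cone hτ.1 (fun σ hσ => h.hψ σ (hsub hσ)) (fun σ hσ => h.hV σ (hsub hσ))
  rwa [h.ψ0, sub_zero] at this

lemma χ_mem (h : SideData κ U V φ ψ χ) (hκ : 0 < κ) (hκ2 : κ ≤ 1 / 2) : χ 1 ∈ Cone (3 * κ) := by
  have := increment_mem_cone (κ := 3 * κ) zero_le_one h.hχ fun τ hτ => by
    have := (Cone.mul hκ hκ (by nlinarith) (h.hU τ hτ) (h.ψ_mem hτ)).1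
    convert this using 2
    ring
  rwa [h.χ0, sub_zero] at this

lemma re_increment_ge {F F' : ℝ → ℂ} {p q m : ℝ} (hp : 0 ≤ p) (hpq : p ≤ q) (hq : q ≤ 1)
    (hκ : 0 < κ) (hF : ∀ τ ∈ Set.Icc (0 : ℝ) 1, HasDerivAt F (F' τ) τ)
    (hF' : ∀ τ ∈ Set.Icc (0 : ℝ) 1, F' τ ∈ Cone κ) (h0 : F 0 = 0)
    (hm : ∀ τ ∈ Set.Icc p q, m ≤ (F' τ).re) {r : ℝ} (hqr : q ≤ r) (hr : r ≤ 1) :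
    m * (q - p) ≤ (F r).re := by
  have h1 := increment_ge hpq (fun τ hτ => hasDerivAt_re (hF τ ⟨hp.trans hτ.1, hτ.2.trans hq⟩)) hm
  have h2 := increment_ge (m := 0) hqr (fun τ hτ => hasDerivAt_re
    (hF τ ⟨(hp.trans hpq).trans hτ.1, hτ.2.trans hr⟩)) (fun τ hτ => Cone.re_nonneg hκ
      (hF' τ ⟨(hp.trans hpq).trans hτ.1, hτ.2.trans hr⟩))
  have h3 := increment_ge (m := 0) hp (fun τ hτ => hasDerivAt_re
    (hF τ ⟨hτ.1, hτ.2.trans (hpq.trans hq)⟩)) (fun τ hτ => Cone.re_nonneg hκ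
      (hF' τ ⟨hτ.1, hτ.2.trans (hpq.trans hq)⟩))
  rw [h0, Complex.zero_re] at h3
  linarith

/-- The mass of V on the earlier interval makes ψ large from q onwards, and U then picks this up on
the later interval. The factor 1/2 is the loss in the real part of a product in the cone. -/
lemma χ_ge (h : SideData κ U V φ ψ χ) (hκ : 0 < κ) (hκ2 : κ ≤ 1 / 2) {p q p' q' m n : ℝ}
    (hp : 0 ≤ p) (hpq : p ≤ q) (hqp' : q ≤ p') (hpq' : p' ≤ q') (hq' : q' ≤ 1)
    (hm0 : 0 ≤ m)
    (hm : ∀ τ ∈ Set.Icc p q, m ≤ (V τ).re) (hn : ∀ τ ∈ Set.Icc p' q', n ≤ (U τ).re) :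
    1 / 2 * (n * m) * ((q - p) * (q' - p')) ≤ (χ 1).re := by
  have h1 : ∀ τ ∈ Set.Icc p' q', m * (q - p) ≤ (ψ τ).re := fun τ hτ =>
    re_increment_ge hp hpq (hqp'.trans (hpq'.trans hq')) hκ h.hψ h.hV h.ψ0 hm
      (hqp'.trans hτ.1) (hτ.2.trans hq')
  have hp'0 : 0 ≤ p' := hp.trans (hpq.trans hqp')
  have h2 := re_increment_ge (κ := 3 * κ) (m := 1 / 2 * (n * (m * (q - p)))) hp'0 hpq' hq' (by positivity)
    h.hχ (fun τ hτ => by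
      have := (Cone.mul hκ hκ (by nlinarith) (h.hU τ hτ) (h.ψ_mem hτ)).1
      convert this using 2
      ring) h.χ0 (fun τ hτ => by
      have hτ' : τ ∈ Set.Icc (0 : ℝ) 1 := ⟨hp'0.trans hτ.1, hτ.2.trans hq'⟩
      refine le_trans ?_ (Cone.mul hκ hκ (by nlinarith) (h.hU τ hτ') (h.ψ_mem hτ')).2
      have := hn τ hτ
      have := h1 τ hτ
      have : 0 ≤ m * (q - p) := mul_nonneg hm0 (by linarith)
      have := Cone.re_nonneg hκ (h.hU τ hτ')
      gcongr) hq' le_rfl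
  refine le_trans (le_of_eq ?_) h2
  ring

/-- Only the parts of the side near its endpoints are used. For φ there is one bound per endpoint;
for χ the earlier and the later interval are both near x, one at each end, or both near y. -/
lemma lower_bounds (h : SideData κ U V φ ψ χ) (hκ : 0 < κ) (hκ2 : κ ≤ 1 / 2)
    {x y M a β s t : ℝ} (hx : 0 < x) (hy : 0 < y) (hxM : x ≤ M) (hyM : y ≤ M)
    (ha : 0 ≤ a) (hβ : 0 ≤ β)
    (hUx : ∀ τ ∈ Set.Icc (0 : ℝ) 1, a * (x + τ * (y - x)) ^ s ≤ (U τ).re)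
    (hVx : ∀ τ ∈ Set.Icc (0 : ℝ) 1, β * (x + τ * (y - x)) ^ t ≤ (V τ).re) :
    ((2 : ℝ) ^ |s|)⁻¹ * a * x ^ s * (x / (2 * M)) ≤ (φ 1).re ∧
    ((2 : ℝ) ^ |s|)⁻¹ * a * y ^ s * (y / (2 * M)) ≤ (φ 1).re ∧
    ((2 : ℝ) ^ |s|)⁻¹ * ((2 : ℝ) ^ |t|)⁻¹ * (a * β) * (x ^ s * x ^ t) * (x ^ 2 / (32 * M ^ 2)) ≤ (χ 1).re ∧
    ((2 : ℝ) ^ |s|)⁻¹ * ((2 : ℝ) ^ |t|)⁻¹ * (a * β) * (y ^ s * x ^ t) * (x * y / (32 * M ^ 2)) ≤ (χ 1).re ∧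
    ((2 : ℝ) ^ |s|)⁻¹ * ((2 : ℝ) ^ |t|)⁻¹ * (a * β) * (y ^ s * y ^ t) * (y ^ 2 / (32 * M ^ 2)) ≤ (χ 1).re := by
  have hM : 0 < M := hx.trans_le hxM
  -- For times up to `l` the radius moves by at most x/2, so its power changes by at most 2^|s|; `r`
  -- plays the same role at the other end.
  set l := x / (2 * M) with hl
  set r := y / (2 * M) with hr
  have hl0 : 0 < l := by positivity
  have hr0 : 0 < r := by positivity
  have hl1 : l ≤ 1 / 2 := by rw [hl, div_le_div_iff₀ (by positivity) two_pos]; linarith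
  have hr1 : r ≤ 1 / 2 := by rw [hr, div_le_div_iff₀ (by positivity) two_pos]; linarith
  have hlM : l * M = x / 2 := by rw [hl]; field_simp
  have hrM : r * M = y / 2 := by rw [hr]; field_simp
  have pw : ∀ {X z p : ℝ}, 0 < z → z / 2 ≤ X → X ≤ 3 / 2 * z → ((2 : ℝ) ^ |p|)⁻¹ * z ^ p ≤ X ^ p := by
    intro X z p hz h1 h2
    rw [inv_mul_le_iff₀ (by positivity)]
    exact rpow_le_abs_mul hz (by linarith) one_le_two (by linarith) (by linarith) p
  have near : ∀ {p b : ℝ} {W : ℝ → ℂ}, 0 ≤ b →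
      (∀ τ ∈ Set.Icc (0 : ℝ) 1, b * (x + τ * (y - x)) ^ p ≤ (W τ).re) →
      ∀ τ ∈ Set.Icc 0 l, ((2 : ℝ) ^ |p|)⁻¹ * b * x ^ p ≤ (W τ).re := by
    intro p b W hb hW τ hτ
    refine le_trans ?_ (hW τ ⟨hτ.1, by linarith [hτ.2]⟩)
    have h1 : τ * M ≤ x / 2 := by rw [← hlM]; exact mul_le_mul_of_nonneg_right hτ.2 hM.le
    have h2 := pw (X := x + τ * (y - x)) (p := p) hx (by nlinarith [hτ.1]) (by nlinarith [hτ.1])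
    calc _ = b * (((2 : ℝ) ^ |p|)⁻¹ * x ^ p) := by ring
      _ ≤ _ := by gcongr
  have far : ∀ {p b : ℝ} {W : ℝ → ℂ}, 0 ≤ b →
      (∀ τ ∈ Set.Icc (0 : ℝ) 1, b * (x + τ * (y - x)) ^ p ≤ (W τ).re) →
      ∀ τ ∈ Set.Icc (1 - r) 1, ((2 : ℝ) ^ |p|)⁻¹ * b * y ^ p ≤ (W τ).re := by
    intro p b W hb hW τ hτ
    refine le_trans ?_ (hW τ ⟨by linarith [hτ.1], hτ.2⟩)
    have h1 : (1 - τ) * M ≤ y / 2 := by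
      rw [← hrM]; exact mul_le_mul_of_nonneg_right (by linarith [hτ.1]) hM.le
    have h3 : 0 ≤ 1 - τ := by linarith [hτ.2]
    have h2 := pw (X := x + τ * (y - x)) (p := p) hy (by nlinarith) (by nlinarith)
    calc _ = b * (((2 : ℝ) ^ |p|)⁻¹ * y ^ p) := by ring
      _ ≤ _ := by gcongr
  have nU := near ha hUx
  have fU := far ha hUx
  have nV := near hβ hVx
  have fV := far hβ hVx
  have nx : ∀ {p b : ℝ}, 0 ≤ b → 0 ≤ ((2 : ℝ) ^ |p|)⁻¹ * b * x ^ p := fun hb => by positivity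
  have ny : ∀ {p b : ℝ}, 0 ≤ b → 0 ≤ ((2 : ℝ) ^ |p|)⁻¹ * b * y ^ p := fun hb => by positivity
  refine ⟨?_, ?_, ?_, ?_, ?_⟩
  · have := re_increment_ge le_rfl hl0.le (by linarith) hκ h.hφ h.hU h.φ0 nU
      (r := 1) (by linarith) le_rfl
    rwa [sub_zero] at this
  · have := re_increment_ge (by linarith) (by linarith) le_rfl hκ h.hφ h.hU h.φ0 fU le_rfl le_rfl
    rwa [sub_sub_cancel] at this
  · have := h.χ_ge hκ hκ2 le_rfl (show 0 ≤ l / 2 by linarith) le_rfl (show l / 2 ≤ l by linarith)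
      (by linarith) (nx hβ) (fun τ hτ => nV τ ⟨hτ.1, by linarith [hτ.2]⟩)
      (fun τ hτ => nU τ ⟨by linarith [hτ.1], hτ.2⟩)
    refine le_trans (le_of_eq ?_) this
    rw [hl]
    field_simp
    ring
  · have := h.χ_ge hκ hκ2 le_rfl (show 0 ≤ l / 2 by linarith) (show l / 2 ≤ 1 - r / 2 by linarith)
      (show 1 - r / 2 ≤ 1 by linarith) le_rfl (nx hβ)
      (fun τ hτ => nV τ ⟨hτ.1, by linarith [hτ.2]⟩) (fun τ hτ => fU τ ⟨by linarith [hτ.1], hτ.2⟩)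
    refine le_trans (le_of_eq ?_) this
    rw [hl, hr]
    field_simp
    ring
  · have := h.χ_ge hκ hκ2 (show 0 ≤ 1 - r by linarith) (show 1 - r ≤ 1 - r / 2 by linarith) le_rfl
      (show 1 - r / 2 ≤ 1 by linarith) le_rfl (ny hβ)
      (fun τ hτ => fV τ ⟨hτ.1, by linarith [hτ.2]⟩) (fun τ hτ => fU τ ⟨by linarith [hτ.1], hτ.2⟩)
    refine le_trans (le_of_eq ?_) this
    rw [hr]
    field_simp
    ring

end SideData

end Sides

/-! ### Absence of cancellation at a wide angle. -/

section Triangles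

/-- No cancellation occurs at a vertex with an angle of at least sixty degrees. -/
lemma norm_sub_ge_of_angle {a₁ a₃ p p' : ℂ} {κ : ℝ} (hκ : 0 < κ) (hκ2 : κ ≤ 1 / 20)
    (h1 : ‖a₁‖ ≤ ‖a₃ - a₁‖) (h3 : ‖a₃‖ ≤ ‖a₃ - a₁‖) (hp : p ∈ Cone κ) (hp' : p' ∈ Cone κ) :
    1 / 4 * (‖a₃‖ * p.re + ‖a₁‖ * p'.re) ≤ ‖a₃ * p - a₁ * p'‖ := by
  have r := Cone.re_nonneg hκ hp
  have r' := Cone.re_nonneg hκ hp'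
  set ζ : ℂ := a₃ * (starRingEnd ℂ) a₁ with hζ
  set w : ℂ := p * (starRingEnd ℂ) p' with hw
  have n1 : ‖a₃ - a₁‖ ^ 2 = ‖a₃‖ ^ 2 + ‖a₁‖ ^ 2 - 2 * ζ.re := by
    rw [← Complex.normSq_eq_norm_sq, ← Complex.normSq_eq_norm_sq, ← Complex.normSq_eq_norm_sq,
      Complex.normSq_sub]
  have n2 : ‖a₃ * p - a₁ * p'‖ ^ 2 = ‖a₃‖ ^ 2 * ‖p‖ ^ 2 + ‖a₁‖ ^ 2 * ‖p'‖ ^ 2 - 2 * (ζ * w).re := by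
    rw [← Complex.normSq_eq_norm_sq, Complex.normSq_sub, Complex.normSq_eq_norm_sq,
      Complex.normSq_eq_norm_sq, norm_mul, norm_mul, hζ, hw, map_mul]
    ring_nf
  have d1 := norm_nonneg a₁
  have d3 := norm_nonneg a₃
  -- The side opposite the vertex is the longest, so the cosine of the angle is at most 1/2.
  -- Multiplying by the nearly positive w raises this bound to at most 3/4.
  have hζre : ζ.re ≤ 1 / 2 * (‖a₃‖ * ‖a₁‖) := by
    rcases le_total ‖a₁‖ ‖a₃‖ with h | h
    · have : ‖a₃‖ ^ 2 ≤ ‖a₃ - a₁‖ ^ 2 := by gcongr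
      nlinarith
    · have : ‖a₁‖ ^ 2 ≤ ‖a₃ - a₁‖ ^ 2 := by gcongr
      nlinarith
  have hζn : ‖ζ‖ = ‖a₃‖ * ‖a₁‖ := by rw [hζ, norm_mul, Complex.norm_conj]
  have hwn : ‖w‖ = ‖p‖ * ‖p'‖ := by rw [hw, norm_mul, Complex.norm_conj]
  have hpc : (starRingEnd ℂ) p' ∈ Cone κ := by
    show |((starRingEnd ℂ) p').im| ≤ κ * ((starRingEnd ℂ) p').re
    rw [Complex.conj_im, Complex.conj_re, abs_neg]
    exact hp'
  have hwc := (Cone.mul hκ hκ (by nlinarith) hp hpc).1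
  rw [show 3 / 2 * (κ + κ) = 3 * κ by ring] at hwc
  have hwre := Cone.re_nonneg (by positivity) hwc
  have hwre' : w.re ≤ ‖p‖ * ‖p'‖ := hwn ▸ Complex.re_le_norm w
  have hζw : (ζ * w).re ≤ 3 / 4 * (‖a₃‖ * ‖a₁‖) * (‖p‖ * ‖p'‖) := by
    have e1 : ζ.re * w.re ≤ 1 / 2 * (‖a₃‖ * ‖a₁‖) * w.re := mul_le_mul_of_nonneg_right hζre hwre
    have e2 : |ζ.im * w.im| ≤ (‖a₃‖ * ‖a₁‖) * (3 * κ * w.re) := by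
      rw [abs_mul]
      exact mul_le_mul (hζn ▸ Complex.abs_im_le_norm ζ) hwc (abs_nonneg _) (by positivity)
    have e3 : (‖a₃‖ * ‖a₁‖) * (3 * κ * w.re) ≤ (‖a₃‖ * ‖a₁‖) * (1 / 4 * w.re) := by
      gcongr
      linarith
    have e4 : 3 / 4 * (‖a₃‖ * ‖a₁‖) * w.re ≤ 3 / 4 * (‖a₃‖ * ‖a₁‖) * (‖p‖ * ‖p'‖) := by gcongr
    rw [Complex.mul_re]
    have := (abs_le.mp e2).1
    linarith
  have hpr : p.re ≤ ‖p‖ := Complex.re_le_norm p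
  have hpr' : p'.re ≤ ‖p'‖ := Complex.re_le_norm p'
  refine le_trans (b := 1 / 4 * (‖a₃‖ * ‖p‖ + ‖a₁‖ * ‖p'‖)) (by gcongr) ?_
  -- With X = ‖a₃‖‖p‖ and Y = ‖a₁‖‖p'‖ it remains that X² + Y² - (3/2)XY ≥ (X + Y)²/16.
  refine le_of_sq_le_sq ?_ (norm_nonneg _)
  rw [n2]
  nlinarith [sq_nonneg (‖a₃‖ * ‖p‖ - ‖a₁‖ * ‖p'‖), sq_nonneg (‖a₃‖ * ‖p‖ + ‖a₁‖ * ‖p'‖)]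

end Triangles

/-! ### Geometry of three points in a narrow sector. -/

section SectorGeometry

lemma polar_mem_cone {r ψ : ℝ} (hr : 0 ≤ r) (hψ : |ψ| ≤ 1 / 500) :
    (r : ℂ) * Complex.exp (ψ * Complex.I) ∈ Cone (1 / 200) ∧
      99 / 100 * r ≤ ((r : ℂ) * Complex.exp (ψ * Complex.I)).re := by
  have hre : ((r : ℂ) * Complex.exp (ψ * Complex.I)).re = r * Real.cos ψ := by
    rw [Complex.re_ofReal_mul, Complex.exp_ofReal_mul_I_re]
  have h1 := Real.one_sub_sq_div_two_le_cos (x := ψ)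
  have h2 : ψ ^ 2 ≤ (1 / 500) ^ 2 := by
    rw [← sq_abs]
    gcongr
  have h3 : 99 / 100 ≤ Real.cos ψ := by linarith
  have h4 : |Real.sin ψ| ≤ 1 / 500 := Real.abs_sin_le_abs.trans hψ
  refine ⟨?_, ?_⟩
  · show |((r : ℂ) * Complex.exp (ψ * Complex.I)).im| ≤ _
    rw [im_ofReal_mul_exp, hre, abs_mul, abs_of_nonneg hr]
    nlinarith
  · rw [hre]
    nlinarith

/-- A point whose direction is within a small angle of the positive real axis. -/
def Narrow (w : ℂ) : Prop := w ∈ Cone (1 / 200) ∧ 99 / 100 * ‖w‖ ≤ w.re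

lemma narrow_polar {r ψ : ℝ} (hr : 0 ≤ r) (hψ : |ψ| ≤ 1 / 500) :
    Narrow ((r : ℂ) * Complex.exp (ψ * Complex.I)) := by
  refine ⟨(polar_mem_cone hr hψ).1, ?_⟩
  rw [norm_mul, Complex.norm_exp_ofReal_mul_I, mul_one, Complex.norm_real, Real.norm_eq_abs,
    abs_of_nonneg hr]
  exact (polar_mem_cone hr hψ).2

lemma InSector.exists_polar {F : ℂ → ℂ} {B : Set ℂ} (h : InSector (1 / 1000) (F '' B)) :
    ∃ θ : ℝ, ∀ z ∈ B, ∃ r ψ : ℝ, 0 ≤ r ∧ 0 ≤ ψ ∧ ψ ≤ 1 / 1000 ∧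
      F z = Complex.exp (θ * Complex.I) * (r * Complex.exp (ψ * Complex.I)) := by
  obtain ⟨θ, h⟩ := h
  refine ⟨θ, fun z hz => ?_⟩
  obtain ⟨r, φ, h1, h2, h3, h4⟩ := h _ ⟨z, hz, rfl⟩
  refine ⟨r, φ - θ, h1, by linarith, by linarith, ?_⟩
  rw [h4, mul_left_comm, ← Complex.exp_add]
  congr 2
  push_cast
  ring

lemma exp_mul_I_inv (θ : ℝ) : (Complex.exp (θ * Complex.I))⁻¹ = Complex.exp ((-θ : ℝ) * Complex.I) := by
  rw [← Complex.exp_neg]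
  congr 1
  push_cast
  ring

/-- The arguments of L₂/L₁² and L₁L₃/L₂² combine those of the Lᵢ with coefficients 1 and -2, so an
aperture of 1/1000 leaves a deviation of at most 1/500, which `narrow_polar` allows. -/
lemma IsPiece.exists_rotations {Γ : Curve} {K : ℝ} {B : Set ℂ} {b : ℂ} {k : Fin 3 → ℕ}
    (h : IsPiece Γ (1 / 1000) K B b k) :
    ∃ ω ωu ωv : ℂ, ‖ω‖ = 1 ∧ ‖ωu‖ = 1 ∧ ‖ωv‖ = 1 ∧ ∀ z ∈ B,
      Narrow (ω * (z - b)) ∧ Narrow (ωu * slope Γ z) ∧ Narrow (ωv * torsion Γ z) := by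
  obtain ⟨θ, hθ⟩ := h.sector.exists_polar
  obtain ⟨θ₀, h₀⟩ := (h.sector_L 0).exists_polar
  obtain ⟨θ₁, h₁⟩ := (h.sector_L 1).exists_polar
  obtain ⟨θ₂, h₂⟩ := (h.sector_L 2).exists_polar
  refine ⟨Complex.exp ((-θ : ℝ) * Complex.I), Complex.exp ((-(θ₁ - 2 * θ₀) : ℝ) * Complex.I),
    Complex.exp ((-(θ₀ + θ₂ - 2 * θ₁) : ℝ) * Complex.I), Complex.norm_exp_ofReal_mul_I _,
    Complex.norm_exp_ofReal_mul_I _, Complex.norm_exp_ofReal_mul_I _, fun z hz => ?_⟩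
  obtain ⟨r, ψ, hr, p1, p2, e⟩ := hθ z hz
  obtain ⟨r₀, ψ₀, hr₀, p1₀, p2₀, e₀⟩ := h₀ z hz
  obtain ⟨r₁, ψ₁, hr₁, p1₁, p2₁, e₁⟩ := h₁ z hz
  obtain ⟨r₂, ψ₂, hr₂, p1₂, p2₂, e₂⟩ := h₂ z hz
  change z - b = _ at e
  change (L₁ Γ).eval z = _ at e₀
  change (L₂ Γ).eval z = _ at e₁
  change (L₃ Γ).eval z = _ at e₂
  refine ⟨?_, ?_, ?_⟩
  · have : Complex.exp ((-θ : ℝ) * Complex.I) * (z - b) = r * Complex.exp (ψ * Complex.I) := by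
      rw [e, ← exp_mul_I_inv, inv_mul_cancel_left₀ (Complex.exp_ne_zero _)]
    rw [this]
    exact narrow_polar hr (abs_le.mpr ⟨by linarith, by linarith⟩)
  · have : Complex.exp ((-(θ₁ - 2 * θ₀) : ℝ) * Complex.I) * slope Γ z =
        ((r₁ / r₀ ^ 2 : ℝ) : ℂ) * Complex.exp ((ψ₁ - 2 * ψ₀ : ℝ) * Complex.I) := by
      rw [slope, e₀, e₁]
      have x1 : Complex.exp ((-(θ₁ - 2 * θ₀) : ℝ) * Complex.I) =
          Complex.exp (θ₀ * Complex.I) ^ 2 * (Complex.exp (θ₁ * Complex.I))⁻¹ := by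
        rw [← Complex.exp_neg, ← Complex.exp_nat_mul, ← Complex.exp_add]
        congr 1
        push_cast
        ring
      have x2 : Complex.exp ((ψ₁ - 2 * ψ₀ : ℝ) * Complex.I) =
          Complex.exp (ψ₁ * Complex.I) * (Complex.exp (ψ₀ * Complex.I) ^ 2)⁻¹ := by
        rw [← Complex.exp_nat_mul, ← Complex.exp_neg, ← Complex.exp_add]
        congr 1
        push_cast
        ring
      rw [x1, x2]
      push_cast
      field_simp [Complex.exp_ne_zero]
    rw [this]
    exact narrow_polar (by positivity) (abs_le.mpr ⟨by linarith, by linarith⟩)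
  · have : Complex.exp ((-(θ₀ + θ₂ - 2 * θ₁) : ℝ) * Complex.I) * torsion Γ z =
        ((r₀ * r₂ / r₁ ^ 2 : ℝ) : ℂ) * Complex.exp ((ψ₀ + ψ₂ - 2 * ψ₁ : ℝ) * Complex.I) := by
      rw [torsion, e₀, e₁, e₂]
      have x1 : Complex.exp ((-(θ₀ + θ₂ - 2 * θ₁) : ℝ) * Complex.I) =
          Complex.exp (θ₁ * Complex.I) ^ 2 *
            ((Complex.exp (θ₀ * Complex.I))⁻¹ * (Complex.exp (θ₂ * Complex.I))⁻¹) := by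
        rw [← Complex.exp_neg, ← Complex.exp_neg, ← Complex.exp_nat_mul, ← Complex.exp_add,
          ← Complex.exp_add]
        congr 1
        push_cast
        ring
      have x2 : Complex.exp ((ψ₀ + ψ₂ - 2 * ψ₁ : ℝ) * Complex.I) =
          Complex.exp (ψ₀ * Complex.I) * Complex.exp (ψ₂ * Complex.I) *
            (Complex.exp (ψ₁ * Complex.I) ^ 2)⁻¹ := by
        rw [← Complex.exp_nat_mul, ← Complex.exp_neg, ← Complex.exp_add, ← Complex.exp_add]
        congr 1
        push_cast
        ring
      rw [x1, x2]
      push_cast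
      field_simp [Complex.exp_ne_zero]
    rw [this]
    exact narrow_polar (by positivity) (abs_le.mpr ⟨by linarith, by linarith⟩)

lemma Narrow.norm_le {w : ℂ} (h : Narrow w) : ‖w‖ ≤ 101 / 99 * w.re := by
  have := h.2
  have := norm_nonneg w
  linarith

/-- The vertex opposite to the longest side lies radially between the other two vertices. -/
lemma radialConfig_of_narrow {w₁ w₂ w₃ : ℂ} (h₁ : Narrow w₁) (h₂ : Narrow w₂) (h₃ : Narrow w₃)
    (p₁ : w₁ ≠ 0) (p₂ : w₂ ≠ 0) (p₃ : w₃ ≠ 0) (hr : ‖w₁‖ ≤ ‖w₃‖)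
    (hs : ‖w₃ - w₂‖ ≤ ‖w₃ - w₁‖) (hs' : ‖w₁ - w₂‖ ≤ ‖w₃ - w₁‖) :
    RadialConfig w₁.re w₂.re w₃.re ‖w₁ - w₂‖ ‖w₃ - w₂‖ := by
  have n₁ := h₁.norm_le
  have n₂ := h₂.norm_le
  have n₃ := h₃.norm_le
  have q₁ := norm_pos_iff.mpr p₁
  have q₂ := norm_pos_iff.mpr p₂
  have q₃ := norm_pos_iff.mpr p₃
  have r₁ := Complex.re_le_norm w₁
  have r₂ := Complex.re_le_norm w₂
  have r₃ := Complex.re_le_norm w₃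
  have hcos : 9 / 10 * (‖w₃‖ * ‖w₁‖) ≤ (w₃ * (starRingEnd ℂ) w₁).re := by
    rw [Complex.mul_re, Complex.conj_re, Complex.conj_im]
    have e1 : |w₃.im * w₁.im| ≤ (1 / 200 * w₃.re) * (1 / 200 * w₁.re) := by
      rw [abs_mul]
      exact mul_le_mul h₃.1 h₁.1 (abs_nonneg _) (by linarith)
    have e2 := (abs_le.mp e1).1
    have e3 : (99 / 100 * ‖w₃‖) * (99 / 100 * ‖w₁‖) ≤ w₃.re * w₁.re :=
      mul_le_mul h₃.2 h₁.2 (by positivity) (by linarith)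
    have e4 : 0 < ‖w₃‖ * ‖w₁‖ := by positivity
    linarith
  have hn : ‖w₃ - w₁‖ ^ 2 = ‖w₃‖ ^ 2 + ‖w₁‖ ^ 2 - 2 * (w₃ * (starRingEnd ℂ) w₁).re := by
    rw [← Complex.normSq_eq_norm_sq, ← Complex.normSq_eq_norm_sq, ← Complex.normSq_eq_norm_sq,
      Complex.normSq_sub]
  have hlong : ‖w₃ - w₁‖ ^ 2 ≤ ‖w₃‖ ^ 2 - 8 / 10 * (‖w₃‖ * ‖w₁‖) := by nlinarith
  have hlong' : ‖w₃ - w₁‖ ≤ ‖w₃‖ := by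
    refine le_of_sq_le_sq ?_ q₃.le
    have : 0 < ‖w₃‖ * ‖w₁‖ := by positivity
    linarith
  -- If w₂ were much closer to the origin than w₁, the side from w₂ to w₃ would be longer than the
  -- one from w₁ to w₃.
  have hr21 : 4 / 10 * ‖w₁‖ ≤ ‖w₂‖ := by
    by_contra hcon
    push Not at hcon
    have e1 : ‖w₃‖ - ‖w₂‖ ≤ ‖w₃ - w₁‖ := (norm_sub_norm_le w₃ w₂).trans hs
    have e2 : 0 ≤ ‖w₃‖ - ‖w₂‖ := by linarith
    have e3 : (‖w₃‖ - ‖w₂‖) ^ 2 ≤ ‖w₃ - w₁‖ ^ 2 := by gcongr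
    nlinarith
  have hr23 : ‖w₂‖ ≤ 2 * ‖w₃‖ := by
    have e1 : ‖w₂‖ ≤ ‖w₁‖ + ‖w₁ - w₂‖ := by
      have := norm_sub_norm_le w₂ w₁
      rw [norm_sub_rev] at this
      linarith
    linarith
  have t₁ := norm_sub_le w₁ w₂
  have t₃ := norm_sub_le w₃ w₂
  exact
    { pos₁ := by linarith [h₁.2]
      pos₂ := by linarith [h₂.2]
      pos₃ := by linarith [h₃.2]
      le₁₂ := by linarith
      le₂₃ := by linarith
      nonneg₁ := norm_nonneg _
      nonneg₃ := norm_nonneg _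
      d₁_le := by linarith
      d₃_le := by linarith
      le_d₁ := by
        rw [norm_sub_rev, ← Complex.sub_re]
        exact Complex.re_le_norm _
      le_d₃ := by
        rw [← Complex.sub_re]
        exact Complex.re_le_norm _ }

end SectorGeometry

/-! ### Lower bounds along one side of the triangle. -/

section OneSide

lemma hasDerivAt_segment {F : ℂ → ℂ} {F' : ℂ} {z a : ℂ} {τ : ℝ} (h : HasDerivAt F F' (z + τ * a)) :
    HasDerivAt (fun τ : ℝ => F (z + τ * a)) (F' * a) τ := by
  have h1 : HasDerivAt (fun τ : ℝ => z + (τ : ℂ) * a) a τ := by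
    have := ((Complex.ofRealCLM.hasDerivAt (x := τ)).mul_const a).const_add z
    simpa using this
  exact h.comp τ h1

/-- The increments of the affine coordinates along a side, normalized. -/
def sideFst (Γ : Curve) (ωu z a : ℂ) : ℂ :=
  ωu / a * (affineCoord Γ 1 (z + a) - affineCoord Γ 1 z)

/-- The increments of the affine coordinates along a side, normalized, second order. -/
def sideSnd (Γ : Curve) (ωu ωv z a : ℂ) : ℂ :=
  ωu * ωv / a ^ 2 * (affineCoord Γ 2 (z + a) - affineCoord Γ 2 z -
    curvature Γ z * (affineCoord Γ 1 (z + a) - affineCoord Γ 1 z))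

/-- This is `SideData.lower_bounds` for the segment from z to z + a, with u and v rotated to the
positive axis. The constants 10 and 800 are 2M/w and 32M²/w² for M = 5w. -/
lemma side_bounds {Γ : Curve} {ωu ωv z a : ℂ} {x y w s t α β : ℝ} (ha : a ≠ 0)
    (hL₁ : ∀ τ ∈ Set.Icc (0 : ℝ) 1, (L₁ Γ).eval (z + τ * a) ≠ 0)
    (hL₂ : ∀ τ ∈ Set.Icc (0 : ℝ) 1, (L₂ Γ).eval (z + τ * a) ≠ 0)
    (hu : ∀ τ ∈ Set.Icc (0 : ℝ) 1, ωu * slope Γ (z + τ * a) ∈ Cone (1 / 200))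
    (hv : ∀ τ ∈ Set.Icc (0 : ℝ) 1, ωv * torsion Γ (z + τ * a) ∈ Cone (1 / 200))
    (hx : 0 < x) (hy : 0 < y) (hw : 0 < w) (hxw : x ≤ 5 * w) (hyw : y ≤ 5 * w) (hα : 0 < α) (hβ : 0 < β)
    (hu' : ∀ τ ∈ Set.Icc (0 : ℝ) 1, α * (x + τ * (y - x)) ^ s ≤ (ωu * slope Γ (z + τ * a)).re)
    (hv' : ∀ τ ∈ Set.Icc (0 : ℝ) 1, β * (x + τ * (y - x)) ^ t ≤ (ωv * torsion Γ (z + τ * a)).re) :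
    sideFst Γ ωu z a ∈ Cone (1 / 200) ∧ sideSnd Γ ωu ωv z a ∈ Cone (3 / 200) ∧
    x ^ (s + 1) * w ^ (-1 : ℝ) ≤ (sideFst Γ ωu z a).re / (((2 : ℝ) ^ |s|)⁻¹ * α / 10) ∧
    y ^ (s + 1) * w ^ (-1 : ℝ) ≤ (sideFst Γ ωu z a).re / (((2 : ℝ) ^ |s|)⁻¹ * α / 10) ∧
    x ^ (s + t + 2) * w ^ (-2 : ℝ) ≤
      (sideSnd Γ ωu ωv z a).re / (((2 : ℝ) ^ |s|)⁻¹ * ((2 : ℝ) ^ |t|)⁻¹ * (α * β) / 800) ∧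
    x ^ (t + 1) * y ^ (s + 1) * w ^ (-2 : ℝ) ≤
      (sideSnd Γ ωu ωv z a).re / (((2 : ℝ) ^ |s|)⁻¹ * ((2 : ℝ) ^ |t|)⁻¹ * (α * β) / 800) ∧
    y ^ (s + t + 2) * w ^ (-2 : ℝ) ≤
      (sideSnd Γ ωu ωv z a).re / (((2 : ℝ) ^ |s|)⁻¹ * ((2 : ℝ) ^ |t|)⁻¹ * (α * β) / 800) := by
  have hD : SideData (1 / 200) (fun τ : ℝ => ωu * slope Γ (z + τ * a))
      (fun τ : ℝ => ωv * torsion Γ (z + τ * a))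
      (fun τ : ℝ => ωu / a * (affineCoord Γ 1 (z + τ * a) - affineCoord Γ 1 z))
      (fun τ : ℝ => ωv / a * (curvature Γ (z + τ * a) - curvature Γ z))
      (fun τ : ℝ => ωu * ωv / a ^ 2 * (affineCoord Γ 2 (z + τ * a) - affineCoord Γ 2 z -
        curvature Γ z * (affineCoord Γ 1 (z + τ * a) - affineCoord Γ 1 z))) :=
    { hφ := fun τ hτ => by
        refine ((hasDerivAt_segment (hasDerivAt_affineCoord_one (hL₁ τ hτ))).sub_const _
          |>.const_mul (ωu / a)).congr_deriv ?_
        field_simp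
      hψ := fun τ hτ => by
        refine ((hasDerivAt_segment (hasDerivAt_curvature (hL₂ τ hτ))).sub_const _
          |>.const_mul (ωv / a)).congr_deriv ?_
        field_simp
      hχ := fun τ hτ => by
        refine (((hasDerivAt_segment (hasDerivAt_affineCoord_two (hL₁ τ hτ) (hL₂ τ hτ))).sub_const
          _).sub (((hasDerivAt_segment (hasDerivAt_affineCoord_one (hL₁ τ hτ))).sub_const _).const_mul
          _) |>.const_mul (ωu * ωv / a ^ 2)).congr_deriv ?_
        field_simp
      φ0 := by simp
      ψ0 := by simp
      χ0 := by simp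
      hU := hu
      hV := hv }
  have e1 : sideFst Γ ωu z a =
      ωu / a * (affineCoord Γ 1 (z + (1 : ℝ) * a) - affineCoord Γ 1 z) := by
    simp [sideFst]
  have e2 : sideSnd Γ ωu ωv z a =
      ωu * ωv / a ^ 2 * (affineCoord Γ 2 (z + (1 : ℝ) * a) - affineCoord Γ 2 z -
        curvature Γ z * (affineCoord Γ 1 (z + (1 : ℝ) * a) - affineCoord Γ 1 z)) := by
    simp [sideSnd]
  obtain ⟨b1, b2, b3, b4, b5⟩ := hD.lower_bounds (by norm_num) (by norm_num) hx hy hxw hyw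
    hα.le hβ.le hu' hv'
  rw [← e1] at b1 b2
  rw [← e2] at b3 b4 b5
  have m1 : sideFst Γ ωu z a ∈ Cone (1 / 200) := by
    rw [e1]
    exact hD.φ_mem
  have m2 : sideSnd Γ ωu ωv z a ∈ Cone (3 / 200) := by
    rw [e2, show (3 : ℝ) / 200 = 3 * (1 / 200) by norm_num]
    exact hD.χ_mem (by norm_num) (by norm_num)
  have w1 : w ^ (-1 : ℝ) = w⁻¹ := Real.rpow_neg_one w
  have w2 : w ^ (-2 : ℝ) = (w ^ 2)⁻¹ := by
    rw [Real.rpow_neg hw.le]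
    norm_num
  have e3 : ∀ {v : ℝ}, 0 < v → v ^ (s + t + 2) = v ^ s * v ^ t * v ^ 2 := fun hv => by
    rw [Real.rpow_add hv, Real.rpow_add hv]
    norm_num
  refine ⟨m1, m2, ?_, ?_, ?_, ?_, ?_⟩
  · rw [le_div_iff₀ (by positivity), w1, Real.rpow_add_one hx.ne']
    refine le_trans (le_of_eq ?_) b1
    field_simp
    norm_num
  · rw [le_div_iff₀ (by positivity), w1, Real.rpow_add_one hy.ne']
    refine le_trans (le_of_eq ?_) b2
    field_simp
    norm_num
  · rw [le_div_iff₀ (by positivity), w2, e3 hx]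
    refine le_trans (le_of_eq ?_) b3
    field_simp
    norm_num
  · rw [le_div_iff₀ (by positivity), w2, Real.rpow_add_one hx.ne', Real.rpow_add_one hy.ne']
    refine le_trans (le_of_eq ?_) b4
    field_simp
    norm_num
  · rw [le_div_iff₀ (by positivity), w2, e3 hy]
    refine le_trans (le_of_eq ?_) b5
    field_simp
    norm_num

end OneSide

/-! ### The Jacobian in terms of the two sides at a vertex. -/

section Factorization

/-- Subtracting `curvature Γ z₂` times the second column from the third changes no determinant, yet
turns the increments of g into the iterated integrals. The powers of the sides come from the
normalization in `sideFst` and `sideSnd`. -/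
lemma jacobian_eq_sides {Γ : Curve} {ωu ωv z₁ z₂ z₃ : ℂ} (hu : ωu ≠ 0) (hv : ωv ≠ 0)
    (h₁ : (L₁ Γ).eval z₁ ≠ 0) (h₂ : (L₁ Γ).eval z₂ ≠ 0) (h₃ : (L₁ Γ).eval z₃ ≠ 0)
    (h₁₂ : z₁ - z₂ ≠ 0) (h₃₂ : z₃ - z₂ ≠ 0) :
    ωu ^ 2 * ωv * jacobian Γ ![z₁, z₂, z₃] = -((L₁ Γ).eval z₁ * (L₁ Γ).eval z₂ * (L₁ Γ).eval z₃ *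
      ((z₁ - z₂) * (z₃ - z₂)) *
      ((z₃ - z₂) * (sideFst Γ ωu z₂ (z₁ - z₂) * sideSnd Γ ωu ωv z₂ (z₃ - z₂)) -
       (z₁ - z₂) * (sideFst Γ ωu z₂ (z₃ - z₂) * sideSnd Γ ωu ωv z₂ (z₁ - z₂)))) := by
  rw [jacobian_formula, sideFst, sideFst, sideSnd, sideSnd, add_sub_cancel, add_sub_cancel]
  simp only [affineCoord]
  have e : ∀ z, (derivative (Γ 0)).eval z = (L₁ Γ).eval z := fun z => rfl
  simp only [e]
  field_simp
  ring

end Factorization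

/-! ### Pointwise lower bounds for slope and torsion on a piece. -/

section PointwiseBounds

lemma slope_ge {K A₀ A₁ r l₀ l₁ s : ℝ} {k₀ k₁ : ℕ} (hK : 1 ≤ K) (hA₀ : 0 < A₀) (hA₁ : 0 < A₁)
    (hr : 0 < r) (hl₀ : 0 < l₀) (h₀ : l₀ ≤ K * (A₀ * r ^ k₀)) (h₁ : K⁻¹ * (A₁ * r ^ k₁) ≤ l₁)
    (hs : s = k₁ - 2 * k₀) : (K ^ 3)⁻¹ * (A₁ / A₀ ^ 2) * r ^ s ≤ l₁ / l₀ ^ 2 := by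
  have hK0 : 0 < K := by linarith
  have e : r ^ s = r ^ k₁ / (r ^ k₀) ^ 2 := by
    rw [hs, Real.rpow_sub hr, Real.rpow_natCast, ← pow_mul']
    congr 1
    rw [← Real.rpow_natCast]
    push_cast
    rfl
  calc (K ^ 3)⁻¹ * (A₁ / A₀ ^ 2) * r ^ s = K⁻¹ * (A₁ * r ^ k₁) / (K * (A₀ * r ^ k₀)) ^ 2 := by
        rw [e]; field_simp
    _ ≤ l₁ / l₀ ^ 2 := by
        have : 0 < l₁ := lt_of_lt_of_le (by positivity) h₁
        gcongr

lemma torsion_ge {K A₀ A₁ A₂ r l₀ l₁ l₂ t : ℝ} {k₀ k₁ k₂ : ℕ} (hK : 1 ≤ K) (hA₀ : 0 < A₀)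
    (hA₁ : 0 < A₁) (hA₂ : 0 < A₂) (hr : 0 < r) (hl₁ : 0 < l₁)
    (h₀ : K⁻¹ * (A₀ * r ^ k₀) ≤ l₀) (h₁ : l₁ ≤ K * (A₁ * r ^ k₁)) (h₂ : K⁻¹ * (A₂ * r ^ k₂) ≤ l₂)
    (ht : t = k₂ + k₀ - 2 * k₁) : (K ^ 4)⁻¹ * (A₀ * A₂ / A₁ ^ 2) * r ^ t ≤ l₀ * l₂ / l₁ ^ 2 := by
  have hK0 : 0 < K := by linarith
  have e : r ^ t = r ^ k₂ * r ^ k₀ / (r ^ k₁) ^ 2 := by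
    rw [ht, Real.rpow_sub hr, Real.rpow_add hr, Real.rpow_natCast, Real.rpow_natCast, ← pow_mul']
    congr 1
    rw [← Real.rpow_natCast]
    push_cast
    rfl
  calc (K ^ 4)⁻¹ * (A₀ * A₂ / A₁ ^ 2) * r ^ t =
        K⁻¹ * (A₀ * r ^ k₀) * (K⁻¹ * (A₂ * r ^ k₂)) / (K * (A₁ * r ^ k₁)) ^ 2 := by
        rw [e]; field_simp
    _ ≤ l₀ * l₂ / l₁ ^ 2 := by
        have : 0 < l₀ := lt_of_lt_of_le (by positivity) h₀
        have : 0 < l₂ := lt_of_lt_of_le (by positivity) h₂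
        gcongr

lemma Narrow.rpow_ge {w : ℂ} (h : Narrow w) (hw : w ≠ 0) (p : ℝ) :
    ((2 : ℝ) ^ |p|)⁻¹ * w.re ^ p ≤ ‖w‖ ^ p := by
  have h1 := h.norm_le
  have h2 := norm_pos_iff.mpr hw
  have h3 := Complex.re_le_norm w
  rw [inv_mul_le_iff₀ (by positivity)]
  exact rpow_le_abs_mul (by linarith) h2 one_le_two (by linarith) (by linarith) p

lemma piece_pointwise {Γ : Curve} {K : ℝ} {b z ω ωu ωv : ℂ} {k : Fin 3 → ℕ} {A : Fin 3 → ℝ}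
    (hK : 1 ≤ K) (hA : ∀ i, 0 < A i) (hω : ‖ω‖ = 1) (hωu : ‖ωu‖ = 1) (hωv : ‖ωv‖ = 1) (hz : z ≠ b)
    (hm : ∀ i, K⁻¹ * (A i * ‖z - b‖ ^ k i) ≤ ‖(L Γ i).eval z‖ ∧
      ‖(L Γ i).eval z‖ ≤ K * (A i * ‖z - b‖ ^ k i))
    (h : Narrow (ω * (z - b)) ∧ Narrow (ωu * slope Γ z) ∧ Narrow (ωv * torsion Γ z)) :
    (∀ i, (L Γ i).eval z ≠ 0) ∧
    1 / 2 * ((K ^ 3)⁻¹ * (A 1 / A 0 ^ 2)) * ((2 : ℝ) ^ |(σ₂ k : ℝ)|)⁻¹ *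
      (ω * (z - b)).re ^ (σ₂ k : ℝ) ≤ (ωu * slope Γ z).re ∧
    1 / 2 * ((K ^ 4)⁻¹ * (A 0 * A 2 / A 1 ^ 2)) * ((2 : ℝ) ^ |(σ₃ k : ℝ)|)⁻¹ *
      (ω * (z - b)).re ^ (σ₃ k : ℝ) ≤ (ωv * torsion Γ z).re := by
  obtain ⟨n1, n2, n3⟩ := h
  have hr : 0 < ‖z - b‖ := norm_pos_iff.mpr (sub_ne_zero.mpr hz)
  have hK0 : 0 < K := by linarith
  have hL : ∀ i, 0 < ‖(L Γ i).eval z‖ := fun i =>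
    lt_of_lt_of_le (by have := hA i; positivity) (hm i).1
  have hw : ‖ω * (z - b)‖ = ‖z - b‖ := by rw [norm_mul, hω, one_mul]
  have hw0 : ω * (z - b) ≠ 0 := norm_pos_iff.mp (by rw [hw]; exact hr)
  refine ⟨fun i => norm_pos_iff.mp (hL i), ?_, ?_⟩
  · have h1 := slope_ge hK (hA 0) (hA 1) hr (hL 0) (hm 0).2 (hm 1).1
      (s := (σ₂ k : ℝ)) (by simp [σ₂])
    have h2 := n2.2
    have h3 : ‖ωu * slope Γ z‖ = ‖(L Γ 1).eval z‖ / ‖(L Γ 0).eval z‖ ^ 2 := by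
      rw [norm_mul, hωu, one_mul, slope, norm_div, norm_pow]
      rfl
    have h4 := n1.rpow_ge hw0 (σ₂ k : ℝ)
    rw [hw] at h4
    have hA0 := hA 0
    have hA1 := hA 1
    calc _ = 1 / 2 * ((K ^ 3)⁻¹ * (A 1 / A 0 ^ 2)) * (((2 : ℝ) ^ |(σ₂ k : ℝ)|)⁻¹ *
          (ω * (z - b)).re ^ (σ₂ k : ℝ)) := by ring
      _ ≤ 1 / 2 * ((K ^ 3)⁻¹ * (A 1 / A 0 ^ 2)) * ‖z - b‖ ^ (σ₂ k : ℝ) := by gcongr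
      _ = 1 / 2 * ((K ^ 3)⁻¹ * (A 1 / A 0 ^ 2) * ‖z - b‖ ^ (σ₂ k : ℝ)) := by ring
      _ ≤ 1 / 2 * ‖ωu * slope Γ z‖ := by rw [h3]; gcongr
      _ ≤ _ := by linarith [norm_nonneg (ωu * slope Γ z)]
  · have h1 := torsion_ge hK (hA 0) (hA 1) (hA 2) hr (hL 1) (hm 0).1 (hm 1).2 (hm 2).1
      (t := (σ₃ k : ℝ)) (by simp [σ₃])
    have h2 := n3.2
    have h3 : ‖ωv * torsion Γ z‖ =
        ‖(L Γ 0).eval z‖ * ‖(L Γ 2).eval z‖ / ‖(L Γ 1).eval z‖ ^ 2 := by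
      rw [norm_mul, hωv, one_mul, torsion, norm_div, norm_mul, norm_pow]
      rfl
    have h4 := n1.rpow_ge hw0 (σ₃ k : ℝ)
    rw [hw] at h4
    have hA0 := hA 0
    have hA1 := hA 1
    have hA2 := hA 2
    calc _ = 1 / 2 * ((K ^ 4)⁻¹ * (A 0 * A 2 / A 1 ^ 2)) * (((2 : ℝ) ^ |(σ₃ k : ℝ)|)⁻¹ *
          (ω * (z - b)).re ^ (σ₃ k : ℝ)) := by ring
      _ ≤ 1 / 2 * ((K ^ 4)⁻¹ * (A 0 * A 2 / A 1 ^ 2)) * ‖z - b‖ ^ (σ₃ k : ℝ) := by gcongr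
      _ = 1 / 2 * ((K ^ 4)⁻¹ * (A 0 * A 2 / A 1 ^ 2) * ‖z - b‖ ^ (σ₃ k : ℝ)) := by ring
      _ ≤ 1 / 2 * ‖ωv * torsion Γ z‖ := by rw [h3]; gcongr
      _ ≤ _ := by linarith [norm_nonneg (ωv * torsion Γ z)]

end PointwiseBounds

/-! ### The inequality at the vertex opposite the longest side. -/

section CoreBound

/-- The right-hand side of the geometric inequality. -/
def geomProduct (Γ : Curve) (z₁ z₂ z₃ : ℂ) : ℝ :=
  (‖(L₃ Γ).eval z₁‖ ^ (1 / 3 : ℝ) * ‖(L₃ Γ).eval z₂‖ ^ (1 / 3 : ℝ) *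
    ‖(L₃ Γ).eval z₃‖ ^ (1 / 3 : ℝ)) * (‖z₂ - z₁‖ * ‖z₃ - z₁‖ * ‖z₃ - z₂‖)

lemma rpow_third_prod_le {K A r₁ r₂ r₃ l₁ l₂ l₃ q : ℝ} {k₀ k₂ : ℕ} (hK : 1 ≤ K) (hA : 0 < A)
    (h₁ : 0 < r₁) (h₂ : 0 < r₂) (h₃ : 0 < r₃) (p₁ : 0 ≤ l₁) (p₂ : 0 ≤ l₂) (p₃ : 0 ≤ l₃)
    (hl₁ : l₁ ≤ K * (A * r₁ ^ k₂)) (hl₂ : l₂ ≤ K * (A * r₂ ^ k₂)) (hl₃ : l₃ ≤ K * (A * r₃ ^ k₂))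
    (hq : 3 * q = k₂ - 3 * k₀) :
    l₁ ^ (1 / 3 : ℝ) * l₂ ^ (1 / 3 : ℝ) * l₃ ^ (1 / 3 : ℝ) ≤
      K * A * ((r₁ * r₂ * r₃) ^ k₀ * (r₁ * r₂ * r₃) ^ q) := by
  have hK0 : 0 < K := by linarith
  have hR : 0 < r₁ * r₂ * r₃ := by positivity
  have e1 : (r₁ * r₂ * r₃) ^ k₀ * (r₁ * r₂ * r₃) ^ q =
      ((r₁ * r₂ * r₃) ^ k₂) ^ (1 / 3 : ℝ) := by
    rw [← Real.rpow_natCast, ← Real.rpow_natCast, ← Real.rpow_add hR, ← Real.rpow_mul hR.le]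
    congr 1
    linarith
  have e2 : K * A = ((K * A) ^ 3) ^ (1 / 3 : ℝ) := by
    rw [← Real.rpow_natCast, ← Real.rpow_mul (by positivity)]
    norm_num
  rw [← Real.mul_rpow p₁ p₂, ← Real.mul_rpow (by positivity) p₃, e1, e2,
    ← Real.mul_rpow (by positivity) (by positivity)]
  refine Real.rpow_le_rpow (by positivity) ?_ (by norm_num)
  calc l₁ * l₂ * l₃ ≤ (K * (A * r₁ ^ k₂)) * (K * (A * r₂ ^ k₂)) * (K * (A * r₃ ^ k₂)) := by gcongr
    _ = _ := by ring

lemma cancel_constants {κ m γ c₁ g K A₀ A₂ ρ Y d₁ d₃ D : ℝ} (hg : g ≠ 0) (hK : K ≠ 0)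
    (hA₀ : A₀ ≠ 0) :
    κ * (1 / 8) * m * γ * c₁ * g⁻¹ * K⁻¹ * ((K * A₂ * (ρ * (g * Y))) * (d₁ * D * d₃)) =
      κ * A₀ ^ 3 * ρ * (d₁ * d₃) * (1 / 8 * (m * (γ * (A₂ / A₀ ^ 3))) * (c₁ * (Y * D))) := by
  field_simp

-- Reduction to the real inequality, which enters as a hypothesis. That hypothesis may use the ratio
-- of the two outer radii, so that both the general and the logarithmic exponents are covered.
set_option maxHeartbeats 1000000 in
lemma exists_core_bound {K c₁ : ℝ} (hK : 1 ≤ K) (hc₁ : 0 < c₁) (k : Fin 3 → ℕ) :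
    ∃ c : ℝ, 0 < c ∧ ∀ (Γ : Curve) (B : Set ℂ) (b : ℂ) (A : Fin 3 → ℝ),
      IsPiece Γ (1 / 1000) K B b k → (∀ i, 0 < A i) →
      (∀ i, ∀ z ∈ B, K⁻¹ * (A i * ‖z - b‖ ^ k i) ≤ ‖(L Γ i).eval z‖ ∧
        ‖(L Γ i).eval z‖ ≤ K * (A i * ‖z - b‖ ^ k i)) →
      ∀ z₁ ∈ B, ∀ z₂ ∈ B, ∀ z₃ ∈ B, z₁ ≠ b → z₂ ≠ b → z₃ ≠ b →
        ‖z₁ - b‖ ≤ ‖z₃ - b‖ → ‖z₃ - z₂‖ ≤ ‖z₃ - z₁‖ → ‖z₁ - z₂‖ ≤ ‖z₃ - z₁‖ →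
        (∀ x₁ x₂ x₃ d₁ d₃ E₁ E₃ F₁ F₃ : ℝ, RadialConfig x₁ x₂ x₃ d₁ d₃ →
          x₃ ≤ 2 * (‖z₃ - b‖ / ‖z₁ - b‖) * x₁ →
          SideBounds (σ₂ k) (σ₃ k) x₁ x₂ x₃ E₁ E₃ F₁ F₃ →
          c₁ * ((x₁ * x₂ * x₃) ^ ((2 * σ₂ k + σ₃ k : ℝ) / 3) * (d₁ + d₃)) ≤
            d₃ * (E₁ * F₃) + d₁ * (E₃ * F₁)) →
        c * geomProduct Γ z₁ z₂ z₃ ≤ ‖jacobian Γ ![z₁, z₂, z₃]‖ := by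
  set s : ℝ := (σ₂ k : ℝ) with hs
  set t : ℝ := (σ₃ k : ℝ) with ht
  set q : ℝ := (2 * s + t) / 3 with hq
  have hq3 : 3 * q = k 2 - 3 * k 0 := by
    rw [hq, hs, ht]
    simp only [σ₂, σ₃]
    push_cast
    ring
  have hK0 : 0 < K := by linarith
  set cu : ℝ := 1 / 2 * (K ^ 3)⁻¹ * ((2 : ℝ) ^ |s|)⁻¹ with hcu
  set cv : ℝ := 1 / 2 * (K ^ 4)⁻¹ * ((2 : ℝ) ^ |t|)⁻¹ with hcv
  have hcu0 : 0 < cu := by positivity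
  have hcv0 : 0 < cv := by positivity
  set mE : ℝ := ((2 : ℝ) ^ |s|)⁻¹ / 10 with hmE
  set mF : ℝ := ((2 : ℝ) ^ |s|)⁻¹ * ((2 : ℝ) ^ |t|)⁻¹ / 800 with hmF
  have hmE0 : 0 < mE := by positivity
  have hmF0 : 0 < mF := by positivity
  -- Origin of the factors: K⁻³ from the three values of L₁, 1/8 from the angle and the products in
  -- the cone, `mE * mF` and `cu ^ 2 * cv` from the integrals and their integrands, `c₁` from the
  -- real inequality, 8^(-|q|) from replacing |z - b| by its projection, and K⁻¹ from L₃.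
  refine ⟨(K ^ 3)⁻¹ * (1 / 8) * (mE * mF) * (cu ^ 2 * cv) * c₁ * ((8 : ℝ) ^ |q|)⁻¹ * K⁻¹,
    by positivity, ?_⟩
  intro Γ B b A hP hA hm z₁ hz₁ z₂ hz₂ z₃ hz₃ hb₁ hb₂ hb₃ hr hs32 hs12 H
  by_cases h12 : z₁ = z₂
  · simp [geomProduct, h12]
  by_cases h32 : z₃ = z₂
  · simp [geomProduct, h32]
  have h12' : z₁ - z₂ ≠ 0 := sub_ne_zero.mpr h12
  have h32' : z₃ - z₂ ≠ 0 := sub_ne_zero.mpr h32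
  obtain ⟨ω, ωu, ωv, hω, hωu, hωv, hN⟩ := hP.exists_rotations
  set X : ℂ → ℝ := fun z => (ω * (z - b)).re with hX
  have hXpos : ∀ z ∈ B, z ≠ b → 0 < X z := fun z hz hzb => by
    have h1 := (hN z hz).1.2
    rw [norm_mul, hω, one_mul] at h1
    have := norm_pos_iff.mpr (sub_ne_zero.mpr hzb)
    simp only [hX]
    linarith
  have hXle : ∀ z, X z ≤ ‖z - b‖ := fun z => by
    have h1 := Complex.re_le_norm (ω * (z - b))
    rwa [norm_mul, hω, one_mul] at h1
  have hXge : ∀ z ∈ B, ‖z - b‖ ≤ 101 / 99 * X z := fun z hz => by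
    have h1 := (hN z hz).1.norm_le
    rwa [norm_mul, hω, one_mul] at h1
  have hXseg : ∀ (a : ℂ) (τ : ℝ), X (z₂ + τ * a) = X z₂ + τ * (X (z₂ + a) - X z₂) := by
    intro a τ
    simp only [hX]
    rw [← Complex.sub_re, ← Complex.re_ofReal_mul, ← Complex.add_re]
    congr 1
    ring
  -- The projection X is affine along the segment and positive at both ends, so the segment misses
  -- b.
  have hseg : ∀ z ∈ B, z ≠ b → ∀ τ ∈ Set.Icc (0 : ℝ) 1, z₂ + τ * (z - z₂) ∈ B ∧ z₂ + τ * (z - z₂) ≠ b := by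
    intro z hz hzb τ hτ
    refine ⟨?_, ?_⟩
    · have := hP.convex.add_smul_sub_mem hz₂ hz hτ
      rwa [Complex.real_smul] at this
    · intro h
      have h1 := hXseg (z - z₂) τ
      rw [h, add_sub_cancel] at h1
      have h2 : X b = 0 := by simp [hX]
      have h3 := hXpos z hz hzb
      have h4 := hXpos z₂ hz₂ hb₂
      rw [h2] at h1
      rcases hτ.1.eq_or_lt with h5 | h5
      · rw [← h5] at h1
        linarith
      · nlinarith [hτ.2, mul_pos h5 h3]
  set α : ℝ := cu * (A 1 / A 0 ^ 2) with hα
  set β : ℝ := cv * (A 0 * A 2 / A 1 ^ 2) with hβ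
  have hA0 := hA 0
  have hA1 := hA 1
  have hA2 := hA 2
  have hα0 : 0 < α := by positivity
  have hβ0 : 0 < β := by positivity
  have hpt : ∀ z ∈ B, z ≠ b → (∀ i, (L Γ i).eval z ≠ 0) ∧ α * X z ^ s ≤ (ωu * slope Γ z).re ∧
      β * X z ^ t ≤ (ωv * torsion Γ z).re := by
    intro z hz hzb
    obtain ⟨e1, e2, e3⟩ := piece_pointwise hK hA hω hωu hωv hzb (fun i => hm i z hz) (hN z hz)
    refine ⟨e1, le_trans (le_of_eq ?_) e2, le_trans (le_of_eq ?_) e3⟩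
    · rw [hα, hcu]; ring
    · rw [hβ, hcv]; ring
  have hside : ∀ z ∈ B, z ≠ b → z - z₂ ≠ 0 → ∀ w : ℝ, 0 < w → X z₂ ≤ 5 * w → X z ≤ 5 * w → _ :=
    fun z hz hzb hza w hw hw1 hw2 =>
    side_bounds (Γ := Γ) (ωu := ωu) (ωv := ωv) (z := z₂) (a := z - z₂) (x := X z₂) (y := X z)
      (w := w) (s := s) (t := t) (α := α) (β := β) hza
      (fun τ hτ => (hpt _ (hseg z hz hzb τ hτ).1 (hseg z hz hzb τ hτ).2).1 0)
      (fun τ hτ => (hpt _ (hseg z hz hzb τ hτ).1 (hseg z hz hzb τ hτ).2).1 1)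
      (fun τ hτ => (hN _ (hseg z hz hzb τ hτ).1).2.1.1)
      (fun τ hτ => (hN _ (hseg z hz hzb τ hτ).1).2.2.1)
      (hXpos z₂ hz₂ hb₂) (hXpos z hz hzb) hw hw1 hw2 hα0 hβ0
      (fun τ hτ => by
        have := (hpt _ (hseg z hz hzb τ hτ).1 (hseg z hz hzb τ hτ).2).2.1
        rwa [hXseg, add_sub_cancel] at this)
      (fun τ hτ => by
        have := (hpt _ (hseg z hz hzb τ hτ).1 (hseg z hz hzb τ hτ).2).2.2
        rwa [hXseg, add_sub_cancel] at this)
  have hsub : ∀ z z' : ℂ, ω * (z - b) - ω * (z' - b) = ω * (z - z') := fun z z' => by ring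
  have hnsub : ∀ z z' : ℂ, ‖ω * (z - b) - ω * (z' - b)‖ = ‖z - z'‖ := fun z z' => by
    rw [hsub, norm_mul, hω, one_mul]
  have hω0 : ω ≠ 0 := norm_pos_iff.mp (by rw [hω]; exact one_pos)
  have hRC : RadialConfig (X z₁) (X z₂) (X z₃) ‖z₁ - z₂‖ ‖z₃ - z₂‖ := by
    have := radialConfig_of_narrow (hN z₁ hz₁).1 (hN z₂ hz₂).1 (hN z₃ hz₃).1
      (mul_ne_zero hω0 (sub_ne_zero.mpr hb₁)) (mul_ne_zero hω0 (sub_ne_zero.mpr hb₂))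
      (mul_ne_zero hω0 (sub_ne_zero.mpr hb₃)) (by rwa [norm_mul, norm_mul, hω, one_mul, one_mul])
      (by rwa [hnsub, hnsub]) (by rwa [hnsub, hnsub])
    rwa [hnsub, hnsub] at this
  obtain ⟨a1, a2, a3, a4, a5, a6, a7⟩ := hside z₁ hz₁ hb₁ h12' (X z₂) hRC.pos₂
    (by linarith [hRC.pos₂]) hRC.le₁₂
  obtain ⟨b1, b2, b3, b4, b5, b6, b7⟩ := hside z₃ hz₃ hb₃ h32' (X z₃) hRC.pos₃ hRC.le₂₃
    (by linarith [hRC.pos₃])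
  have emE : ((2 : ℝ) ^ |s|)⁻¹ * α / 10 = mE * α := by rw [hmE]; ring
  have emF : ((2 : ℝ) ^ |s|)⁻¹ * ((2 : ℝ) ^ |t|)⁻¹ * (α * β) / 800 = mF * (α * β) := by rw [hmF]; ring
  rw [emE] at a3 a4 b3 b4
  rw [emF] at a5 a6 a7 b5 b6 b7
  set P₁ := sideFst Γ ωu z₂ (z₁ - z₂)
  set P₃ := sideFst Γ ωu z₂ (z₃ - z₂)
  set Q₁ := sideSnd Γ ωu ωv z₂ (z₁ - z₂)
  set Q₃ := sideSnd Γ ωu ωv z₂ (z₃ - z₂)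
  have y1 := hRC.pos₁
  have y2 := hRC.pos₂
  have y3 := hRC.pos₃
  have hSB : SideBounds s t (X z₁) (X z₂) (X z₃) (P₁.re / (mE * α)) (P₃.re / (mE * α))
      (Q₁.re / (mF * (α * β))) (Q₃.re / (mF * (α * β))) :=
    { E₁_near := by
        rw [Real.rpow_zero, one_mul, sub_zero]
        rw [← Real.rpow_add y2] at a3
        convert a3 using 2
        ring
      E₁_far := by
        rw [sub_add_cancel_left]
        exact a4
      E₃_near := by
        rw [sub_add_cancel_left]
        exact b3
      E₃_far := by
        rw [Real.rpow_zero, one_mul, sub_zero]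
        rw [← Real.rpow_add y3] at b4
        convert b4 using 2
        ring
      F₁_near := by
        rw [Real.rpow_zero, one_mul, sub_zero]
        rw [← Real.rpow_add y2] at a5
        convert a5 using 2
        ring
      F₁_mid := by
        rw [mul_comm (_ ^ (t + 1)), mul_assoc, ← Real.rpow_add y2] at a6
        convert a6 using 3
        ring
      F₁_far := by
        convert a7 using 3
        ring
      F₃_near := by
        convert b5 using 3
        ring
      F₃_mid := by
        rw [mul_assoc, ← Real.rpow_add y3] at b6
        convert b6 using 3
        ring
      F₃_far := by
        rw [Real.rpow_zero, one_mul, sub_zero]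
        rw [← Real.rpow_add y3] at b7
        convert b7 using 2
        ring }
  have hratio : X z₃ ≤ 2 * (‖z₃ - b‖ / ‖z₁ - b‖) * X z₁ := by
    have n1 := norm_pos_iff.mpr (sub_ne_zero.mpr hb₁)
    have n3 := norm_pos_iff.mpr (sub_ne_zero.mpr hb₃)
    have e1 := hXle z₃
    have e2 := hXge z₁ hz₁
    have e3 : ‖z₃ - b‖ / ‖z₁ - b‖ * ‖z₁ - b‖ ≤ ‖z₃ - b‖ / ‖z₁ - b‖ * (2 * X z₁) := by
      gcongr
      linarith
    rw [div_mul_cancel₀ _ n1.ne'] at e3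
    linarith
  have hmain := H _ _ _ _ _ _ _ _ _ hRC hratio hSB
  have hωu0 : ωu ≠ 0 := norm_pos_iff.mp (by rw [hωu]; exact one_pos)
  have hωv0 : ωv ≠ 0 := norm_pos_iff.mp (by rw [hωv]; exact one_pos)
  have hJ := jacobian_eq_sides (Γ := Γ) hωu0 hωv0 ((hpt z₁ hz₁ hb₁).1 0) ((hpt z₂ hz₂ hb₂).1 0)
    ((hpt z₃ hz₃ hb₃).1 0) h12' h32'
  have hJn : ‖jacobian Γ ![z₁, z₂, z₃]‖ = ‖(L Γ 0).eval z₁‖ * ‖(L Γ 0).eval z₂‖ *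
      ‖(L Γ 0).eval z₃‖ * (‖z₁ - z₂‖ * ‖z₃ - z₂‖) *
      ‖(z₃ - z₂) * (P₁ * Q₃) - (z₁ - z₂) * (P₃ * Q₁)‖ := by
    have := congrArg norm hJ
    rw [norm_mul, norm_mul, norm_pow, hωu, hωv, one_pow, one_mul, one_mul] at this
    rw [this, norm_neg, norm_mul, norm_mul, norm_mul, norm_mul, norm_mul]
    rfl
  have hPQ13 := Cone.mul (by norm_num) (by norm_num) (by norm_num) a1 b2
  have hPQ31 := Cone.mul (by norm_num) (by norm_num) (by norm_num) b1 a2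
  -- The products lie in the cone with κ = (3/2)(1/200 + 3/200) = 3/100, below the permitted 1/20.
  have hang := norm_sub_ge_of_angle (a₁ := z₁ - z₂) (a₃ := z₃ - z₂) (by norm_num) (by norm_num)
    (by rwa [sub_sub_sub_cancel_right]) (by rwa [sub_sub_sub_cancel_right]) hPQ13.1 hPQ31.1
  have hlow : 1 / 8 * (mE * mF * (α ^ 2 * β)) * (‖z₃ - z₂‖ * (P₁.re / (mE * α) *
      (Q₃.re / (mF * (α * β)))) + ‖z₁ - z₂‖ * (P₃.re / (mE * α) * (Q₁.re / (mF * (α * β))))) ≤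
      ‖(z₃ - z₂) * (P₁ * Q₃) - (z₁ - z₂) * (P₃ * Q₁)‖ := by
    refine le_trans ?_ hang
    have e1 : ‖z₃ - z₂‖ * (1 / 2 * (P₁.re * Q₃.re)) ≤ ‖z₃ - z₂‖ * (P₁ * Q₃).re := by
      gcongr
      exact hPQ13.2
    have e2 : ‖z₁ - z₂‖ * (1 / 2 * (P₃.re * Q₁.re)) ≤ ‖z₁ - z₂‖ * (P₃ * Q₁).re := by
      gcongr
      exact hPQ31.2
    have e3 : 1 / 8 * (mE * mF * (α ^ 2 * β)) * (‖z₃ - z₂‖ * (P₁.re / (mE * α) *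
      (Q₃.re / (mF * (α * β)))) + ‖z₁ - z₂‖ * (P₃.re / (mE * α) * (Q₁.re / (mF * (α * β))))) =
      1 / 8 * (‖z₃ - z₂‖ * (P₁.re * Q₃.re) + ‖z₁ - z₂‖ * (P₃.re * Q₁.re)) := by
      field_simp
    rw [e3]
    linarith
  have hLLL : (K ^ 3)⁻¹ * A 0 ^ 3 * (‖z₁ - b‖ * ‖z₂ - b‖ * ‖z₃ - b‖) ^ k 0 ≤
      ‖(L Γ 0).eval z₁‖ * ‖(L Γ 0).eval z₂‖ * ‖(L Γ 0).eval z₃‖ := by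
    calc _ = K⁻¹ * (A 0 * ‖z₁ - b‖ ^ k 0) * (K⁻¹ * (A 0 * ‖z₂ - b‖ ^ k 0)) *
          (K⁻¹ * (A 0 * ‖z₃ - b‖ ^ k 0)) := by
          rw [mul_pow, mul_pow]
          field_simp
      _ ≤ _ := by
        gcongr
        · exact (hm 0 z₁ hz₁).1
        · exact (hm 0 z₂ hz₂).1
        · exact (hm 0 z₃ hz₃).1
  have n1 := norm_pos_iff.mpr (sub_ne_zero.mpr hb₁)
  have n2 := norm_pos_iff.mpr (sub_ne_zero.mpr hb₂)
  have n3 := norm_pos_iff.mpr (sub_ne_zero.mpr hb₃)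
  have hLthird := rpow_third_prod_le hK hA2 n1 n2 n3 (norm_nonneg _) (norm_nonneg _) (norm_nonneg _)
    (hm 2 z₁ hz₁).2 (hm 2 z₂ hz₂).2 (hm 2 z₃ hz₃).2 hq3
  have hXR : (‖z₁ - b‖ * ‖z₂ - b‖ * ‖z₃ - b‖) ^ q ≤ 8 ^ |q| * (X z₁ * X z₂ * X z₃) ^ q := by
    have g1 : ‖z₁ - b‖ ≤ 2 * X z₁ := by linarith [hXge z₁ hz₁]
    have g2 : ‖z₂ - b‖ ≤ 2 * X z₂ := by linarith [hXge z₂ hz₂]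
    have g3 : ‖z₃ - b‖ ≤ 2 * X z₃ := by linarith [hXge z₃ hz₃]
    have u1 : ‖z₁ - b‖ * ‖z₂ - b‖ * ‖z₃ - b‖ ≤ (2 * X z₁) * (2 * X z₂) * (2 * X z₃) := by gcongr
    have u2 : X z₁ * X z₂ * X z₃ ≤ ‖z₁ - b‖ * ‖z₂ - b‖ * ‖z₃ - b‖ := by
      gcongr <;> exact hXle _
    have u3 : 0 < X z₁ * X z₂ * X z₃ := by positivity
    exact rpow_le_abs_mul (by positivity) u3 (by norm_num) (by linarith) (by linarith) q
  set R := ‖z₁ - b‖ * ‖z₂ - b‖ * ‖z₃ - b‖ with hR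
  have hR0 : 0 < R := by positivity
  have hd : ‖z₃ - z₁‖ ≤ ‖z₁ - z₂‖ + ‖z₃ - z₂‖ := by
    have := norm_sub_le (z₃ - z₂) (z₁ - z₂)
    rw [sub_sub_sub_cancel_right] at this
    linarith
  rw [geomProduct, norm_sub_rev z₂ z₁]
  change _ * ((‖(L Γ 2).eval z₁‖ ^ (1 / 3 : ℝ) * ‖(L Γ 2).eval z₂‖ ^ (1 / 3 : ℝ) *
    ‖(L Γ 2).eval z₃‖ ^ (1 / 3 : ℝ)) * _) ≤ _
  rw [hJn]
  -- The constant `A 1` drops out, and `A 0 ^ 3` will cancel against the product of the values of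
  -- L₁.
  have hAid : α ^ 2 * β = cu ^ 2 * cv * (A 2 / A 0 ^ 3) := by
    rw [hα, hβ]
    field_simp
  calc _ ≤ (K ^ 3)⁻¹ * (1 / 8) * (mE * mF) * (cu ^ 2 * cv) * c₁ * ((8 : ℝ) ^ |q|)⁻¹ * K⁻¹ *
        ((K * A 2 * (R ^ k 0 * R ^ q)) *
          (‖z₁ - z₂‖ * (‖z₁ - z₂‖ + ‖z₃ - z₂‖) * ‖z₃ - z₂‖)) := by gcongr
    _ ≤ (K ^ 3)⁻¹ * (1 / 8) * (mE * mF) * (cu ^ 2 * cv) * c₁ * ((8 : ℝ) ^ |q|)⁻¹ * K⁻¹ *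
        ((K * A 2 * (R ^ k 0 * (8 ^ |q| * (X z₁ * X z₂ * X z₃) ^ q))) *
          (‖z₁ - z₂‖ * (‖z₁ - z₂‖ + ‖z₃ - z₂‖) * ‖z₃ - z₂‖)) := by gcongr
    _ = (K ^ 3)⁻¹ * A 0 ^ 3 * R ^ k 0 * (‖z₁ - z₂‖ * ‖z₃ - z₂‖) *
        (1 / 8 * (mE * mF * (cu ^ 2 * cv * (A 2 / A 0 ^ 3))) * (c₁ * ((X z₁ * X z₂ * X z₃) ^ q *
          (‖z₁ - z₂‖ + ‖z₃ - z₂‖)))) :=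
        cancel_constants (by positivity) hK0.ne' hA0.ne'
    _ ≤ (K ^ 3)⁻¹ * A 0 ^ 3 * R ^ k 0 * (‖z₁ - z₂‖ * ‖z₃ - z₂‖) *
        ‖(z₃ - z₂) * (P₁ * Q₃) - (z₁ - z₂) * (P₃ * Q₁)‖ := by
        gcongr
        rw [← hAid]
        refine le_trans ?_ hlow
        gcongr
    _ ≤ _ := by gcongr

end CoreBound

/-! ### Invariance under relabelling of the three points. -/

section Symmetry

lemma norm_jacobian_swap_outer (Γ : Curve) (a b c : ℂ) :
    ‖jacobian Γ ![c, b, a]‖ = ‖jacobian Γ ![a, b, c]‖ := by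
  rw [← norm_neg, jacobian_formula, jacobian_formula]
  congr 1
  ring

lemma norm_jacobian_swap_right (Γ : Curve) (a b c : ℂ) :
    ‖jacobian Γ ![a, c, b]‖ = ‖jacobian Γ ![a, b, c]‖ := by
  rw [← norm_neg, jacobian_formula, jacobian_formula]
  congr 1
  ring

lemma geomProduct_swap_outer (Γ : Curve) (a b c : ℂ) :
    geomProduct Γ c b a = geomProduct Γ a b c := by
  rw [geomProduct, geomProduct, norm_sub_rev b c, norm_sub_rev a c, norm_sub_rev a b]
  ring

lemma geomProduct_swap_right (Γ : Curve) (a b c : ℂ) :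
    geomProduct Γ a c b = geomProduct Γ a b c := by
  rw [geomProduct, geomProduct, norm_sub_rev b c]
  ring

end Symmetry

/-! ### Assembling the cases and making the constant uniform. -/

section Conclusion

lemma Admissible.ne {k : Fin 3 → ℕ} (h : Admissible k) : σ₃ k ≠ -1 := h.1

lemma Admissible.sum {k : Fin 3 → ℕ} (h : Admissible k) :
    2 * σ₂ k + σ₃ k < -4 ∨ 0 ≤ 2 * σ₂ k + σ₃ k := by
  refine h.2.imp (fun h => ?_) fun h => ?_
  · have : (2 * σ₂ k + σ₃ k : ℝ) < -4 := by linarith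
    exact_mod_cast this
  · have : (0 : ℝ) ≤ 2 * σ₂ k + σ₃ k := by linarith
    exact_mod_cast this

lemma IsPiece.exists_norm_eq {Γ : Curve} {ε K : ℝ} {B : Set ℂ} {b : ℂ} {k : Fin 3 → ℕ}
    (h : IsPiece Γ ε K B b k) {z₁ z₃ : ℂ} (h₁ : z₁ ∈ B) (h₃ : z₃ ∈ B) {r : ℝ}
    (hr₁ : ‖z₁ - b‖ ≤ r) (hr₃ : r ≤ ‖z₃ - b‖) : ∃ w ∈ B, ‖w - b‖ = r := by
  have hc : ContinuousOn (fun z : ℂ => ‖z - b‖) B := by fun_prop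
  exact h.convex.isPreconnected.intermediate_value h₁ h₃ hc ⟨hr₁, hr₃⟩

/-- The real inequality holds for the radii of any three points of an admissible piece. -/
lemma exists_radial_bound_of_admissible (N : ℕ) {K : ℝ} (hK : 1 ≤ K) {k : Fin 3 → ℕ}
    (hk : Admissible k) :
    ∃ c : ℝ, 0 < c ∧ ∀ Γ : Curve, Γ.DegreeLE N → L₃ Γ ≠ 0 →
      ∀ (B : Set ℂ) (b : ℂ) (A : Fin 3 → ℝ) (ε : ℝ), IsPiece Γ ε K B b k → (∀ i, 0 < A i) →
        (∀ i, ∀ z ∈ B, K⁻¹ * (A i * ‖z - b‖ ^ k i) ≤ ‖(L Γ i).eval z‖ ∧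
          ‖(L Γ i).eval z‖ ≤ K * (A i * ‖z - b‖ ^ k i)) →
        ∀ z₁ ∈ B, ∀ z₃ ∈ B, z₁ ≠ b →
        ∀ x₁ x₂ x₃ d₁ d₃ E₁ E₃ F₁ F₃ : ℝ, RadialConfig x₁ x₂ x₃ d₁ d₃ →
          x₃ ≤ 2 * (‖z₃ - b‖ / ‖z₁ - b‖) * x₁ →
          SideBounds (σ₂ k) (σ₃ k) x₁ x₂ x₃ E₁ E₃ F₁ F₃ →
          c * ((x₁ * x₂ * x₃) ^ ((2 * σ₂ k + σ₃ k : ℝ) / 3) * (d₁ + d₃)) ≤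
            d₃ * (E₁ * F₃) + d₁ * (E₃ * F₁) := by
  -- In the logarithmic cases the ratio of the radii is bounded. Convexity makes |w - b| take every
  -- intermediate value on the piece, as the circle argument requires.
  by_cases hlog : σ₂ k = -1 ∨ (σ₂ k = -3 ∧ σ₃ k = 1)
  · obtain ⟨Λ, hΛ, HΛ⟩ := exists_radii_ratio_bound N hK
    obtain ⟨c, hc, H⟩ := exists_radial_bound_of_comparable (σ₂ k) (σ₃ k)
      (show 1 ≤ 2 * Λ by linarith)
    refine ⟨c, hc, fun Γ hΓ hL B b A ε hP hA hm z₁ hz₁ z₃ hz₃ hb₁ x₁ x₂ x₃ d₁ d₃ E₁ E₃ F₁ F₃ hR hx hS =>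
      H _ _ _ _ _ _ _ _ _ hR (hx.trans ?_) hS⟩
    have n1 := norm_pos_iff.mpr (sub_ne_zero.mpr hb₁)
    have := HΛ Γ hΓ hL b k A ‖z₁ - b‖ ‖z₃ - b‖ n1 hA (fun r h1 h2 => by
      obtain ⟨w, hw, hwr⟩ := hP.exists_norm_eq hz₁ hz₃ h1 h2
      refine ⟨w, hwr, fun i => ?_⟩
      rw [← hwr]
      exact hm i w hw) hlog
    have h1 : ‖z₃ - b‖ / ‖z₁ - b‖ ≤ Λ := by rwa [div_le_iff₀ n1]
    have := hR.pos₁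
    gcongr
  · push Not at hlog
    obtain ⟨c, hc, H⟩ := exists_radial_bound hk.ne hk.sum hlog.1 fun h => hlog.2 h.1 h.2
    exact ⟨c, hc, fun Γ hΓ hL B b A ε hP hA hm z₁ hz₁ z₃ hz₃ hb₁ x₁ x₂ x₃ d₁ d₃ E₁ E₃ F₁ F₃ hR hx hS =>
      H _ _ _ _ _ _ _ _ _ hR hS⟩

/-- Both sides are symmetric in the points, so z₂ may be taken opposite the longest side and z₁ no
farther from b than z₃. -/
lemma exists_bound_off_center (N : ℕ) {K : ℝ} (hK : 1 ≤ K) {k : Fin 3 → ℕ} (hk : Admissible k) :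
    ∃ c : ℝ, 0 < c ∧ ∀ Γ : Curve, Γ.DegreeLE N → L₃ Γ ≠ 0 →
      ∀ (B : Set ℂ) (b : ℂ), IsPiece Γ (1 / 1000) K B b k →
        ∀ z₁ ∈ B, ∀ z₂ ∈ B, ∀ z₃ ∈ B, z₁ ≠ b → z₂ ≠ b → z₃ ≠ b →
          c * geomProduct Γ z₁ z₂ z₃ ≤ ‖jacobian Γ ![z₁, z₂, z₃]‖ := by
  obtain ⟨c₁, hc₁, H₁⟩ := exists_radial_bound_of_admissible N hK hk
  obtain ⟨c, hc, H⟩ := exists_core_bound hK hc₁ k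
  refine ⟨c, hc, fun Γ hΓ hL B b hP => ?_⟩
  choose hdeg A hA hm using hP.monomial
  have middle : ∀ z₁ ∈ B, ∀ z₂ ∈ B, ∀ z₃ ∈ B, z₁ ≠ b → z₂ ≠ b → z₃ ≠ b →
      ‖z₃ - z₂‖ ≤ ‖z₃ - z₁‖ → ‖z₁ - z₂‖ ≤ ‖z₃ - z₁‖ →
      c * geomProduct Γ z₁ z₂ z₃ ≤ ‖jacobian Γ ![z₁, z₂, z₃]‖ := by
    intro z₁ h₁ z₂ h₂ z₃ h₃ b₁ b₂ b₃ s₃ s₁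
    rcases le_total ‖z₁ - b‖ ‖z₃ - b‖ with h | h
    · exact H Γ B b A hP hA hm z₁ h₁ z₂ h₂ z₃ h₃ b₁ b₂ b₃ h s₃ s₁
        (H₁ Γ hΓ hL B b A _ hP hA hm z₁ h₁ z₃ h₃ b₁)
    · rw [norm_sub_rev z₃ z₁] at s₃ s₁
      rw [← geomProduct_swap_outer, ← norm_jacobian_swap_outer]
      exact H Γ B b A hP hA hm z₃ h₃ z₂ h₂ z₁ h₁ b₃ b₂ b₁ h s₁ s₃
        (H₁ Γ hΓ hL B b A _ hP hA hm z₃ h₃ z₁ h₁ b₃)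
  intro z₁ h₁ z₂ h₂ z₃ h₃ b₁ b₂ b₃
  have e12 := norm_sub_rev z₁ z₂
  have e13 := norm_sub_rev z₁ z₃
  have e23 := norm_sub_rev z₂ z₃
  by_cases m2 : ‖z₃ - z₂‖ ≤ ‖z₃ - z₁‖ ∧ ‖z₁ - z₂‖ ≤ ‖z₃ - z₁‖
  · exact middle z₁ h₁ z₂ h₂ z₃ h₃ b₁ b₂ b₃ m2.1 m2.2
  by_cases m3 : ‖z₂ - z₃‖ ≤ ‖z₂ - z₁‖ ∧ ‖z₁ - z₃‖ ≤ ‖z₂ - z₁‖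
  · rw [← geomProduct_swap_right, ← norm_jacobian_swap_right]
    exact middle z₁ h₁ z₃ h₃ z₂ h₂ b₁ b₃ b₂ m3.1 m3.2
  · have m1 : ‖z₂ - z₁‖ ≤ ‖z₂ - z₃‖ ∧ ‖z₃ - z₁‖ ≤ ‖z₂ - z₃‖ := by
      by_contra hcon
      rw [not_and_or, not_le, not_le] at m2 m3 hcon
      rcases m2 with m2 | m2 <;> rcases m3 with m3 | m3 <;> rcases hcon with m1 | m1 <;> linarith
    rw [← geomProduct_swap_outer, ← norm_jacobian_swap_outer, ← geomProduct_swap_right,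
      ← norm_jacobian_swap_right]
    exact middle z₃ h₃ z₁ h₁ z₂ h₂ b₃ b₁ b₂ m1.1 m1.2

lemma continuous_jacobian (Γ : Curve) {f₁ f₂ f₃ : ℝ → ℂ} (h₁ : Continuous f₁) (h₂ : Continuous f₂)
    (h₃ : Continuous f₃) : Continuous fun τ => jacobian Γ ![f₁ τ, f₂ τ, f₃ τ] := by
  simp only [jacobian_formula]
  have e : ∀ i, ∀ {f : ℝ → ℂ}, Continuous f → Continuous fun τ => (derivative (Γ i)).eval (f τ) :=
    fun i _ hf => (derivative (Γ i)).continuous.comp hf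
  have := e 0 h₁
  have := e 0 h₂
  have := e 0 h₃
  have := e 1 h₁
  have := e 1 h₂
  have := e 1 h₃
  have := e 2 h₁
  have := e 2 h₂
  have := e 2 h₃
  fun_prop

lemma continuous_geomProduct (Γ : Curve) {f₁ f₂ f₃ : ℝ → ℂ} (h₁ : Continuous f₁)
    (h₂ : Continuous f₂) (h₃ : Continuous f₃) :
    Continuous fun τ => geomProduct Γ (f₁ τ) (f₂ τ) (f₃ τ) := by
  have e : ∀ {f : ℝ → ℂ}, Continuous f → Continuous fun τ => ‖(L₃ Γ).eval (f τ)‖ ^ (1 / 3 : ℝ) :=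
    fun hf => ((L₃ Γ).continuous.comp hf).norm.rpow_const fun _ => Or.inr (by norm_num)
  have := e h₁
  have := e h₂
  have := e h₃
  unfold geomProduct
  fun_prop

/-- The centre may belong to the piece. Moving all points towards some w ≠ b of the piece makes them
avoid b, and both sides are continuous along this motion. If no such w exists, the points coincide
and the product vanishes. -/
lemma exists_bound_on_piece (N : ℕ) {K : ℝ} (hK : 1 ≤ K) {k : Fin 3 → ℕ} (hk : Admissible k) :
    ∃ c : ℝ, 0 < c ∧ ∀ Γ : Curve, Γ.DegreeLE N → L₃ Γ ≠ 0 →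
      ∀ (B : Set ℂ) (b : ℂ), IsPiece Γ (1 / 1000) K B b k →
        ∀ z₁ ∈ B, ∀ z₂ ∈ B, ∀ z₃ ∈ B,
          c * geomProduct Γ z₁ z₂ z₃ ≤ ‖jacobian Γ ![z₁, z₂, z₃]‖ := by
  obtain ⟨c, hc, H⟩ := exists_bound_off_center N hK hk
  refine ⟨c, hc, fun Γ hΓ hL B b hP z₁ h₁ z₂ h₂ z₃ h₃ => ?_⟩
  by_cases hall : z₁ = b ∧ z₂ = b
  · simp [geomProduct, hall.1, hall.2]
  obtain ⟨w, hw, hwb⟩ : ∃ w ∈ B, w ≠ b := by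
    by_contra hcon
    push Not at hcon
    exact hall ⟨hcon z₁ h₁, hcon z₂ h₂⟩
  obtain ⟨ω, _, _, hω, _, _, hN⟩ := hP.exists_rotations
  have hre : ∀ z ∈ B, 0 ≤ (ω * (z - b)).re := fun z hz =>
    Cone.re_nonneg (by norm_num) (hN z hz).1.1
  have hre' : 0 < (ω * (w - b)).re := by
    have h1 := (hN w hw).1.2
    rw [norm_mul, hω, one_mul] at h1
    have := norm_pos_iff.mpr (sub_ne_zero.mpr hwb)
    linarith
  have hmove : ∀ z ∈ B, ∀ τ ∈ Set.Ioc (0 : ℝ) 1, z + τ * (w - z) ∈ B ∧ z + τ * (w - z) ≠ b := by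
    intro z hz τ hτ
    refine ⟨?_, fun h => ?_⟩
    · have := hP.convex.add_smul_sub_mem hz hw ⟨hτ.1.le, hτ.2⟩
      rwa [Complex.real_smul] at this
    · have e : (1 - τ) * (ω * (z - b)).re + τ * (ω * (w - b)).re = 0 := by
        rw [← Complex.re_ofReal_mul, ← Complex.re_ofReal_mul, ← Complex.add_re]
        have : ((1 - τ : ℝ) : ℂ) * (ω * (z - b)) + τ * (ω * (w - b)) =
            ω * (z + τ * (w - z) - b) := by push_cast; ring
        rw [this, h, sub_self, mul_zero, Complex.zero_re]
      have := mul_pos hτ.1 hre'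
      have := mul_nonneg (sub_nonneg.mpr hτ.2) (hre z hz)
      linarith
  have hcont : ∀ z : ℂ, Continuous fun τ : ℝ => z + τ * (w - z) := fun z => by fun_prop
  have t1 : Filter.Tendsto (fun τ : ℝ => c * geomProduct Γ (z₁ + τ * (w - z₁)) (z₂ + τ * (w - z₂))
      (z₃ + τ * (w - z₃))) (nhdsWithin 0 (Set.Ioi 0)) (nhds (c * geomProduct Γ z₁ z₂ z₃)) := by
    have := (((continuous_geomProduct Γ (hcont z₁) (hcont z₂) (hcont z₃)).const_mul c).tendsto
      0).mono_left (nhdsWithin_le_nhds (s := Set.Ioi 0))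
    simpa using this
  have t2 : Filter.Tendsto (fun τ : ℝ => ‖jacobian Γ ![z₁ + τ * (w - z₁), z₂ + τ * (w - z₂),
      z₃ + τ * (w - z₃)]‖) (nhdsWithin 0 (Set.Ioi 0)) (nhds ‖jacobian Γ ![z₁, z₂, z₃]‖) := by
    have := ((continuous_jacobian Γ (hcont z₁) (hcont z₂) (hcont z₃)).norm.tendsto
      0).mono_left (nhdsWithin_le_nhds (s := Set.Ioi 0))
    simpa using this
  refine le_of_tendsto_of_tendsto t1 t2 ?_
  filter_upwards [Ioc_mem_nhdsGT (one_pos : (0 : ℝ) < 1)] with τ hτ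
  exact H Γ hΓ hL B b hP _ (hmove z₁ h₁ τ hτ).1 _ (hmove z₂ h₂ τ hτ).1 _ (hmove z₃ h₃ τ hτ).1
    (hmove z₁ h₁ τ hτ).2 (hmove z₂ h₂ τ hτ).2 (hmove z₃ h₃ τ hτ).2

/-- The exponents are at most the degrees of the Lᵢ, hence at most 3N, so the minimum runs over
finitely many constants. -/
lemma exists_uniform_bound (N : ℕ) {K : ℝ} (hK : 1 ≤ K) :
    ∃ c : ℝ, 0 < c ∧ ∀ Γ : Curve, Γ.DegreeLE N → L₃ Γ ≠ 0 →
      ∀ (B : Set ℂ) (b : ℂ) (k : Fin 3 → ℕ), IsPiece Γ (1 / 1000) K B b k → Admissible k →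
        ∀ z₁ ∈ B, ∀ z₂ ∈ B, ∀ z₃ ∈ B,
          c * geomProduct Γ z₁ z₂ z₃ ≤ ‖jacobian Γ ![z₁, z₂, z₃]‖ := by
  have key : ∀ k : Fin 3 → Fin (3 * N + 1), ∃ c : ℝ, 0 < c ∧
      (Admissible (fun i => (k i : ℕ)) → ∀ Γ : Curve, Γ.DegreeLE N → L₃ Γ ≠ 0 →
      ∀ (B : Set ℂ) (b : ℂ), IsPiece Γ (1 / 1000) K B b (fun i => (k i : ℕ)) →
        ∀ z₁ ∈ B, ∀ z₂ ∈ B, ∀ z₃ ∈ B,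
          c * geomProduct Γ z₁ z₂ z₃ ≤ ‖jacobian Γ ![z₁, z₂, z₃]‖) := by
    intro k
    by_cases hk : Admissible (fun i => (k i : ℕ))
    · obtain ⟨c, hc, H⟩ := exists_bound_on_piece N hK hk
      exact ⟨c, hc, fun _ => H⟩
    · exact ⟨1, one_pos, fun h => absurd h hk⟩
  choose c hc H using key
  obtain ⟨k₀, hk₀⟩ := Finite.exists_min c
  refine ⟨c k₀, hc k₀, fun Γ hΓ hL B b k hP hk z₁ h₁ z₂ h₂ z₃ h₃ => ?_⟩
  have hk3 : ∀ i, k i < 3 * N + 1 := fun i =>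
    Nat.lt_succ_of_le ((hP.monomial i).1.trans (natDegree_L_le hΓ i))
  refine le_trans (mul_le_mul_of_nonneg_right (hk₀ fun i => ⟨k i, hk3 i⟩) ?_)
    (H (fun i => ⟨k i, hk3 i⟩) hk Γ hΓ hL B b hP z₁ h₁ z₂ h₂ z₃ h₃)
  rw [geomProduct]
  positivity

end Conclusion

end GeomIneq

end

theorem lemma3p1 (N : ℕ) :
    ∃ ε : ℝ, 0 < ε ∧
      -- the decomposition of the plane
      (∃ (M : ℕ) (K : ℝ), 1 ≤ K ∧
        ∀ Γ : GeomIneq.Curve, Γ.DegreeLE N → GeomIneq.L₃ Γ ≠ 0 →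
          ∃ (B : Fin M → Set ℂ) (b : Fin M → ℂ) (k : Fin M → Fin 3 → ℕ),
            (⋃ j, B j) = Set.univ ∧
            Pairwise (fun i j => Disjoint (B i) (B j)) ∧
            ∀ j, GeomIneq.IsPiece Γ ε K (B j) (b j) (k j)) ∧
      -- the inequality on each set of the decomposition
      (∀ K : ℝ, 1 ≤ K → ∃ c : ℝ, 0 < c ∧
        ∀ Γ : GeomIneq.Curve, Γ.DegreeLE N → GeomIneq.L₃ Γ ≠ 0 →
          ∀ (B : Set ℂ) (b : ℂ) (k : Fin 3 → ℕ),
            GeomIneq.IsPiece Γ ε K B b k → GeomIneq.Admissible k →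
            ∀ z₁ ∈ B, ∀ z₂ ∈ B, ∀ z₃ ∈ B,
              c * ((‖(GeomIneq.L₃ Γ).eval z₁‖ ^ (1 / 3 : ℝ) *
                    ‖(GeomIneq.L₃ Γ).eval z₂‖ ^ (1 / 3 : ℝ) *
                    ‖(GeomIneq.L₃ Γ).eval z₃‖ ^ (1 / 3 : ℝ)) *
                  (‖z₂ - z₁‖ * ‖z₃ - z₁‖ * ‖z₃ - z₂‖)) ≤
                ‖GeomIneq.jacobian Γ ![z₁, z₂, z₃]‖) := by
  refine ⟨1 / 1000, by norm_num, GeomIneq.exists_decomposition N (by norm_num), fun K hK => ?_⟩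
  obtain ⟨c, hc, H⟩ := GeomIneq.exists_uniform_bound N hK
  exact ⟨c, hc, fun Γ hΓ hL B b k hB hk z₁ h₁ z₂ h₂ z₃ h₃ => H Γ hΓ hL B b k hB hk z₁ h₁ z₂ h₂ z₃ h₃⟩
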